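/- **Theorem (Google File System).** Let $n\ge 1$. Consider process terms built from atomic actions and guards with $\cdot$, $+$, parallel composition $\between$, process creation $\mathbf{new}$, recursion, encapsulation $\partial_H$ and abstraction $\tau_I$. Communication is asynchronous: there is no communication function, so $x\between y=x\parallel y$, and the events of the two sides are concurrent (they may be executed in either order or together in one step), subject only to the causality constraints below. A creation followed by a process satisfies $\mathbf{new}(x)\cdot y=x\between y$, and for a parallel creation $(\mathbf{new}(x_1)\parallel\cdots\parallel\mathbf{new}(x_n))\cdot y=x_1\between\cdots\between x_n\between y$. Guards test a data state, every atomic action can be executed in every data state and may change it, and the data states themselves are not observed. Equality of processes means that, from every initial data state, they are equivalent modulo each of the rooted branching step, rooted branching pomset and rooted branching history-preserving bisimilarities. The actors are given by the following recursive equations, where $s_X(d)$ and $r_X(d)$ send the message $d$ to, and read it from, the mail box $X$, and $O$ is the outside ($1\le i\le n$). * Client: $CA=r_{CA}(DI_{CA})\cdot CA_1$, $CA_1=L_{CA}\cdot CA_2$, $CA_2=s_{Mas}(DI_{Mas})\cdot CA_3$, $CA_3=(r_{CA}(DO_{CSA_1})\parallel\cdots\parallel r_{CA}(DO_{CSA_n}))\cdot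 CA_4$, $CA_4=L'_{CA}\cdot CA_5$, $CA_5=s_O(DO_{CA})\cdot CA$. * Chunk servers: $CSA_i=r_{CSA_i}(DI_{CSA_i})\cdot CSA_{i,1}$, $CSA_{i,1}=L_{CSA_i}\cdot CSA_{i,2}$, $CSA_{i,2}=s_{CA}(DO_{CSA_i})\cdot CSA_i$. * Master: $Mas=r_{Mas}(DI_{Mas})\cdot Mas_1$, $Mas_1=L_{Mas}\cdot Mas_2$, $Mas_2=(\mathbf{new}(CSA_1)\parallel\cdots\parallel\mathbf{new}(CSA_n))\cdot Mas_3$, $Mas_3=(s_{CSA_1}(DI_{CSA_1})\parallel\cdots\parallel s_{CSA_n}(DI_{CSA_n}))\cdot Mas$. Here $L_{CA},L'_{CA},L_{CSA_i},L_{Mas}$ are arbitrary local computations: terms built with $\cdot,+,\between$ from guards and from atomic actions in the sets $I_{CA},I_{CA},I_{CSA_i},I_{Mas}$ of local actions of the respective actor, such that a computation that has been started can always be finished, also when actions that are not local actions of its actor change the data state in the meantime. The causality constraints are $s_{CSA_i}(DI_{CSA_i})\le r_{CSA_i}(DI_{CSA_i})$, $s_{CA}(DO_{CSA_i})\le r_{CA}(DO_{CSA_i})$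 and $s_{Mas}(DI_{Mas})\le r_{Mas}(DI_{Mas})$: the $j$-th occurrence of the sending action must precede the $j$-th occurrence of the reading action, and is then a cause of it. $H$ consists of the occurrences of these communication actions that violate their constraint (under $\partial_H$ they deadlock), and $I$ consists of the occurrences that satisfy it, together with the local actions in $I_{CA}\cup I_{CSA_1}\cup\cdots\cup I_{CSA_n}\cup I_{Mas}$. Then $$\tau_I(\partial_H(CA\between Mas))=\tau_I(\partial_H(CA\between Mas\between CSA_1\between\cdots\between CSA_n)),$$ $$\tau_I(\partial_H(CA\between Mas\between CSA_1\between\cdots\between CSA_n))=r_{CA}(DI_{CA})\cdot s_O(DO_{CA})\cdot\tau_I(\partial_H(CA\between Mas\between CSA_1\between\cdots\between CSA_n)),$$ $$\tau_I(\partial_H(CA\between Mas))=r_{CA}(DI_{CA})\cdot s_O(DO_{CA})\cdot\tau_I(\partial_H(CA\between Mas)).$$ The external behaviour is thus a request–response loop: $\tau_I(\partial_H(CA\between Mas))=\langle X\mid X=r_{CA}(DI_{CA})\cdot s_O(DO_{CA})\cdot X\rangle$. -/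

import Mathlib

/-- The `k`-th entry of a history is the event number `k`: its label (`none` is the silent
label `τ`) and the set of its direct causes. -/
abbrev APTC.History (Act : Type*) := List (Option Act × Set ℕ)

namespace APTC

universe u v w

/-- Process terms with asynchronous communication.  There is no communication function, so the
communication merge is void and `x ≬ y = x ∥ y`: both are the constructor `par`.
`fin D` is the empty process `ε` (successful termination `√`) that remembers the set `D` of the
events that were executed to reach it; `fin ∅` is `ε` itself.
`enc C m x` is `∂_H (x)` for a causality constraint `C`, see `InH`; `m` lists the actions that `x`
has executed under the operator, with their event numbers, so `∂_H (x)` is `enc C [] x`. -/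
inductive Term (Act : Type u) (Var : Type v) (S : Type w) : Type (max u v w)
  | fin (D : Set ℕ)
  | act (a : Act)
  | guard (φ : Set S)
  | seq (x y : Term Act Var S)
  | alt (x y : Term Act Var S)
  | par (x y : Term Act Var S)
  | new (x : Term Act Var S)
  | var (X : Var)
  | enc (C : Set (Act × Act)) (m : List (Act × ℕ)) (x : Term Act Var S)
  | abs (I : Set Act) (x : Term Act Var S)

/-- A recursive specification `X = t_X`. -/
abbrev Spec (Act : Type u) (Var : Type v) (S : Type w) := Var → Term Act Var S

/-- A data environment: executing `a` in the data state `s` leads to some `s' ∈ effect a s`. -/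
structure DataEnv (Act : Type u) (S : Type w) where
  effect : Act → S → Set S
  effect_nonempty : ∀ a s, (effect a s).Nonempty

variable {Act : Type u} {Var : Type v} {S : Type w}

/-- `x₁ ∥ ⋯ ∥ xₙ` -/
def parList : List (Term Act Var S) → Term Act Var S
  | [] => .fin ∅
  | [x] => x
  | x :: y :: l => .par x (parList (y :: l))

/-- The result of the creation `new(x₁) ∥ ⋯ ∥ new(xₙ) → x₁ ≬ ⋯ ≬ xₙ`. -/
def created : Term Act Var S → Option (Term Act Var S)
  | .new x => some x
  | .par x y =>
    match created x, created y with
    | some x', some y' => some (.par x' y')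
    | _, _ => none
  | _ => none

/-- The numbers of the occurrences of `a`, in the order of execution. -/
noncomputable def occ (m : List (Act × ℕ)) (a : Act) : List ℕ :=
  open scoped Classical in (m.filter fun p => p.1 = a).map Prod.snd

/-- A pair `(s, r) ∈ C` is the constraint `s ≤ r`: the `j`-th occurrence of `s` precedes the `j`-th
occurrence of `r`.  The next occurrence of `a` belongs to `H` if it violates a constraint, that is,
if `a` is a receiving action whose sending action has not yet been executed, or a sending action
whose receiving action has been executed already. -/
def InH (C : Set (Act × Act)) (m : List (Act × ℕ)) (a : Act) : Prop :=
  (∃ s, (s, a) ∈ C ∧ (occ m s).length ≤ (occ m a).length) ∨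
    (∃ r, (a, r) ∈ C ∧ (occ m a).length < (occ m r).length)

/-- The sending events that the next occurrence of `a` receives from. -/
def sources (C : Set (Act × Act)) (m : List (Act × ℕ)) (a : Act) : Set ℕ :=
  {i | ∃ s, (s, a) ∈ C ∧ (occ m s)[(occ m a).length]? = some i}

/-- The label after the renaming of the actions in `I` into `τ`. -/
noncomputable def hide (I : Set Act) : Option Act → Option Act
  | none => none
  | some a => open scoped Classical in if a ∈ I then none else some a

/-- `Done E s x D`: in the data state `s`, the process `x` can terminate without executing any
further action, and `D` is the set of the events it has executed. -/
inductive Done (E : Spec Act Var S) (s : S) : Term Act Var S → Set ℕ → Prop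
  | fin (D : Set ℕ) : Done E s (.fin D) D
  | guard {φ : Set S} (h : s ∈ φ) : Done E s (.guard φ) ∅
  | seq {x y : Term Act Var S} {D D' : Set ℕ} (hx : created x = none) (h : Done E s x D)
      (h' : Done E s y D') : Done E s (.seq x y) (D ∪ D')
  | seq_new {x x' y : Term Act Var S} {D : Set ℕ} (hx : created x = some x')
      (h : Done E s (.par x' y) D) : Done E s (.seq x y) D
  | alt_left {x y : Term Act Var S} {D : Set ℕ} (h : Done E s x D) : Done E s (.alt x y) D
  | alt_right {x y : Term Act Var S} {D : Set ℕ} (h : Done E s y D) : Done E s (.alt x y) D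
  | par {x y : Term Act Var S} {D D' : Set ℕ} (h : Done E s x D) (h' : Done E s y D') :
      Done E s (.par x y) (D ∪ D')
  | new {x : Term Act Var S} {D : Set ℕ} (h : Done E s x D) : Done E s (.new x) D
  | var {X : Var} {D : Set ℕ} (h : Done E s (E X) D) : Done E s (.var X) D
  | enc {C : Set (Act × Act)} {m : List (Act × ℕ)} {x : Term Act Var S} {D : Set ℕ}
      (h : Done E s x D) : Done E s (.enc C m x) D
  | abs {I : Set Act} {x : Term Act Var S} {D : Set ℕ} (h : Done E s x D) :
      Done E s (.abs I x) D

/-- `Step E env k s x l K x' s'`: in the data state `s`, the process `x` can execute the event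
number `k`, which has the label `l` and the direct causes `K`, and it becomes `x'` in the data state
`s'`.  The events of the two sides of `x ∥ y` are concurrent: they are executed in any order, and
together as one step, which is the case of events that do not cause each other in
`Bisim.PTrans`. -/
inductive Step (E : Spec Act Var S) (env : DataEnv Act S) (k : ℕ) (s : S) :
    Term Act Var S → Option Act → Set ℕ → Term Act Var S → S → Prop
  | act {a : Act} {s' : S} (h : s' ∈ env.effect a s) :
      Step E env k s (.act a) (some a) ∅ (.fin {k}) s'
  | seq_left {x y x' : Term Act Var S} {l : Option Act} {K : Set ℕ} {s' : S}
      (hx : created x = none) (h : Step E env k s x l K x' s') :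
      Step E env k s (.seq x y) l K (.seq x' y) s'
  | seq_right {x y y' : Term Act Var S} {l : Option Act} {K D : Set ℕ} {s' : S}
      (hx : created x = none) (hD : Done E s x D) (h : Step E env k s y l K y' s') :
      Step E env k s (.seq x y) l (D ∪ K) (.seq (.fin D) y') s'
  -- process creation: `new(x) · y` behaves as `x ≬ y`
  | seq_new {x x₀ y z : Term Act Var S} {l : Option Act} {K : Set ℕ} {s' : S}
      (hx : created x = some x₀) (h : Step E env k s (.par x₀ y) l K z s') :
      Step E env k s (.seq x y) l K z s'
  | alt_left {x y x' : Term Act Var S} {l : Option Act} {K : Set ℕ} {s' : S}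
      (h : Step E env k s x l K x' s') : Step E env k s (.alt x y) l K x' s'
  | alt_right {x y y' : Term Act Var S} {l : Option Act} {K : Set ℕ} {s' : S}
      (h : Step E env k s y l K y' s') : Step E env k s (.alt x y) l K y' s'
  | par_left {x y x' : Term Act Var S} {l : Option Act} {K : Set ℕ} {s' : S}
      (h : Step E env k s x l K x' s') : Step E env k s (.par x y) l K (.par x' y) s'
  | par_right {x y y' : Term Act Var S} {l : Option Act} {K : Set ℕ} {s' : S}
      (h : Step E env k s y l K y' s') : Step E env k s (.par x y) l K (.par x y') s'
  | new {x x' : Term Act Var S} {l : Option Act} {K : Set ℕ} {s' : S}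
      (h : Step E env k s x l K x' s') : Step E env k s (.new x) l K (.new x') s'
  | var {X : Var} {y : Term Act Var S} {l : Option Act} {K : Set ℕ} {s' : S}
      (h : Step E env k s (E X) l K y s') : Step E env k s (.var X) l K y s'
  | enc_tau {C : Set (Act × Act)} {m : List (Act × ℕ)} {x x' : Term Act Var S} {K : Set ℕ}
      {s' : S} (h : Step E env k s x none K x' s') :
      Step E env k s (.enc C m x) none K (.enc C m x') s'
  | enc_act {C : Set (Act × Act)} {m : List (Act × ℕ)} {x x' : Term Act Var S} {a : Act}
      {K : Set ℕ} {s' : S} (h : Step E env k s x (some a) K x' s') (hH : ¬ InH C m a) :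
      Step E env k s (.enc C m x) (some a) (K ∪ sources C m a) (.enc C (m ++ [(a, k)]) x') s'
  | abs {I : Set Act} {x x' : Term Act Var S} {l : Option Act} {K : Set ℕ} {s' : S}
      (h : Step E env k s x l K x' s') :
      Step E env k s (.abs I x) (hide I l) K (.abs I x') s'

/-! ### Configurations, pomset transitions and steps -/

/-- A configuration: the executed events with their causal order, together with the process that
remains and the data state. -/
structure Config (Act : Type u) (Var : Type v) (S : Type w) where
  term : Term Act Var S
  data : S
  hist : History Act

/-- The empty configuration of a process. -/
def init (x : Term Act Var S) (s : S) : Config Act Var S := ⟨x, s, []⟩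

/-- The label of the event number `i`, where `none` means that there is no such event. -/
def labelAt (h : History Act) (i : ℕ) : Option (Option Act) := h[i]?.map Prod.fst

/-- Strict causality, generated by the direct causes. -/
def Before (h : History Act) : ℕ → ℕ → Prop :=
  Relation.TransGen fun i j => ∃ e, h[j]? = some e ∧ i ∈ e.2

/-- The events other than `τ` among the events number `k`, `k + 1`, … -/
def visibleFrom (k : ℕ) (h : History Act) : Set ℕ :=
  {i | k ≤ i ∧ ∃ a, labelAt h i = some (some a)}

/-- `f` is an isomorphism of labelled posets from the set `A` of events of `h₁` onto the set `B` of
events of `h₂`. -/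
structure IsPomsetIso (h₁ : History Act) (A : Set ℕ) (h₂ : History Act) (B : Set ℕ)
    (f : Set (ℕ × ℕ)) : Prop where
  subset : ∀ p ∈ f, p.1 ∈ A ∧ p.2 ∈ B
  label : ∀ p ∈ f, labelAt h₁ p.1 = labelAt h₂ p.2
  total : ∀ i ∈ A, ∃! j, (i, j) ∈ f
  onto : ∀ j ∈ B, ∃! i, (i, j) ∈ f
  order : ∀ p ∈ f, ∀ q ∈ f, Before h₁ p.1 q.1 ↔ Before h₂ p.2 q.2

namespace Bisim

/-- The transition by one event with the label `l`. -/
def Trans (E : Spec Act Var S) (env : DataEnv Act S) (l : Option Act) (c c' : Config Act Var S) :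
    Prop :=
  ∃ K, Step E env c.hist.length c.data c.term l K c'.term c'.data ∧ c'.hist = c.hist ++ [(l, K)]

/-- Zero or more `τ`-transitions. -/
def TauRun (E : Spec Act Var S) (env : DataEnv Act S) :
    Config Act Var S → Config Act Var S → Prop :=
  Relation.ReflTransGen (Trans E env none)

/-- The termination predicate `↓`. -/
def Terminated (E : Spec Act Var S) (c : Config Act Var S) : Prop := ∃ D, Done E c.data c.term D

/-- The two kinds of transitions by sets of events. -/
inductive Kind
  | pomset
  | step

/-- A set of events that a transition of the given kind may execute: any set for a pomset
transition, a set of pairwise concurrent events for a step. -/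
def Kind.Admits (κ : Kind) (h : History Act) (X : Set ℕ) : Prop :=
  κ = .step → ∀ i ∈ X, ∀ j ∈ X, ¬ Before h i j

/-- The pomset transition (step) `c -X→ c'`, where `X ≠ ∅` is the set of the events of `c'` that are
not in `c`. -/
def PTrans (E : Spec Act Var S) (env : DataEnv Act S) (κ : Kind) (c c' : Config Act Var S) :
    Prop :=
  Relation.TransGen (fun d d' => ∃ l, Trans E env l d d') c c' ∧
    κ.Admits c'.hist {i | c.hist.length ≤ i ∧ i < c'.hist.length}

/-- The weak pomset transition (weak step) `c =X⇒ c'`, where `X` is the set of the events other than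
`τ` of `c'` that are not in `c`. -/
def WTrans (E : Spec Act Var S) (env : DataEnv Act S) (κ : Kind) (c c' : Config Act Var S) :
    Prop :=
  Relation.ReflTransGen (fun d d' => ∃ l, Trans E env l d d') c c' ∧
    κ.Admits c'.hist (visibleFrom c.hist.length c'.hist)

/-- The pomsets that are executed from `c₁` to `c₁'` and from `c₂` to `c₂'` are isomorphic, up to
silent events. -/
def SamePomset (c₁ c₁' c₂ c₂' : Config Act Var S) : Prop :=
  ∃ f, IsPomsetIso c₁'.hist (visibleFrom c₁.hist.length c₁'.hist)
    c₂'.hist (visibleFrom c₂.hist.length c₂'.hist) f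

/-- Branching pomset bisimulations and branching step bisimulations.  The data states belong to the
actors; they influence the transitions, but they are not observed. -/
structure IsBranching (E : Spec Act Var S) (env : DataEnv Act S) (κ : Kind)
    (R : Config Act Var S → Config Act Var S → Prop) : Prop where
  forth : ∀ c₁ c₂ c₁', R c₁ c₂ → PTrans E env κ c₁ c₁' →
    (visibleFrom c₁.hist.length c₁'.hist = ∅ ∧ R c₁' c₂) ∨
      ∃ d c₂', TauRun E env c₂ d ∧ R c₁ d ∧ WTrans E env κ d c₂' ∧
        SamePomset c₁ c₁' d c₂' ∧ R c₁' c₂'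
  back : ∀ c₁ c₂ c₂', R c₁ c₂ → PTrans E env κ c₂ c₂' →
    (visibleFrom c₂.hist.length c₂'.hist = ∅ ∧ R c₁ c₂') ∨
      ∃ d c₁', TauRun E env c₁ d ∧ R d c₂ ∧ WTrans E env κ d c₁' ∧
        SamePomset d c₁' c₂ c₂' ∧ R c₁' c₂'
  term_forth : ∀ c₁ c₂, R c₁ c₂ → Terminated E c₁ →
    ∃ d, TauRun E env c₂ d ∧ R c₁ d ∧ Terminated E d
  term_back : ∀ c₁ c₂, R c₁ c₂ → Terminated E c₂ →
    ∃ d, TauRun E env c₁ d ∧ R d c₂ ∧ Terminated E d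

/-- Branching pomset (step) bisimilarity of configurations. -/
def Branching (E : Spec Act Var S) (env : DataEnv Act S) (κ : Kind) (c₁ c₂ : Config Act Var S) :
    Prop :=
  ∃ R, IsBranching E env κ R ∧ R c₁ c₂

/-- Rooted branching pomset (step) bisimilarity `≈_rbp` (`≈_rbs`). -/
structure Rooted (E : Spec Act Var S) (env : DataEnv Act S) (κ : Kind) (c₁ c₂ : Config Act Var S) :
    Prop where
  forth : ∀ c₁', PTrans E env κ c₁ c₁' →
    ∃ c₂', PTrans E env κ c₂ c₂' ∧ SamePomset c₁ c₁' c₂ c₂' ∧ Branching E env κ c₁' c₂'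
  back : ∀ c₂', PTrans E env κ c₂ c₂' →
    ∃ c₁', PTrans E env κ c₁ c₁' ∧ SamePomset c₁ c₁' c₂ c₂' ∧ Branching E env κ c₁' c₂'
  term : Terminated E c₁ ↔ Terminated E c₂

/-- `f[i ↦ j]` for events with the label `l`; silent events do not enter `f`. -/
def update (f : Set (ℕ × ℕ)) (l : Option Act) (i j : ℕ) : Set (ℕ × ℕ) :=
  match l with
  | none => f
  | some _ => insert (i, j) f

/-- Branching history-preserving bisimulations. -/
structure IsBranchingHP (E : Spec Act Var S) (env : DataEnv Act S)
    (R : Config Act Var S → Set (ℕ × ℕ) → Config Act Var S → Prop) : Prop where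
  iso : ∀ c₁ f c₂, R c₁ f c₂ →
    IsPomsetIso c₁.hist (visibleFrom 0 c₁.hist) c₂.hist (visibleFrom 0 c₂.hist) f
  forth : ∀ c₁ f c₂ l c₁', R c₁ f c₂ → Trans E env l c₁ c₁' →
    (l = none ∧ R c₁' f c₂) ∨
      ∃ d c₂', TauRun E env c₂ d ∧ R c₁ f d ∧ Trans E env l d c₂' ∧
        R c₁' (update f l c₁.hist.length d.hist.length) c₂'
  back : ∀ c₁ f c₂ l c₂', R c₁ f c₂ → Trans E env l c₂ c₂' →
    (l = none ∧ R c₁ f c₂') ∨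
      ∃ d c₁', TauRun E env c₁ d ∧ R d f c₂ ∧ Trans E env l d c₁' ∧
        R c₁' (update f l d.hist.length c₂.hist.length) c₂'
  term_forth : ∀ c₁ f c₂, R c₁ f c₂ → Terminated E c₁ →
    ∃ d, TauRun E env c₂ d ∧ R c₁ f d ∧ Terminated E d
  term_back : ∀ c₁ f c₂, R c₁ f c₂ → Terminated E c₂ →
    ∃ d, TauRun E env c₁ d ∧ R d f c₂ ∧ Terminated E d

/-- Branching history-preserving bisimilarity, relative to the isomorphism `f` of the past. -/
def BranchingHP (E : Spec Act Var S) (env : DataEnv Act S) (c₁ : Config Act Var S)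
    (f : Set (ℕ × ℕ)) (c₂ : Config Act Var S) : Prop :=
  ∃ R, IsBranchingHP E env R ∧ R c₁ f c₂

/-- Rooted branching history-preserving bisimilarity `≈_rbhp` of configurations without a past. -/
structure RootedHP (E : Spec Act Var S) (env : DataEnv Act S) (c₁ c₂ : Config Act Var S) :
    Prop where
  forth : ∀ l c₁', Trans E env l c₁ c₁' → ∃ c₂', Trans E env l c₂ c₂' ∧
    BranchingHP E env c₁' (update ∅ l c₁.hist.length c₂.hist.length) c₂'
  back : ∀ l c₂', Trans E env l c₂ c₂' → ∃ c₁', Trans E env l c₁ c₁' ∧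
    BranchingHP E env c₁' (update ∅ l c₁.hist.length c₂.hist.length) c₂'
  term : Terminated E c₁ ↔ Terminated E c₂

end Bisim

/-- Equality of processes: `≈_rbs`, `≈_rbp` and `≈_rbhp`, in every data state. -/
def ProcEq (E : Spec Act Var S) (env : DataEnv Act S) (x y : Term Act Var S) : Prop :=
  ∀ s, Bisim.Rooted E env .step (init x s) (init y s) ∧
    Bisim.Rooted E env .pomset (init x s) (init y s) ∧
    Bisim.RootedHP E env (init x s) (init y s)

/-! ### Local computations -/

/-- A local computation: a term over the local atomic actions in `I` that is built with `·`, `+`,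
`≬` and guards. -/
inductive IsLocal (I : Set Act) : Term Act Var S → Prop
  | act {a : Act} (h : a ∈ I) : IsLocal I (.act a)
  | guard (φ : Set S) : IsLocal I (.guard φ)
  | seq {x y : Term Act Var S} (hx : IsLocal I x) (hy : IsLocal I y) : IsLocal I (.seq x y)
  | alt {x y : Term Act Var S} (hx : IsLocal I x) (hy : IsLocal I y) : IsLocal I (.alt x y)
  | par {x y : Term Act Var S} (hx : IsLocal I x) (hy : IsLocal I y) : IsLocal I (.par x y)

/-- A move of the computation itself. -/
def OwnMove (E : Spec Act Var S) (env : DataEnv Act S) (c c' : Term Act Var S × S) : Prop :=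
  ∃ k l K, Step E env k c.2 c.1 l K c'.1 c'.2

/-- A change of the data state by an action outside `I`, executed elsewhere. -/
def OtherMove (env : DataEnv Act S) (I : Set Act) (c c' : Term Act Var S × S) : Prop :=
  c'.1 = c.1 ∧ ∃ a ∉ I, c'.2 ∈ env.effect a c.2

/-- The computation `x` over the actions in `I` never gets stuck: whenever it has been started, it
can be finished. -/
def Completes (E : Spec Act Var S) (env : DataEnv Act S) (I : Set Act) (x : Term Act Var S) :
    Prop :=
  ∀ s c, Relation.ReflTransGen (fun d d' => OwnMove E env d d' ∨ OtherMove env I d d') (x, s) c →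
    ∃ c' D, Relation.ReflTransGen (OwnMove E env) c c' ∧ Done E c'.2 c'.1 D

end APTC

/-! ### The Google File System -/

namespace GFS

open APTC

universe u w

/-- The names of the actors (and of their mail boxes), and the outside `O`. -/
inductive Name (n : ℕ)
  | CA
  | Mas
  | CSA (i : Fin n)
  | O

inductive Msg (n : ℕ)
  | DI_CA
  | DO_CA
  | DI_Mas
  | DI_CSA (i : Fin n)
  | DO_CSA (i : Fin n)

/-- The atomic actions: `send X d` is `s_X(d)`, `recv X d` is `r_X(d)`, and `loc X a` is a local
action of the actor `X`. -/
inductive Action (n : ℕ) (A : Type u)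
  | send (box : Name n) (d : Msg n)
  | recv (box : Name n) (d : Msg n)
  | loc (owner : Name n) (a : A)

/-- The recursion variables; `Loop` is the variable of the specification `X = r · s · X` of the
request-response loop. -/
inductive Var (n : ℕ)
  | CA | CA₁ | CA₂ | CA₃ | CA₄ | CA₅
  | CSA (i : Fin n) | CSA₁ (i : Fin n) | CSA₂ (i : Fin n)
  | Mas | Mas₁ | Mas₂ | Mas₃
  | Loop

abbrev Proc (n : ℕ) (A : Type u) (S : Type w) := Term (Action n A) (Var n) S

/-- The local computations of the actors. The client has one before it sends its request to the
Master, and one after it has received the chunks. -/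
structure Computations (n : ℕ) (A : Type u) (S : Type w) where
  ca : Proc n A S
  ca' : Proc n A S
  csa : Fin n → Proc n A S
  mas : Proc n A S

variable {n : ℕ} {A : Type u} {S : Type w}

/-- The set `I_X` of the local actions of the actor `X`. -/
def localActions (n : ℕ) (A : Type u) (X : Name n) : Set (Action n A) := Set.range (Action.loc X)

/-- `x₁ ∥ ⋯ ∥ xₙ` -/
def parFin (x : Fin n → Proc n A S) : Proc n A S := parList (List.ofFn x)

open APTC.Term _root_.GFS.Action in
/-- The state transitions of the actors. -/
def spec (L : Computations n A S) : Spec (Action n A) (Var n) S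
  | .CA => seq (act (recv .CA .DI_CA)) (var .CA₁)
  | .CA₁ => seq L.ca (var .CA₂)
  | .CA₂ => seq (act (send .Mas .DI_Mas)) (var .CA₃)
  | .CA₃ => seq (parFin fun i => act (recv .CA (.DO_CSA i))) (var .CA₄)
  | .CA₄ => seq L.ca' (var .CA₅)
  | .CA₅ => seq (act (send .O .DO_CA)) (var .CA)
  | .CSA i => seq (act (recv (.CSA i) (.DI_CSA i))) (var (.CSA₁ i))
  | .CSA₁ i => seq (L.csa i) (var (.CSA₂ i))
  | .CSA₂ i => seq (act (send .CA (.DO_CSA i))) (var (.CSA i))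
  | .Mas => seq (act (recv .Mas .DI_Mas)) (var .Mas₁)
  | .Mas₁ => seq L.mas (var .Mas₂)
  | .Mas₂ => seq (parFin fun i => new (var (.CSA i))) (var .Mas₃)
  | .Mas₃ => seq (parFin fun i => act (send (.CSA i) (.DI_CSA i))) (var .Mas)
  | .Loop => seq (act (recv .CA .DI_CA)) (seq (act (send .O .DO_CA)) (var .Loop))

/-- The causality constraints `s ≤ r` of the asynchronous communications. -/
inductive Constraint (n : ℕ) (A : Type u) : Action n A × Action n A → Prop
  | csa (i : Fin n) :
      Constraint n A (.send (.CSA i) (.DI_CSA i), .recv (.CSA i) (.DI_CSA i))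
  | ca (i : Fin n) : Constraint n A (.send .CA (.DO_CSA i), .recv .CA (.DO_CSA i))
  | mas : Constraint n A (.send .Mas .DI_Mas, .recv .Mas .DI_Mas)

def constraints (n : ℕ) (A : Type u) : Set (Action n A × Action n A) := {p | Constraint n A p}

/-- The set `I` of the internal actions: the communications and the local actions. An occurrence of
a communication action under `∂_H` satisfies its constraint. -/
def internal (n : ℕ) (A : Type u) : Set (Action n A) :=
  {a | ∃ p ∈ constraints n A, a = p.1 ∨ a = p.2} ∪ localActions n A .CA ∪
    (⋃ i, localActions n A (.CSA i)) ∪ localActions n A .Mas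

/-- `τ_I(∂_H(x))` -/
def closed (x : Proc n A S) : Proc n A S := .abs (internal n A) (.enc (constraints n A) [] x)

/-- `τ_I(∂_H(CA ≬ Mas))` -/
def system : Proc n A S := closed (.par (.var .CA) (.var .Mas))

/-- `τ_I(∂_H(CA ≬ Mas ≬ CSA₁ ≬ ⋯ ≬ CSAₙ))` -/
def fullSystem : Proc n A S :=
  closed (.par (.var .CA) (.par (.var .Mas) (parFin fun i => .var (.CSA i))))

/-- `r_CA(DI_CA) · s_O(DO_CA) · x` -/
def respond (x : Proc n A S) : Proc n A S :=
  .seq (.act (.recv .CA .DI_CA)) (.seq (.act (.send .O .DO_CA)) x)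

/-- The local computations consist of local actions of their actors, and they never get stuck. -/
structure Computations.Valid (env : DataEnv (Action n A) S) (L : Computations n A S) : Prop where
  ca_local : IsLocal (localActions n A .CA) L.ca
  ca'_local : IsLocal (localActions n A .CA) L.ca'
  csa_local : ∀ i, IsLocal (localActions n A (.CSA i)) (L.csa i)
  mas_local : IsLocal (localActions n A .Mas) L.mas
  ca_completes : Completes (spec L) env (localActions n A .CA) L.ca
  ca'_completes : Completes (spec L) env (localActions n A .CA) L.ca'
  csa_completes : ∀ i, Completes (spec L) env (localActions n A (.CSA i)) (L.csa i)
  mas_completes : Completes (spec L) env (localActions n A .Mas) L.mas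

end GFS

/-! In both systems every visible event is an action of the client, and the client is a sequential
thread. The visible events therefore form a causal chain in which requests and responses alternate.
Silent events occur only between a request and its response, they do not change the phase, and the
next visible event can always be reached. Two processes of this kind in the same phase are matched
by pairing their visible events in order. On a chain, causality is the order of the event numbers,
so this pairing is a pomset isomorphism, and one argument serves the step, pomset and
history-preserving equivalences. The rooted versions hold because an idle process has no silent
event.

`IsLoop` axiomatises such processes by an invariant, and `IsLoop.procEq` makes any two of them
equal. `IsLoop.looped` enlarges the invariant by the prefix `request · response ·` and by the
variable of the loop. All four equations are then instances, once `isLoop_sysInv` provides an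
invariant that holds of the system with and without the initial chunk servers.

For that invariant, a term is flattened into a multiset of threads (`Flat`, with the transitions
`Fires`). In the round `j`, each of the six kinds of communication has occurred `j` or `j + 1`
times, and the counters decrease along the protocol: request to the master, its reading,
assignments, their reading, replies, their reading. Two facts follow. While the client is idle all
the counters equal `j`, so nobody else can move. And although the master creates fresh servers in
every round, at most one copy of each server is busy: the surplus copies only wait, and a running
local computation is disturbed only by actions of other actors, so that `Completes` applies. The
past of the client contains all the visible events, which gives the causal chain.

Responsiveness (`Good.responds`) is an induction on the number of communications that remain in the
round. The first kind of communication whose counter is still `j` can be executed after the thread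
in charge has finished its local computation; if there is none, the client can finish and respond.
-/

namespace APTC

universe u v w

variable {Act : Type u} {Var : Type v} {S : Type w}

/-! ### Histories -/

/-- The direct causes of an event have smaller numbers. -/
def Causal (h : History Act) : Prop :=
  ∀ (j : ℕ) (e : Option Act × Set ℕ), h[j]? = some e → e.2 ⊆ Set.Iio j

/-- The visible events are totally ordered by causality, in the order of their numbers. -/
def Chain (h : History Act) : Prop :=
  ∀ i ∈ visibleFrom 0 h, ∀ j ∈ visibleFrom 0 h, i < j → Before h i j

theorem lt_length_of_mem_visibleFrom {h : History Act} {k i : ℕ} (hi : i ∈ visibleFrom k h) :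
    i < h.length := by
  obtain ⟨-, a, ha⟩ := hi
  by_contra hlt
  simp [labelAt, List.getElem?_eq_none (not_lt.1 hlt)] at ha

theorem visibleFrom_subset (k : ℕ) (h : History Act) : visibleFrom k h ⊆ visibleFrom 0 h :=
  fun _ hi => ⟨Nat.zero_le _, hi.2⟩

theorem visibleFrom_length (h : History Act) : visibleFrom h.length h = ∅ :=
  Set.eq_empty_of_forall_notMem fun _ hi => (lt_length_of_mem_visibleFrom hi).not_ge hi.1

theorem labelAt_append {h : History Act} {i : ℕ} (hi : i < h.length) (g : History Act) :
    labelAt (h ++ g) i = labelAt h i := by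
  simp [labelAt, List.getElem?_append_left hi]

theorem labelAt_length (h : History Act) (e : Option Act × Set ℕ) :
    labelAt (h ++ [e]) h.length = some e.1 := by
  simp [labelAt]

theorem visibleFrom_append_subset (k : ℕ) (h g : History Act) :
    visibleFrom k h ⊆ visibleFrom k (h ++ g) := fun i hi =>
  ⟨hi.1, by rw [labelAt_append (lt_length_of_mem_visibleFrom hi)]; exact hi.2⟩

theorem mem_visibleFrom_append {k i : ℕ} {h : History Act} {e : Option Act × Set ℕ}
    (hi : i ∈ visibleFrom k (h ++ [e])) : i ∈ visibleFrom k h ∨ i = h.length := by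
  have hlt := lt_length_of_mem_visibleFrom hi
  rw [List.length_append, List.length_singleton] at hlt
  rcases (Nat.lt_succ_iff.1 hlt).lt_or_eq with h' | h'
  · exact .inl ⟨hi.1, by rw [← labelAt_append h' [e]]; exact hi.2⟩
  · exact .inr h'

theorem visibleFrom_append_tau (k : ℕ) (h : History Act) (K : Set ℕ) :
    visibleFrom k (h ++ [(none, K)]) = visibleFrom k h := by
  refine subset_antisymm (fun i hi => ?_) (visibleFrom_append_subset k h _)
  rcases mem_visibleFrom_append hi with h' | rfl
  · exact h'
  · obtain ⟨-, a, ha⟩ := hi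
    simp [labelAt_length] at ha

theorem visibleFrom_append_act {k : ℕ} {h : History Act} (hk : k ≤ h.length) (a : Act)
    (K : Set ℕ) :
    visibleFrom k (h ++ [(some a, K)]) = insert h.length (visibleFrom k h) := by
  refine subset_antisymm (fun i hi => ?_) (Set.insert_subset ?_ (visibleFrom_append_subset k h _))
  · exact (mem_visibleFrom_append hi).symm
  · exact ⟨hk, a, labelAt_length h _⟩

/-- Numbers increase along direct causes. Together with `Chain`, this identifies causality between
visible events with the order of their numbers. -/
theorem Before.lt {h : History Act} (hh : Causal h) {i j : ℕ} (hij : Before h i j) : i < j := by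
  induction hij with
  | single h' => obtain ⟨e, he, hi⟩ := h'; exact hh _ e he hi
  | tail _ h' ih => obtain ⟨e, he, hi⟩ := h'; exact ih.trans (hh _ e he hi)

theorem Before.append {h : History Act} {i j : ℕ} (hij : Before h i j) (g : History Act) :
    Before (h ++ g) i j :=
  Relation.TransGen.mono (fun _ _ ⟨e, he, ha⟩ =>
    ⟨e, by rw [List.getElem?_append_left (List.getElem?_eq_some_iff.1 he).1, he], ha⟩) _ _ hij

theorem Causal.append {h : History Act} (hh : Causal h) {l : Option Act} {K : Set ℕ}
    (hK : K ⊆ Set.Iio h.length) : Causal (h ++ [(l, K)]) := by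
  intro j e he
  rcases lt_trichotomy j h.length with hj | rfl | hj
  · rw [List.getElem?_append_left hj] at he
    exact hh j e he
  · simp at he
    exact he ▸ hK
  · rw [List.getElem?_eq_none (by simpa using hj)] at he
    cases he

theorem Chain.append_tau {h : History Act} (hh : Chain h) (K : Set ℕ) :
    Chain (h ++ [(none, K)]) := by
  intro i hi j hj hij
  rw [visibleFrom_append_tau] at hi hj
  exact (hh i hi j hj hij).append _

theorem Chain.append_act {h : History Act} (hh : Chain h) (a : Act) {K : Set ℕ}
    (hK : visibleFrom 0 h ⊆ K) : Chain (h ++ [(some a, K)]) := by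
  intro i hi j hj hij
  rw [visibleFrom_append_act (Nat.zero_le _)] at hi hj
  rcases hj with rfl | hj
  · rcases hi with rfl | hi
    · exact absurd hij (lt_irrefl _)
    · exact .single ⟨(some a, K), by simp, hK hi⟩
  · rcases hi with rfl | hi
    · exact absurd (hij.trans (lt_length_of_mem_visibleFrom hj)) (lt_irrefl _)
    · exact (hh i hi j hj hij).append _

/-! ### Order isomorphisms between the visible events of two histories -/

/-- `f` is an isomorphism from the events `A` of `h₁` onto the events `B` of `h₂` that preserves the
labels and the order of the numbers. -/
structure IsOrderIso (h₁ : History Act) (A : Set ℕ) (h₂ : History Act) (B : Set ℕ)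
    (f : Set (ℕ × ℕ)) : Prop where
  subset : ∀ p ∈ f, p.1 ∈ A ∧ p.2 ∈ B
  label : ∀ p ∈ f, labelAt h₁ p.1 = labelAt h₂ p.2
  total : ∀ i ∈ A, ∃! j, (i, j) ∈ f
  onto : ∀ j ∈ B, ∃! i, (i, j) ∈ f
  order : ∀ p ∈ f, ∀ q ∈ f, p.1 < q.1 ↔ p.2 < q.2

namespace IsOrderIso

variable {h₁ h₂ : History Act} {A B : Set ℕ} {f : Set (ℕ × ℕ)}

theorem empty (h₁ h₂ : History Act) : IsOrderIso h₁ ∅ h₂ ∅ ∅ := by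
  constructor <;> simp

theorem swap (hf : IsOrderIso h₁ A h₂ B f) : IsOrderIso h₂ B h₁ A (Prod.swap ⁻¹' f) where
  subset _ hp := (hf.subset _ hp).symm
  label _ hp := (hf.label _ hp).symm
  total := hf.onto
  onto := hf.total
  order _ hp _ hq := (hf.order _ hp _ hq).symm

theorem tau_left {k : ℕ} (hf : IsOrderIso h₁ (visibleFrom k h₁) h₂ B f) (K : Set ℕ) :
    IsOrderIso (h₁ ++ [(none, K)]) (visibleFrom k (h₁ ++ [(none, K)])) h₂ B f := by
  rw [visibleFrom_append_tau]
  exact ⟨hf.subset, fun p hp => by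
    rw [labelAt_append (lt_length_of_mem_visibleFrom (hf.subset p hp).1), hf.label p hp],
    hf.total, hf.onto, hf.order⟩

/-- The new events have the largest numbers on both sides, so pairing them keeps the order. -/
theorem append_act {k₁ k₂ : ℕ} (hf : IsOrderIso h₁ (visibleFrom k₁ h₁) h₂ (visibleFrom k₂ h₂) f)
    (hk₁ : k₁ ≤ h₁.length) (hk₂ : k₂ ≤ h₂.length) (a : Act) (K₁ K₂ : Set ℕ) :
    IsOrderIso (h₁ ++ [(some a, K₁)]) (visibleFrom k₁ (h₁ ++ [(some a, K₁)]))
      (h₂ ++ [(some a, K₂)]) (visibleFrom k₂ (h₂ ++ [(some a, K₂)]))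
      (insert (h₁.length, h₂.length) f) := by
  have l₁ : ∀ p ∈ f, p.1 < h₁.length := fun p hp =>
    lt_length_of_mem_visibleFrom (hf.subset p hp).1
  have l₂ : ∀ p ∈ f, p.2 < h₂.length := fun p hp =>
    lt_length_of_mem_visibleFrom (hf.subset p hp).2
  rw [visibleFrom_append_act hk₁, visibleFrom_append_act hk₂]
  constructor
  · rintro p (rfl | hp)
    · exact ⟨.inl rfl, .inl rfl⟩
    · exact ⟨.inr (hf.subset p hp).1, .inr (hf.subset p hp).2⟩
  · rintro p (rfl | hp)
    · rw [labelAt_length, labelAt_length]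
    · rw [labelAt_append (l₁ p hp), labelAt_append (l₂ p hp), hf.label p hp]
  · rintro i (rfl | hi)
    · refine ⟨h₂.length, .inl rfl, ?_⟩
      rintro j (hj | hj)
      · exact (Prod.ext_iff.1 hj).2
      · exact absurd (l₁ _ hj) (lt_irrefl _)
    · obtain ⟨j, hj, hu⟩ := hf.total i hi
      refine ⟨j, .inr hj, ?_⟩
      rintro j' (hj' | hj')
      · exact absurd (Prod.ext_iff.1 hj').1 (lt_length_of_mem_visibleFrom hi).ne
      · exact hu j' hj'
  · rintro j (rfl | hj)
    · refine ⟨h₁.length, .inl rfl, ?_⟩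
      rintro i (hi | hi)
      · exact (Prod.ext_iff.1 hi).1
      · exact absurd (l₂ _ hi) (lt_irrefl _)
    · obtain ⟨i, hi, hu⟩ := hf.onto j hj
      refine ⟨i, .inr hi, ?_⟩
      rintro i' (hi' | hi')
      · exact absurd (Prod.ext_iff.1 hi').2 (lt_length_of_mem_visibleFrom hj).ne
      · exact hu i' hi'
  · rintro p (rfl | hp) q (rfl | hq)
    · simp
    · exact iff_of_false (l₁ q hq).asymm (l₂ q hq).asymm
    · exact iff_of_true (l₁ p hp) (l₂ p hp)
    · exact hf.order p hp q hq

/-- `Causal` and `Chain` turn both causal orders into `<` on visible events, so nothing beyond the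
order of the numbers has to be compared. -/
theorem isPomsetIso {k₁ k₂ : ℕ}
    (hf : IsOrderIso h₁ (visibleFrom k₁ h₁) h₂ (visibleFrom k₂ h₂) f)
    (hc₁ : Causal h₁) (hc₂ : Causal h₂) (hh₁ : Chain h₁) (hh₂ : Chain h₂) :
    IsPomsetIso h₁ (visibleFrom k₁ h₁) h₂ (visibleFrom k₂ h₂) f where
  subset := hf.subset
  label := hf.label
  total := hf.total
  onto := hf.onto
  order p hp q hq := by
    have v₁ := fun r hr => visibleFrom_subset _ _ (hf.subset r hr).1
    have v₂ := fun r hr => visibleFrom_subset _ _ (hf.subset r hr).2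
    rw [(⟨Before.lt hc₁, hh₁ _ (v₁ p hp) _ (v₁ q hq)⟩ : Before h₁ p.1 q.1 ↔ p.1 < q.1),
      (⟨Before.lt hc₂, hh₂ _ (v₂ p hp) _ (v₂ q hq)⟩ : Before h₂ p.2 q.2 ↔ p.2 < q.2)]
    exact hf.order p hp q hq

end IsOrderIso

/-! ### Event numbers in terms -/

/-- The event numbers that occur in a term are less than `k`. -/
def Term.Below (k : ℕ) : Term Act Var S → Prop
  | .fin D => D ⊆ Set.Iio k
  | .act _ => True
  | .guard _ => True
  | .seq x y => x.Below k ∧ y.Below k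
  | .alt x y => x.Below k ∧ y.Below k
  | .par x y => x.Below k ∧ y.Below k
  | .new x => x.Below k
  | .var _ => True
  | .enc _ m x => (∀ p ∈ m, p.2 < k) ∧ x.Below k
  | .abs _ x => x.Below k

theorem Term.Below.mono {k k' : ℕ} (hk : k ≤ k') {x : Term Act Var S} (hx : x.Below k) :
    x.Below k' := by
  induction x with
  | fin D => exact hx.trans (Set.Iio_subset_Iio hk)
  | act | guard | var => trivial
  | seq x y ihx ihy => exact ⟨ihx hx.1, ihy hx.2⟩
  | alt x y ihx ihy => exact ⟨ihx hx.1, ihy hx.2⟩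
  | par x y ihx ihy => exact ⟨ihx hx.1, ihy hx.2⟩
  | new x ih => exact ih hx
  | enc C m x ih => exact ⟨fun p hp => (hx.1 p hp).trans_le hk, ih hx.2⟩
  | abs I x ih => exact ih hx

theorem Term.Below.created {k : ℕ} {x x' : Term Act Var S} (hx : x.Below k)
    (h : created x = some x') : x'.Below k := by
  induction x generalizing x' with
  | new x ih => cases h; exact hx
  | par x y ihx ihy =>
    simp only [APTC.created] at h
    split at h
    · rename_i h₁ h₂
      cases h
      exact ⟨ihx hx.1 h₁, ihy hx.2 h₂⟩
    · cases h
  | _ => cases h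

theorem Done.subset_Iio {E : Spec Act Var S} (hE : ∀ X, (E X).Below 0) {s : S} {k : ℕ}
    {x : Term Act Var S} {D : Set ℕ} (h : Done E s x D) (hx : x.Below k) : D ⊆ Set.Iio k := by
  induction h with
  | fin D => exact hx
  | guard => exact Set.empty_subset _
  | seq _ _ _ ih ih' => exact Set.union_subset (ih hx.1) (ih' hx.2)
  | seq_new hc _ ih => exact ih ⟨hx.1.created hc, hx.2⟩
  | alt_left _ ih => exact ih hx.1
  | alt_right _ ih => exact ih hx.2
  | par _ _ ih ih' => exact Set.union_subset (ih hx.1) (ih' hx.2)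
  | new _ ih => exact ih hx
  | var _ ih => exact ih ((hE _).mono (Nat.zero_le _))
  | enc _ ih => exact ih hx.2
  | abs _ ih => exact ih hx

theorem sources_subset_Iio {C : Set (Act × Act)} {m : List (Act × ℕ)} {k : ℕ}
    (hm : ∀ p ∈ m, p.2 < k) (a : Act) : sources C m a ⊆ Set.Iio k := by
  rintro i ⟨s, -, hi⟩
  obtain ⟨p, hp, rfl⟩ := List.mem_map.1 (List.mem_of_getElem? hi)
  exact hm p (List.mem_filter.1 hp).1

/-- This keeps histories `Causal`. The hypothesis `hE` says that unfolding a variable brings in no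
event numbers. -/
theorem Step.subset_Iio {E : Spec Act Var S} (hE : ∀ X, (E X).Below 0) {env : DataEnv Act S} {k : ℕ}
    {s s' : S} {x x' : Term Act Var S} {l : Option Act} {K : Set ℕ}
    (h : Step E env k s x l K x' s') (hx : x.Below k) :
    K ⊆ Set.Iio k ∧ x'.Below (k + 1) := by
  have up : ∀ {z : Term Act Var S}, z.Below k → z.Below (k + 1) :=
    fun hz => hz.mono (Nat.le_succ k)
  induction h with
  | act => exact ⟨Set.empty_subset _, by simp [Term.Below]⟩
  | seq_left _ _ ih => exact ⟨(ih hx.1).1, (ih hx.1).2, up hx.2⟩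
  | seq_right _ hD _ ih =>
    have := hD.subset_Iio hE hx.1
    exact ⟨Set.union_subset this (ih hx.2).1, this.trans (Set.Iio_subset_Iio (Nat.le_succ k)),
      (ih hx.2).2⟩
  | seq_new hc _ ih => exact ih ⟨hx.1.created hc, hx.2⟩
  | alt_left _ ih => exact ih hx.1
  | alt_right _ ih => exact ih hx.2
  | par_left _ ih => exact ⟨(ih hx.1).1, (ih hx.1).2, up hx.2⟩
  | par_right _ ih => exact ⟨(ih hx.2).1, up hx.1, (ih hx.2).2⟩
  | new _ ih => exact ih hx
  | var _ ih => exact ih ((hE _).mono (Nat.zero_le _))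
  | enc_tau _ ih =>
    exact ⟨(ih hx.2).1, fun p hp => (hx.1 p hp).trans (Nat.lt_succ_self k), (ih hx.2).2⟩
  | enc_act _ _ ih =>
    refine ⟨Set.union_subset (ih hx.2).1 (sources_subset_Iio hx.1 _), fun p hp => ?_, (ih hx.2).2⟩
    rcases List.mem_append.1 hp with hp | hp
    · exact (hx.1 p hp).trans (Nat.lt_succ_self k)
    · rw [List.mem_singleton.1 hp]
      exact Nat.lt_succ_self k
  | abs _ ih => exact ih hx

/-! ### Request-response loops -/

/-- In the data state `s`, the process `x` can reach a visible event by silent events, where the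
next event has the number `k`. -/
inductive Responds (E : Spec Act Var S) (env : DataEnv Act S) : ℕ → S → Term Act Var S → Prop
  | now {k : ℕ} {s s' : S} {x x' : Term Act Var S} {a : Act} {K : Set ℕ}
      (h : Step E env k s x (some a) K x' s') : Responds E env k s x
  | tau {k : ℕ} {s s' : S} {x x' : Term Act Var S} {K : Set ℕ}
      (h : Step E env k s x none K x' s') (h' : Responds E env (k + 1) s' x') :
      Responds E env k s x

/-- `P b V k s x` is an invariant of processes that alternate between the visible actions
`ext false` and `ext true`: `b` tells which one is the next, `V` is the set of the visible events
of the past, and `k` is the number of the next event. -/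
structure IsLoop (E : Spec Act Var S) (env : DataEnv Act S) (ext : Bool → Act)
    (P : Bool → Set ℕ → ℕ → S → Term Act Var S → Prop) : Prop where
  tau : ∀ {b V k s x K x' s'}, P b V k s x → Step E env k s x none K x' s' →
    b = true ∧ P b V (k + 1) s' x'
  act : ∀ {b V k s x a K x' s'}, P b V k s x → Step E env k s x (some a) K x' s' →
    a = ext b ∧ V ⊆ K ∧ P (!b) (insert k V) (k + 1) s' x'
  responds : ∀ {b V k s x}, P b V k s x → Responds E env k s x
  not_done : ∀ {b V k s x D}, P b V k s x → ¬ Done E s x D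

/-- A configuration whose process satisfies the invariant `P`. -/
structure InLoop (P : Bool → Set ℕ → ℕ → S → Term Act Var S → Prop) (b : Bool)
    (c : Config Act Var S) : Prop where
  inv : P b (visibleFrom 0 c.hist) c.hist.length c.data c.term
  below : c.term.Below c.hist.length
  causal : Causal c.hist
  chain : Chain c.hist

open Bisim

variable {E : Spec Act Var S} {env : DataEnv Act S} {ext : Bool → Act}
  {P : Bool → Set ℕ → ℕ → S → Term Act Var S → Prop}

namespace InLoop

theorem tau (hP : IsLoop E env ext P) (hE : ∀ X, (E X).Below 0) {b : Bool}
    {c c' : Config Act Var S} (hc : InLoop P b c) (h : Trans E env none c c') :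
    b = true ∧ InLoop P b c' := by
  obtain ⟨K, h, hh⟩ := h
  obtain ⟨hb, hinv⟩ := hP.tau hc.inv h
  obtain ⟨hK, hbel⟩ := h.subset_Iio hE hc.below
  refine ⟨hb, ?_, ?_, ?_, ?_⟩
  · rw [hh, visibleFrom_append_tau, List.length_append]
    exact hinv
  · rw [hh, List.length_append]
    exact hbel
  · rw [hh]
    exact hc.causal.append hK
  · rw [hh]
    exact hc.chain.append_tau K

theorem act (hP : IsLoop E env ext P) (hE : ∀ X, (E X).Below 0) {b : Bool} {a : Act}
    {c c' : Config Act Var S} (hc : InLoop P b c) (h : Trans E env (some a) c c') :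
    a = ext b ∧ visibleFrom 0 c'.hist = insert c.hist.length (visibleFrom 0 c.hist) ∧
      InLoop P (!b) c' := by
  obtain ⟨K, h, hh⟩ := h
  obtain ⟨ha, hV, hinv⟩ := hP.act hc.inv h
  obtain ⟨hK, hbel⟩ := h.subset_Iio hE hc.below
  have hvis : visibleFrom 0 c'.hist = insert c.hist.length (visibleFrom 0 c.hist) := by
    rw [hh, visibleFrom_append_act (Nat.zero_le _)]
  refine ⟨ha, hvis, ?_, ?_, ?_, ?_⟩
  · rw [hvis, hh, List.length_append]
    exact hinv
  · rw [hh, List.length_append]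
    exact hbel
  · rw [hh]
    exact hc.causal.append hK
  · rw [hh]
    exact hc.chain.append_act a hV

theorem tauRun (hP : IsLoop E env ext P) (hE : ∀ X, (E X).Below 0) {b : Bool}
    {c c' : Config Act Var S} (hc : InLoop P b c) (h : TauRun E env c c') :
    InLoop P b c' := by
  induction h with
  | refl => exact hc
  | tail _ h ih => exact (ih.tau hP hE h).2

/-- `responds` promises some visible event; its label is forced, because the silent events before it
keep the phase `b`. -/
theorem ready (hP : IsLoop E env ext P) (hE : ∀ X, (E X).Below 0) {b : Bool}
    {c : Config Act Var S} (hc : InLoop P b c) :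
    ∃ d c', TauRun E env c d ∧ Trans E env (some (ext b)) d c' := by
  have key : ∀ k s x, Responds E env k s x → ∀ c : Config Act Var S, c.hist.length = k →
      c.data = s → c.term = x → ∃ d c' a, TauRun E env c d ∧ Trans E env (some a) d c' := by
    intro k s x h
    induction h with
    | @now k s s' x x' a K h =>
      rintro c rfl rfl rfl
      exact ⟨c, ⟨x', s', c.hist ++ [(some a, K)]⟩, a, .refl, K, h, rfl⟩
    | @tau k s s' x x' K h _ ih =>
      rintro c rfl rfl rfl
      obtain ⟨d, c', a, hd, h'⟩ := ih ⟨x', s', c.hist ++ [(none, K)]⟩ (by simp) rfl rfl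
      exact ⟨d, c', a, .head ⟨K, h, rfl⟩ hd, h'⟩
  obtain ⟨d, c', a, hd, h⟩ := key _ _ _ (hP.responds hc.inv) c rfl rfl rfl
  obtain rfl := ((hc.tauRun hP hE hd).act hP hE h).1
  exact ⟨d, c', hd, h⟩

theorem not_terminated (hP : IsLoop E env ext P) {b : Bool} {c : Config Act Var S}
    (hc : InLoop P b c) : ¬ Terminated E c :=
  fun ⟨_, h⟩ => hP.not_done hc.inv h

theorem isPomsetIso {b₁ b₂ : Bool} {k₁ k₂ : ℕ} {c₁ c₂ : Config Act Var S} {f : Set (ℕ × ℕ)}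
    (hc₁ : InLoop P b₁ c₁) (hc₂ : InLoop P b₂ c₂)
    (hf : IsOrderIso c₁.hist (visibleFrom k₁ c₁.hist) c₂.hist (visibleFrom k₂ c₂.hist) f) :
    IsPomsetIso c₁.hist (visibleFrom k₁ c₁.hist) c₂.hist (visibleFrom k₂ c₂.hist) f :=
  hf.isPomsetIso hc₁.causal hc₂.causal hc₁.chain hc₂.chain

end InLoop

theorem Bisim.Trans.hist {l : Option Act} {c c' : Config Act Var S} (h : Trans E env l c c') :
    ∃ K, c'.hist = c.hist ++ [(l, K)] :=
  ⟨h.choose, h.choose_spec.2⟩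

theorem hist_of_run {c c' : Config Act Var S}
    (h : Relation.ReflTransGen (fun d d' => ∃ l, Trans E env l d d') c c') :
    ∃ g, c'.hist = c.hist ++ g := by
  induction h with
  | refl => exact ⟨[], (List.append_nil _).symm⟩
  | tail _ h ih =>
    obtain ⟨l, K, -, hh⟩ := h
    obtain ⟨g, hg⟩ := ih
    exact ⟨g ++ [(l, K)], by rw [hh, hg, List.append_assoc]⟩

theorem Bisim.TauRun.run {c c' : Config Act Var S} (h : TauRun E env c c') :
    Relation.ReflTransGen (fun d d' => ∃ l, Trans E env l d d') c c' :=
  Relation.ReflTransGen.mono (fun _ _ h => ⟨none, h⟩) _ _ h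

/-! ### Matching the runs of two loops -/

/-- The order isomorphism from the past of `c₁` onto the past of `c₂`, from the event numbers `k₁`
and `k₂` on. -/
structure Matches (c₁ : Config Act Var S) (k₁ : ℕ) (f : Set (ℕ × ℕ)) (c₂ : Config Act Var S)
    (k₂ : ℕ) : Prop where
  le_left : k₁ ≤ c₁.hist.length
  le_right : k₂ ≤ c₂.hist.length
  iso : IsOrderIso c₁.hist (visibleFrom k₁ c₁.hist) c₂.hist (visibleFrom k₂ c₂.hist) f

namespace Matches

variable {c₁ c₂ c₁' c₂' : Config Act Var S} {k₁ k₂ : ℕ} {f : Set (ℕ × ℕ)}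

theorem start (c₁ c₂ : Config Act Var S) :
    Matches c₁ c₁.hist.length ∅ c₂ c₂.hist.length :=
  ⟨le_rfl, le_rfl, by
    rw [visibleFrom_length, visibleFrom_length]; exact .empty _ _⟩

theorem swap (h : Matches c₁ k₁ f c₂ k₂) : Matches c₂ k₂ (Prod.swap ⁻¹' f) c₁ k₁ :=
  ⟨h.le_right, h.le_left, h.iso.swap⟩

theorem tau_left (h : Matches c₁ k₁ f c₂ k₂) (ht : Trans E env none c₁ c₁') :
    Matches c₁' k₁ f c₂ k₂ := by
  obtain ⟨K, hK⟩ := Trans.hist ht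
  refine ⟨?_, h.le_right, ?_⟩
  · rw [hK, List.length_append]
    exact h.le_left.trans (Nat.le_add_right _ _)
  · rw [hK]
    exact h.iso.tau_left K

theorem tauRun_left (h : Matches c₁ k₁ f c₂ k₂) (ht : TauRun E env c₁ c₁') :
    Matches c₁' k₁ f c₂ k₂ := by
  induction ht with
  | refl => exact h
  | tail _ ht ih => exact ih.tau_left ht

theorem tauRun_right (h : Matches c₁ k₁ f c₂ k₂) (ht : TauRun E env c₂ c₂') :
    Matches c₁ k₁ f c₂' k₂ := (h.swap.tauRun_left ht).swap

theorem act (h : Matches c₁ k₁ f c₂ k₂) {a : Act} (h₁ : Trans E env (some a) c₁ c₁')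
    (h₂ : Trans E env (some a) c₂ c₂') :
    Matches c₁' k₁ (update f (some a) c₁.hist.length c₂.hist.length) c₂' k₂ := by
  obtain ⟨K₁, hK₁⟩ := Trans.hist h₁
  obtain ⟨K₂, hK₂⟩ := Trans.hist h₂
  refine ⟨?_, ?_, ?_⟩
  · rw [hK₁, List.length_append]
    exact h.le_left.trans (Nat.le_add_right _ _)
  · rw [hK₂, List.length_append]
    exact h.le_right.trans (Nat.le_add_right _ _)
  · rw [hK₁, hK₂]
    exact h.iso.append_act h.le_left h.le_right a K₁ K₂

/-- A run of `c₁` is matched by a run of `c₂`. -/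
theorem run (hP : IsLoop E env ext P) (hE : ∀ X, (E X).Below 0) {b : Bool}
    (h : Matches c₁ k₁ f c₂ k₂) (h₁ : InLoop P b c₁) (h₂ : InLoop P b c₂)
    (hr : Relation.ReflTransGen (fun d d' => ∃ l, Trans E env l d d') c₁ c₁') :
    ∃ b' f' c₂', Relation.ReflTransGen (fun d d' => ∃ l, Trans E env l d d') c₂ c₂' ∧
      InLoop P b' c₁' ∧ InLoop P b' c₂' ∧ Matches c₁' k₁ f' c₂' k₂ := by
  induction hr with
  | refl => exact ⟨b, f, c₂, .refl, h₁, h₂, h⟩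
  | tail _ ht ih =>
    obtain ⟨b', f', c₂', hr, h₁', h₂', h'⟩ := ih
    obtain ⟨l, ht⟩ := ht
    cases l with
    -- A silent event is matched by no event at all.
    | none => exact ⟨b', f', c₂', hr, (h₁'.tau hP hE ht).2, h₂', h'.tau_left ht⟩
    | some a =>
      obtain ⟨rfl, -, h₁''⟩ := h₁'.act hP hE ht
      -- The other side is in the same phase, so it can reach a visible event, which has the same
      -- label.
      obtain ⟨d, c₂'', hd, ht'⟩ := h₂'.ready hP hE
      have hd' := h₂'.tauRun hP hE hd
      exact ⟨!b', _, c₂'', (hr.trans (TauRun.run hd)).tail ⟨_, ht'⟩, h₁'',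
        (hd'.act hP hE ht').2.2, (h'.tauRun_right hd).act ht ht'⟩

/-- A run of `c₁` without visible events is matched by the empty run of `c₂`. -/
theorem stutter (hP : IsLoop E env ext P) (hE : ∀ X, (E X).Below 0) {b : Bool}
    (h : Matches c₁ k₁ f c₂ k₂) (h₁ : InLoop P b c₁)
    (hr : Relation.ReflTransGen (fun d d' => ∃ l, Trans E env l d d') c₁ c₁')
    (hv : visibleFrom c₁.hist.length c₁'.hist = ∅) :
    InLoop P b c₁' ∧ Matches c₁' k₁ f c₂ k₂ := by
  induction hr with
  | refl => exact ⟨h₁, h⟩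
  | tail hr' ht ih =>
    obtain ⟨l, ht⟩ := ht
    obtain ⟨K, hK⟩ := Trans.hist ht
    obtain ⟨g, hg⟩ := hist_of_run hr'
    cases l with
    | none =>
      rw [hK, visibleFrom_append_tau] at hv
      obtain ⟨h₁', h'⟩ := ih hv
      exact ⟨(h₁'.tau hP hE ht).2, h'.tau_left ht⟩
    | some a =>
      rw [hK, visibleFrom_append_act (by rw [hg, List.length_append]; omega)] at hv
      exact absurd hv (Set.insert_nonempty _ _).ne_empty

theorem samePomset {b₁ b₂ : Bool} {d₁ d₂ : Config Act Var S}
    (h : Matches c₁ d₁.hist.length f c₂ d₂.hist.length) (h₁ : InLoop P b₁ c₁)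
    (h₂ : InLoop P b₂ c₂) : SamePomset d₁ c₁ d₂ c₂ :=
  ⟨f, h₁.isPomsetIso h₂ h.iso⟩

end Matches

/-! ### Loops in the same phase are bisimilar -/

theorem Bisim.SamePomset.symm {c₁ c₁' c₂ c₂' : Config Act Var S} (h : SamePomset c₁ c₁' c₂ c₂') :
    SamePomset c₂ c₂' c₁ c₁' := by
  obtain ⟨f, hf⟩ := h
  exact ⟨Prod.swap ⁻¹' f, fun p hp => (hf.subset _ hp).symm, fun p hp => (hf.label _ hp).symm,
    hf.onto, hf.total, fun p hp q hq => (hf.order _ hp _ hq).symm⟩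

/-- An isomorphism reflects causality, so pairwise concurrency of the visible events is carried
over; this is all that a weak step requires. -/
theorem Bisim.SamePomset.admits {c₁ c₁' c₂ c₂' : Config Act Var S} (h : SamePomset c₁ c₁' c₂ c₂')
    {κ : Kind} (h₁ : κ.Admits c₁'.hist (visibleFrom c₁.hist.length c₁'.hist)) :
    κ.Admits c₂'.hist (visibleFrom c₂.hist.length c₂'.hist) := by
  obtain ⟨f, hf⟩ := h
  intro hκ i hi j hj hij
  obtain ⟨i', hi', -⟩ := hf.onto i hi
  obtain ⟨j', hj', -⟩ := hf.onto j hj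
  exact h₁ hκ i' (hf.subset _ hi').1 j' (hf.subset _ hj').1 ((hf.order _ hi' _ hj').2 hij)

theorem Bisim.PTrans.run {κ : Kind} {c c' : Config Act Var S} (h : PTrans E env κ c c') :
    Relation.ReflTransGen (fun d d' => ∃ l, Trans E env l d d') c c' :=
  h.1.to_reflTransGen

theorem visibleFrom_subset_Ico (h : History Act) (k : ℕ) :
    visibleFrom k h ⊆ {i | k ≤ i ∧ i < h.length} :=
  fun _ hi => ⟨hi.1, lt_length_of_mem_visibleFrom hi⟩

/-- The bisimulation is equality of phases. It does not mention the past, because a transition is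
compared only from its starting point on. -/
theorem IsLoop.isBranching (hP : IsLoop E env ext P) (hE : ∀ X, (E X).Below 0) (κ : Kind) :
    IsBranching E env κ fun c₁ c₂ => ∃ b, InLoop P b c₁ ∧ InLoop P b c₂ := by
  have forth : ∀ c₁ c₂ c₁', (∃ b, InLoop P b c₁ ∧ InLoop P b c₂) → PTrans E env κ c₁ c₁' →
      ∃ c₂', WTrans E env κ c₂ c₂' ∧ SamePomset c₁ c₁' c₂ c₂' ∧
        ∃ b, InLoop P b c₁' ∧ InLoop P b c₂' := by
    rintro c₁ c₂ c₁' ⟨b, h₁, h₂⟩ ht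
    obtain ⟨b', f', c₂', hr, h₁', h₂', h'⟩ :=
      (Matches.start c₁ c₂).run hP hE h₁ h₂ ht.run
    have hs := h'.samePomset h₁' h₂'
    -- A strong step constrains all its events, in particular the visible ones.
    exact ⟨c₂', ⟨hr, hs.admits fun hκ i hi j hj =>
      ht.2 hκ i (visibleFrom_subset_Ico _ _ hi) j (visibleFrom_subset_Ico _ _ hj)⟩, hs,
      b', h₁', h₂'⟩
  refine ⟨fun c₁ c₂ c₁' h ht => .inr ?_, fun c₁ c₂ c₂' h ht => .inr ?_, ?_, ?_⟩
  · obtain ⟨c₂', hw, hs, hr⟩ := forth c₁ c₂ c₁' h ht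
    exact ⟨c₂, c₂', .refl, h, hw, hs, hr⟩
  · obtain ⟨b, h₁, h₂⟩ := h
    obtain ⟨c₁', hw, hs, b', h₂', h₁'⟩ := forth c₂ c₁ c₂' ⟨b, h₂, h₁⟩ ht
    exact ⟨c₁, c₁', .refl, ⟨b, h₁, h₂⟩, hw, hs.symm, b', h₁', h₂'⟩
  · rintro c₁ c₂ ⟨b, h₁, -⟩ ht
    exact absurd ht (h₁.not_terminated hP)
  · rintro c₁ c₂ ⟨b, -, h₂⟩ ht
    exact absurd ht (h₂.not_terminated hP)

/-- Here the pairing has to cover the whole past, hence the starting numbers `0` in `Matches`. -/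
theorem IsLoop.isBranchingHP (hP : IsLoop E env ext P) (hE : ∀ X, (E X).Below 0) :
    IsBranchingHP E env fun c₁ f c₂ => ∃ b, InLoop P b c₁ ∧ InLoop P b c₂ ∧
      Matches c₁ 0 f c₂ 0 := by
  refine ⟨?_, ?_, ?_, ?_, ?_⟩
  · rintro c₁ f c₂ ⟨b, h₁, h₂, h⟩
    exact h₁.isPomsetIso h₂ h.iso
  · rintro c₁ f c₂ l c₁' ⟨b, h₁, h₂, h⟩ ht
    cases l with
    | none => exact .inl ⟨rfl, b, (h₁.tau hP hE ht).2, h₂, h.tau_left ht⟩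
    | some a =>
      obtain ⟨rfl, -, h₁'⟩ := h₁.act hP hE ht
      obtain ⟨d, c₂', hd, ht'⟩ := h₂.ready hP hE
      have hd' := h₂.tauRun hP hE hd
      have hm := h.tauRun_right hd
      exact .inr ⟨d, c₂', hd, ⟨b, h₁, hd', hm⟩, ht', !b, h₁', (hd'.act hP hE ht').2.2,
        hm.act ht ht'⟩
  · rintro c₁ f c₂ l c₂' ⟨b, h₁, h₂, h⟩ ht
    cases l with
    | none => exact .inl ⟨rfl, b, h₁, (h₂.tau hP hE ht).2, (h.swap.tau_left ht).swap⟩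
    | some a =>
      obtain ⟨rfl, -, h₂'⟩ := h₂.act hP hE ht
      obtain ⟨d, c₁', hd, ht'⟩ := h₁.ready hP hE
      have hd' := h₁.tauRun hP hE hd
      have hm := h.tauRun_left hd
      exact .inr ⟨d, c₁', hd, ⟨b, hd', h₂, hm⟩, ht', !b, (hd'.act hP hE ht').2.2, h₂',
        hm.act ht' ht⟩
  · rintro c₁ f c₂ ⟨b, h₁, -⟩ ht
    exact absurd ht (h₁.not_terminated hP)
  · rintro c₁ f c₂ ⟨b, -, h₂, -⟩ ht
    exact absurd ht (h₂.not_terminated hP)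

/-! ### Rooted equivalence of idle loops -/

theorem InLoop.start {x : Term Act Var S} {s : S} (h : P false ∅ 0 s x) (hx : x.Below 0) :
    InLoop P false (init x s) := by
  have hv : visibleFrom 0 (init x s).hist = ∅ := visibleFrom_length []
  refine ⟨?_, hx, ?_, ?_⟩
  · rw [hv]
    exact h
  · intro j e he
    simp [APTC.init] at he
  · intro i hi
    rw [hv] at hi
    exact absurd hi (Set.notMem_empty i)

/-- The first event of an idle process is visible, and it can be executed immediately. -/
theorem InLoop.first (hP : IsLoop E env ext P) (hE : ∀ X, (E X).Below 0)
    {c : Config Act Var S} (hc : InLoop P false c) :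
    ∃ c', Trans E env (some (ext false)) c c' := by
  obtain ⟨d, c', hd, ht⟩ := hc.ready hP hE
  rcases Relation.ReflTransGen.cases_head hd with rfl | ⟨e, he, -⟩
  · exact ⟨c', ht⟩
  · exact absurd (hc.tau hP hE he).1 Bool.false_ne_true

theorem InLoop.label_first (hP : IsLoop E env ext P) (hE : ∀ X, (E X).Below 0) {l : Option Act}
    {c c' : Config Act Var S} (hc : InLoop P false c) (h : Trans E env l c c') :
    l = some (ext false) := by
  cases l with
  | none => exact absurd (hc.tau hP hE h).1 Bool.false_ne_true
  | some a => rw [(hc.act hP hE h).1]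

/-- The first event is visible, and the other side can execute it at once. A pomset transition is
then matched event by event. A strong step must not contain causally related events, even silent
ones, so it is matched by this single event. -/
theorem InLoop.rooted_forth (hP : IsLoop E env ext P) (hE : ∀ X, (E X).Below 0) (κ : Kind)
    {c₁ c₂ c₁' : Config Act Var S} (h₁ : InLoop P false c₁) (h₂ : InLoop P false c₂)
    (ht : PTrans E env κ c₁ c₁') :
    ∃ c₂', PTrans E env κ c₂ c₂' ∧ SamePomset c₁ c₁' c₂ c₂' ∧
      ∃ b, InLoop P b c₁' ∧ InLoop P b c₂' := by
  obtain ⟨e₁, ⟨l, hl⟩, hr⟩ := Relation.TransGen.head'_iff.1 ht.1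
  obtain rfl := h₁.label_first hP hE hl
  obtain ⟨e₂, hl₂⟩ := h₂.first hP hE
  have hm := (Matches.start c₁ c₂).act hl hl₂
  obtain ⟨-, hv₁, he₁⟩ := h₁.act hP hE hl
  have he₂ := (h₂.act hP hE hl₂).2.2
  cases κ with
  | pomset =>
    obtain ⟨b', f', c₂', hr', h₁', h₂', h'⟩ := hm.run hP hE he₁ he₂ hr
    exact ⟨c₂', ⟨Relation.TransGen.head' ⟨_, hl₂⟩ hr', nofun⟩, h'.samePomset h₁' h₂', b', h₁', h₂'⟩
  | step =>
    obtain ⟨K₁, hK₁⟩ := Trans.hist hl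
    obtain ⟨K₂, hK₂⟩ := Trans.hist hl₂
    obtain ⟨g, hg⟩ := hist_of_run hr
    have hb' : ∃ b', InLoop P b' c₁' := by
      obtain ⟨b', -, -, -, h, -⟩ := hm.run hP hE he₁ he₂ hr
      exact ⟨b', h⟩
    obtain ⟨b', hb'⟩ := hb'
    have hlen : e₁.hist.length = c₁.hist.length + 1 := by rw [hK₁]; simp
    -- A second visible event would causally follow the first one by `chain`, which a step forbids;
    -- the rest of the run is silent.
    have hv : visibleFrom e₁.hist.length c₁'.hist = ∅ := by
      refine Set.eq_empty_of_forall_notMem fun i hi => ?_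
      have h0 : c₁.hist.length ∈ visibleFrom 0 c₁'.hist := by
        rw [hg]
        refine visibleFrom_append_subset _ _ _ ?_
        rw [hv₁]
        exact Set.mem_insert _ _
      have hlt : c₁.hist.length < i := by have := hi.1; omega
      exact ht.2 rfl _ ⟨le_rfl, lt_length_of_mem_visibleFrom h0⟩ i
        ⟨hlt.le, lt_length_of_mem_visibleFrom hi⟩
        (hb'.chain _ h0 i (visibleFrom_subset _ _ hi) hlt)
    obtain ⟨h₁', h'⟩ := hm.stutter hP hE he₁ hr hv
    refine ⟨e₂, ⟨.single ⟨_, hl₂⟩, ?_⟩, h'.samePomset h₁' he₂, _, h₁', he₂⟩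
    -- There is only one event, and `Before.lt` excludes that it precedes itself.
    rintro - i ⟨hi, hi'⟩ j ⟨hj, hj'⟩ hij
    have := Before.lt he₂.causal hij
    rw [hK₂, List.length_append, List.length_singleton] at hi' hj'
    omega

theorem IsLoop.rooted (hP : IsLoop E env ext P) (hE : ∀ X, (E X).Below 0) (κ : Kind)
    {c₁ c₂ : Config Act Var S} (h₁ : InLoop P false c₁) (h₂ : InLoop P false c₂) :
    Rooted E env κ c₁ c₂ := by
  refine ⟨fun c₁' ht => ?_, fun c₂' ht => ?_, iff_of_false (h₁.not_terminated hP)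
    (h₂.not_terminated hP)⟩
  · obtain ⟨c₂', ht', hs, hb⟩ := h₁.rooted_forth hP hE κ h₂ ht
    exact ⟨c₂', ht', hs, _, hP.isBranching hE κ, hb⟩
  · obtain ⟨c₁', ht', hs, b, hb, hb'⟩ := h₂.rooted_forth hP hE κ h₁ ht
    exact ⟨c₁', ht', hs.symm, _, hP.isBranching hE κ, b, hb', hb⟩

theorem IsLoop.rootedHP (hP : IsLoop E env ext P) (hE : ∀ X, (E X).Below 0)
    {c₁ c₂ : Config Act Var S} (h₁ : InLoop P false c₁) (h₂ : InLoop P false c₂)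
    (hc₁ : c₁.hist = []) (hc₂ : c₂.hist = []) : RootedHP E env c₁ c₂ := by
  have key : ∀ {c₁' c₂' : Config Act Var S}, Trans E env (some (ext false)) c₁ c₁' →
      Trans E env (some (ext false)) c₂ c₂' → BranchingHP E env c₁'
        (update ∅ (some (ext false)) c₁.hist.length c₂.hist.length) c₂' := by
    intro c₁' c₂' ht₁ ht₂
    have hm := (Matches.start c₁ c₂).act ht₁ ht₂
    -- Both histories are empty, so a matching from their lengths on is a matching from `0` on.
    rw [hc₁, hc₂] at hm ⊢
    exact ⟨_, hP.isBranchingHP hE, _, (h₁.act hP hE ht₁).2.2, (h₂.act hP hE ht₂).2.2, hm⟩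
  refine ⟨fun l c₁' ht => ?_, fun l c₂' ht => ?_, iff_of_false (h₁.not_terminated hP)
    (h₂.not_terminated hP)⟩
  · obtain rfl := h₁.label_first hP hE ht
    obtain ⟨c₂', ht'⟩ := h₂.first hP hE
    exact ⟨c₂', ht', key ht ht'⟩
  · obtain rfl := h₂.label_first hP hE ht
    obtain ⟨c₁', ht'⟩ := h₁.first hP hE
    exact ⟨c₁', ht', key ht' ht⟩

theorem IsLoop.procEq (hP : IsLoop E env ext P) (hE : ∀ X, (E X).Below 0)
    {x y : Term Act Var S} (hx : ∀ s, P false ∅ 0 s x) (hx' : x.Below 0)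
    (hy : ∀ s, P false ∅ 0 s y) (hy' : y.Below 0) : ProcEq E env x y := fun s =>
  have h₁ := InLoop.start (hx s) hx'
  have h₂ := InLoop.start (hy s) hy'
  ⟨hP.rooted hE .step h₁ h₂, hP.rooted hE .pomset h₁ h₂, hP.rootedHP hE h₁ h₂ rfl rfl⟩

end APTC

namespace APTC

universe u v w

variable {Act : Type u} {Var : Type v} {S : Type w}

/-! ### Prefixing a loop by a request and a response, and the recursive loop -/

section Wrapped

variable {E : Spec Act Var S} {env : DataEnv Act S} {ext : Bool → Act}
  {P : Bool → Set ℕ → ℕ → S → Term Act Var S → Prop}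

theorem step_act_iff {k : ℕ} {s s' : S} {a : Act} {l : Option Act} {K : Set ℕ}
    {x' : Term Act Var S} :
    Step E env k s (.act a) l K x' s' ↔
      s' ∈ env.effect a s ∧ l = some a ∧ K = ∅ ∧ x' = .fin {k} :=
  ⟨fun h => by cases h with | act h => exact ⟨h, rfl, rfl, rfl⟩,
    fun ⟨h, hl, hK, hx⟩ => hl ▸ hK ▸ hx ▸ .act h⟩

theorem not_done_act {s : S} {a : Act} {D : Set ℕ} : ¬ Done E s (.act a) D := nofun

theorem not_step_fin {k : ℕ} {s s' : S} {D : Set ℕ} {l : Option Act} {K : Set ℕ}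
    {x' : Term Act Var S} : ¬ Step E env k s (.fin D) l K x' s' := nofun

theorem done_fin_iff {s : S} {D D' : Set ℕ} : Done E s (.fin D) D' ↔ D' = D :=
  ⟨fun h => by cases h; rfl, fun h => h ▸ .fin _⟩

theorem step_act_seq {k : ℕ} {s s' : S} {a : Act} {l : Option Act} {K : Set ℕ}
    {y z : Term Act Var S} (h : Step E env k s (.seq (.act a) y) l K z s') :
    l = some a ∧ K = ∅ ∧ z = .seq (.fin {k}) y := by
  cases h with
  | seq_left _ h =>
    obtain ⟨-, rfl, rfl, rfl⟩ := step_act_iff.1 h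
    exact ⟨rfl, rfl, rfl⟩
  | seq_right _ hD => exact absurd hD not_done_act
  | seq_new hx => cases hx

theorem step_fin_seq {k : ℕ} {s s' : S} {D : Set ℕ} {l : Option Act} {K : Set ℕ}
    {y z : Term Act Var S} (h : Step E env k s (.seq (.fin D) y) l K z s') :
    ∃ K' y', Step E env k s y l K' y' s' ∧ K = D ∪ K' ∧ z = .seq (.fin D) y' := by
  cases h with
  | seq_left _ h => exact absurd h not_step_fin
  | seq_right _ hD h =>
    obtain rfl := done_fin_iff.1 hD
    exact ⟨_, _, h, rfl, rfl⟩
  | seq_new hx => cases hx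

theorem not_done_act_seq {s : S} {a : Act} {y : Term Act Var S} {D : Set ℕ} :
    ¬ Done E s (.seq (.act a) y) D := by
  intro h
  cases h with
  | seq _ h => exact not_done_act h
  | seq_new hx => cases hx

/-- The invariant `P`, together with the request-response loops that are built on top of it:
`X = ext false · ext true · X` for the variable `Z`, and the prefixing by the two actions. -/
inductive Looped (ext : Bool → Act) (Z : Var)
    (P : Bool → Set ℕ → ℕ → S → Term Act Var S → Prop) :
    Bool → Set ℕ → ℕ → S → Term Act Var S → Prop
  | base {b V k s x} (h : P b V k s x) : Looped ext Z P b V k s x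
  | var (k s) : Looped ext Z P false ∅ k s (.var Z)
  | request {y} (hy : ∀ k s, Looped ext Z P false ∅ k s y) (k s) :
      Looped ext Z P false ∅ k s (.seq (.act (ext false)) (.seq (.act (ext true)) y))
  | response {y} (hy : ∀ k s, Looped ext Z P false ∅ k s y) (k s) :
      Looped ext Z P true ∅ k s (.seq (.act (ext true)) y)
  | fin {b V V' k s D x} (h : Looped ext Z P b V k s x) (hV : V' ⊆ D ∪ V) :
      Looped ext Z P b V' k s (.seq (.fin D) x)

theorem Responds.fin_seq {k : ℕ} {s : S} {x : Term Act Var S} (D : Set ℕ)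
    (h : Responds E env k s x) : Responds E env k s (.seq (.fin D) x) := by
  induction h with
  | now h => exact .now (.seq_right rfl (.fin D) h)
  | tau h _ ih => exact .tau (.seq_right rfl (.fin D) h) ih

/-- A fresh term owes nothing to the past (`V = ∅`). The set `D` that a finished prefix leaves in
`fin D` becomes part of the causes of every later event, and this is what keeps the chain across the
prefix. -/
theorem Looped.act {Z : Var} (hP : IsLoop E env ext P)
    (hZ : E Z = .seq (.act (ext false)) (.seq (.act (ext true)) (.var Z)))
    {b V k s x} (hx : Looped ext Z P b V k s x) {a K x' s'}
    (h : Step E env k s x (some a) K x' s') :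
    a = ext b ∧ V ⊆ K ∧ Looped ext Z P (!b) (insert k V) (k + 1) s' x' := by
  induction hx generalizing a K x' with
  | base hx =>
    obtain ⟨ha, hV, h'⟩ := hP.act hx h
    exact ⟨ha, hV, .base h'⟩
  | var k s =>
    cases h with
    | var h =>
      rw [hZ] at h
      obtain ⟨hl, rfl, rfl⟩ := step_act_seq h
      exact ⟨Option.some.inj hl, Set.empty_subset _,
        .fin (.response (fun k s => .var k s) _ _) subset_rfl⟩
  | request hy k s =>
    obtain ⟨hl, rfl, rfl⟩ := step_act_seq h
    exact ⟨Option.some.inj hl, Set.empty_subset _, .fin (.response hy _ _) subset_rfl⟩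
  | response hy k s =>
    obtain ⟨hl, rfl, rfl⟩ := step_act_seq h
    exact ⟨Option.some.inj hl, Set.empty_subset _, .fin (hy _ _) subset_rfl⟩
  | fin _ hV ih =>
    obtain ⟨K', y', h', rfl, rfl⟩ := step_fin_seq h
    obtain ⟨ha, hV', h''⟩ := ih h'
    -- Every cause is either remembered in `D` or supplied by the invariant of the continuation.
    refine ⟨ha, hV.trans (Set.union_subset_union_right _ hV'), .fin h'' ?_⟩
    rw [Set.union_insert]
    exact Set.insert_subset_insert hV

theorem IsLoop.looped {Z : Var} (hP : IsLoop E env ext P)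
    (hZ : E Z = .seq (.act (ext false)) (.seq (.act (ext true)) (.var Z))) :
    IsLoop E env ext (Looped ext Z P) where
  act hx h := hx.act hP hZ h
  tau := by
    intro b V k s x K x' s' hx h
    induction hx generalizing K x' with
    | base hx => exact ⟨(hP.tau hx h).1, .base (hP.tau hx h).2⟩
    | var k s =>
      cases h with
      | var h =>
        rw [hZ] at h
        exact absurd (step_act_seq h).1 nofun
    | request => exact absurd (step_act_seq h).1 nofun
    | response => exact absurd (step_act_seq h).1 nofun
    | fin _ hV ih =>
      obtain ⟨K', y', h', rfl, rfl⟩ := step_fin_seq h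
      exact ⟨(ih h').1, .fin (ih h').2 hV⟩
  responds := by
    intro b V k s x hx
    have now : ∀ (b : Bool) k s y, Responds E env k s (.seq (.act (ext b)) y) := by
      intro b k s y
      obtain ⟨s', hs'⟩ := env.effect_nonempty (ext b) s
      exact .now (.seq_left rfl (.act hs'))
    induction hx with
    | base hx => exact hP.responds hx
    | var k s =>
      obtain ⟨s', hs'⟩ := env.effect_nonempty (ext false) s
      exact .now (.var (by rw [hZ]; exact .seq_left rfl (.act hs')))
    | request => exact now _ _ _ _
    | response => exact now _ _ _ _
    | fin _ _ ih => exact ih.fin_seq _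
  not_done := by
    intro b V k s x D hx h
    induction hx generalizing D with
    | base hx => exact hP.not_done hx h
    | var k s =>
      cases h with
      | var h => exact not_done_act_seq (hZ ▸ h)
    | request => exact not_done_act_seq h
    | response => exact not_done_act_seq h
    | fin _ _ ih =>
      cases h with
      | seq _ _ h => exact ih h
      | seq_new hx => cases hx

end Wrapped

/-! ### Terms without recursion -/

/-- The terms that are reached from terms over the actions in `I` that are built with `·`, `+`, `≬`
and guards. -/
inductive Basic (I : Set Act) : Term Act Var S → Prop
  | fin (D : Set ℕ) : Basic I (.fin D)
  | act {a : Act} (h : a ∈ I) : Basic I (.act a)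
  | guard (φ : Set S) : Basic I (.guard φ)
  | seq {x y : Term Act Var S} (hx : Basic I x) (hy : Basic I y) : Basic I (.seq x y)
  | alt {x y : Term Act Var S} (hx : Basic I x) (hy : Basic I y) : Basic I (.alt x y)
  | par {x y : Term Act Var S} (hx : Basic I x) (hy : Basic I y) : Basic I (.par x y)

theorem IsLocal.basic {I : Set Act} {x : Term Act Var S} (hx : IsLocal I x) : Basic I x := by
  induction hx with
  | act h => exact .act h
  | guard φ => exact .guard φ
  | seq _ _ ihx ihy => exact .seq ihx ihy
  | alt _ _ ihx ihy => exact .alt ihx ihy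
  | par _ _ ihx ihy => exact .par ihx ihy

theorem IsLocal.term_below {I : Set Act} {x : Term Act Var S} (hx : IsLocal I x) (k : ℕ) :
    x.Below k := by
  induction hx with
  | act | guard => trivial
  | seq _ _ ihx ihy => exact ⟨ihx, ihy⟩
  | alt _ _ ihx ihy => exact ⟨ihx, ihy⟩
  | par _ _ ihx ihy => exact ⟨ihx, ihy⟩

namespace Basic

variable {I : Set Act} {x : Term Act Var S}

theorem mono {J : Set Act} (hx : Basic I x) (h : I ⊆ J) : Basic J x := by
  induction hx with
  | fin D => exact .fin D
  | act ha => exact .act (h ha)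
  | guard φ => exact .guard φ
  | seq _ _ ihx ihy => exact .seq ihx ihy
  | alt _ _ ihx ihy => exact .alt ihx ihy
  | par _ _ ihx ihy => exact .par ihx ihy

/-- Sequential composition has separate rules for process creation; this excludes them for a first
component without `new`. -/
theorem created_eq_none (hx : Basic I x) : created x = none := by
  induction hx with
  | par _ _ ihx ihy => simp [created, ihx]
  | _ => rfl

theorem step {E : Spec Act Var S} {env : DataEnv Act S} {k : ℕ} {s s' : S}
    {l : Option Act} {K : Set ℕ} {x' : Term Act Var S} (hx : Basic I x)
    (h : Step E env k s x l K x' s') :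
    Basic I x' ∧ ∃ a ∈ I, l = some a ∧ s' ∈ env.effect a s := by
  induction h with
  | act h => cases hx with | act ha => exact ⟨.fin _, _, ha, rfl, h⟩
  | seq_left _ _ ih => cases hx with | seq hx hy => exact ⟨.seq (ih hx).1 hy, (ih hx).2⟩
  | seq_right _ _ _ ih =>
    cases hx with | seq hx hy => exact ⟨.seq (.fin _) (ih hy).1, (ih hy).2⟩
  | seq_new hc =>
    cases hx with | seq hx hy => rw [hx.created_eq_none] at hc; cases hc
  | alt_left _ ih => cases hx with | alt hx hy => exact ih hx
  | alt_right _ ih => cases hx with | alt hx hy => exact ih hy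
  | par_left _ ih => cases hx with | par hx hy => exact ⟨.par (ih hx).1 hy, (ih hx).2⟩
  | par_right _ ih => cases hx with | par hx hy => exact ⟨.par hx (ih hy).1, (ih hy).2⟩
  | new | var | enc_tau | enc_act | abs => cases hx

end Basic

/-! ### Independence of the event numbers, and completion of local computations -/

/-- The terms `x` and `y` differ only in the numbers of the events that were executed. -/
inductive SameShape : Term Act Var S → Term Act Var S → Prop
  | fin (D D' : Set ℕ) : SameShape (.fin D) (.fin D')
  | act (a : Act) : SameShape (.act a) (.act a)
  | guard (φ : Set S) : SameShape (.guard φ) (.guard φ)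
  | seq {x y x' y' : Term Act Var S} (hx : SameShape x x') (hy : SameShape y y') :
      SameShape (.seq x y) (.seq x' y')
  | alt {x y x' y' : Term Act Var S} (hx : SameShape x x') (hy : SameShape y y') :
      SameShape (.alt x y) (.alt x' y')
  | par {x y x' y' : Term Act Var S} (hx : SameShape x x') (hy : SameShape y y') :
      SameShape (.par x y) (.par x' y')

theorem Basic.sameShape {I : Set Act} {x : Term Act Var S} (hx : Basic I x) : SameShape x x := by
  induction hx with
  | fin D => exact .fin D D
  | act => exact .act _
  | guard φ => exact .guard φ
  | seq _ _ ihx ihy => exact .seq ihx ihy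
  | alt _ _ ihx ihy => exact .alt ihx ihy
  | par _ _ ihx ihy => exact .par ihx ihy

namespace SameShape

theorem created_eq_none {x y : Term Act Var S} (h : SameShape x y) :
    created x = none ∧ created y = none := by
  induction h with
  | par _ _ ihx ihy => simp [created, ihx.1, ihx.2]
  | _ => exact ⟨rfl, rfl⟩

theorem done {E : Spec Act Var S} {s : S} {x y : Term Act Var S} {D : Set ℕ}
    (h : Done E s x D) (hxy : SameShape x y) : ∃ D', Done E s y D' := by
  induction h generalizing y with
  | fin => cases hxy; exact ⟨_, .fin _⟩
  | guard h => cases hxy; exact ⟨_, .guard h⟩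
  | seq _ _ _ ih ih' =>
    cases hxy with
    | seq hx hy => exact ⟨_, .seq hx.created_eq_none.2 (ih hx).choose_spec (ih' hy).choose_spec⟩
  | seq_new hc =>
    cases hxy with | seq hx hy => rw [hx.created_eq_none.1] at hc; cases hc
  | alt_left _ ih => cases hxy with | alt hx hy => exact ⟨_, .alt_left (ih hx).choose_spec⟩
  | alt_right _ ih => cases hxy with | alt hx hy => exact ⟨_, .alt_right (ih hy).choose_spec⟩
  | par _ _ ih ih' =>
    cases hxy with | par hx hy => exact ⟨_, .par (ih hx).choose_spec (ih' hy).choose_spec⟩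
  | new | var | enc | abs => cases hxy

/-- Event numbers affect only the recorded causes, never what can be executed. Hence `k'` is
arbitrary. -/
theorem step {E : Spec Act Var S} {env : DataEnv Act S} {k : ℕ} (k' : ℕ) {s s' : S}
    {x y x' : Term Act Var S} {l : Option Act} {K : Set ℕ} (h : Step E env k s x l K x' s')
    (hxy : SameShape x y) : ∃ K' y', Step E env k' s y l K' y' s' ∧ SameShape x' y' := by
  induction h generalizing y with
  | act h => cases hxy; exact ⟨_, _, .act h, .fin _ _⟩
  | seq_left _ _ ih =>
    cases hxy with
    | seq hx hy =>
      obtain ⟨K', y', h, hs⟩ := ih hx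
      exact ⟨_, _, .seq_left hx.created_eq_none.2 h, .seq hs hy⟩
  | seq_right _ hD _ ih =>
    cases hxy with
    | seq hx hy =>
      obtain ⟨K', y', h, hs⟩ := ih hy
      obtain ⟨D', hD'⟩ := SameShape.done hD hx
      exact ⟨_, _, .seq_right hx.created_eq_none.2 hD' h, .seq (.fin _ _) hs⟩
  | seq_new hc =>
    cases hxy with | seq hx hy => rw [hx.created_eq_none.1] at hc; cases hc
  | alt_left _ ih =>
    cases hxy with
    | alt hx hy =>
      obtain ⟨K', y', h, hs⟩ := ih hx
      exact ⟨_, _, .alt_left h, hs⟩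
  | alt_right _ ih =>
    cases hxy with
    | alt hx hy =>
      obtain ⟨K', y', h, hs⟩ := ih hy
      exact ⟨_, _, .alt_right h, hs⟩
  | par_left _ ih =>
    cases hxy with
    | par hx hy =>
      obtain ⟨K', y', h, hs⟩ := ih hx
      exact ⟨_, _, .par_left h, .par hs hy⟩
  | par_right _ ih =>
    cases hxy with
    | par hx hy =>
      obtain ⟨K', y', h, hs⟩ := ih hy
      exact ⟨_, _, .par_right h, .par hx hs⟩
  | new | var | enc_tau | enc_act | abs => cases hxy

end SameShape

/-- The process `x` can finish without interference, whatever the numbers of its events. -/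
inductive Finishes (E : Spec Act Var S) (env : DataEnv Act S) : Term Act Var S → S → Prop
  | done {x : Term Act Var S} {s : S} {D : Set ℕ} (h : Done E s x D) : Finishes E env x s
  | step {x : Term Act Var S} {s s' : S} (a : Act) (K : ℕ → Set ℕ) (x' : ℕ → Term Act Var S)
      (h : ∀ k, Step E env k s x (some a) (K k) (x' k) s') (h' : ∀ k, Finishes E env (x' k) s') :
      Finishes E env x s

/-- `Completes` yields a run with event numbers that may not fit the actual history. Replaying it up
to `SameShape` gives a run for any numbers, in a form suited to induction. -/
theorem Finishes.of_run {E : Spec Act Var S} {env : DataEnv Act S} {I : Set Act}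
    {c c' : Term Act Var S × S} {D : Set ℕ}
    (h : Relation.ReflTransGen (OwnMove E env) c c') (hD : Done E c'.2 c'.1 D)
    (hc : Basic I c.1) {y : Term Act Var S} (hy : SameShape c.1 y) :
    Finishes E env y c.2 := by
  induction h using Relation.ReflTransGen.head_induction_on generalizing y with
  | refl => exact .done (SameShape.done hD hy).choose_spec
  | head h _ ih =>
    obtain ⟨k, l, K, h⟩ := h
    obtain ⟨hb, a, -, rfl, -⟩ := hc.step h
    choose K' y' h' hs using fun k' => SameShape.step k' h hy
    exact .step a K' y' h' fun k' => ih hb (hs k')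

/-- The computation `x` can have been reached in the data state `s`, when the computation `x₀` over
the actions in `I` was started in some data state. -/
def Reached (E : Spec Act Var S) (env : DataEnv Act S) (I : Set Act) (x₀ x : Term Act Var S)
    (s : S) : Prop :=
  ∃ s₀, Relation.ReflTransGen (fun d d' => OwnMove E env d d' ∨ OtherMove env I d d') (x₀, s₀)
    (x, s)

namespace Reached

variable {E : Spec Act Var S} {env : DataEnv Act S} {I : Set Act} {x₀ x : Term Act Var S} {s s' : S}

theorem start : Reached E env I x₀ x₀ s := ⟨s, .refl⟩

theorem own (hx : Reached E env I x₀ x s) {k : ℕ} {l : Option Act} {K : Set ℕ}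
    {x' : Term Act Var S} (h : Step E env k s x l K x' s') : Reached E env I x₀ x' s' :=
  ⟨_, hx.choose_spec.tail (.inl ⟨k, l, K, h⟩)⟩

theorem other (hx : Reached E env I x₀ x s) {a : Act} (ha : a ∉ I) (h : s' ∈ env.effect a s) :
    Reached E env I x₀ x s' :=
  ⟨_, hx.choose_spec.tail (.inr ⟨rfl, a, ha, h⟩)⟩

theorem basic (hx : Reached E env I x₀ x s) (h₀ : Basic I x₀) : Basic I x := by
  obtain ⟨s₀, h⟩ := hx
  have key : ∀ c, Relation.ReflTransGen
      (fun d d' => OwnMove E env d d' ∨ OtherMove env I d d') (x₀, s₀) c → Basic I c.1 := by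
    intro c h
    induction h with
    | refl => exact h₀
    | tail _ h ih =>
      rcases h with ⟨k, l, K, h⟩ | ⟨h, -⟩
      · exact (ih.step h).1
      · exact h ▸ ih
  exact key _ h

theorem finishes (hx : Reached E env I x₀ x s) (h₀ : Basic I x₀) (hc : Completes E env I x₀) :
    Finishes E env x s := by
  obtain ⟨c', D, h, hD⟩ := hc _ _ hx.choose_spec
  exact Finishes.of_run h hD (hx.basic h₀) (hx.basic h₀).sameShape

end Reached

/-! ### Parallel compositions of atomic actions -/

/-- The actions that remain to be executed in a parallel composition of atomic actions. -/
inductive Remaining : Term Act Var S → Multiset Act → Prop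
  | fin (D : Set ℕ) : Remaining (.fin D) 0
  | act (a : Act) : Remaining (.act a) {a}
  | par {x y : Term Act Var S} {A B : Multiset Act} (hx : Remaining x A) (hy : Remaining y B) :
      Remaining (.par x y) (A + B)

namespace Remaining

variable {E : Spec Act Var S} {env : DataEnv Act S} {x : Term Act Var S} {A : Multiset Act}
  {s s' : S}

theorem basic (hx : Remaining x A) : Basic Set.univ x := by
  induction hx with
  | fin D => exact .fin D
  | act a => exact .act trivial
  | par _ _ ihx ihy => exact .par ihx ihy

theorem step (hx : Remaining x A) {k : ℕ} {a : Act} {K : Set ℕ} {x' : Term Act Var S}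
    (h : Step E env k s x (some a) K x' s') : ∃ B, A = a ::ₘ B ∧ Remaining x' B := by
  induction hx generalizing x' K with
  | fin D => cases h
  | act a =>
    obtain ⟨-, hl, -, rfl⟩ := step_act_iff.1 h
    cases hl
    exact ⟨0, rfl, .fin _⟩
  | par hx hy ihx ihy =>
    cases h with
    | par_left h =>
      obtain ⟨B, rfl, hB⟩ := ihx h
      exact ⟨_, Multiset.cons_add _ _ _, .par hB hy⟩
    | par_right h =>
      obtain ⟨B, rfl, hB⟩ := ihy h
      exact ⟨_, Multiset.add_cons _ _ _, .par hx hB⟩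

theorem eq_zero_of_done (hx : Remaining x A) {D : Set ℕ} (h : Done E s x D) : A = 0 := by
  induction hx generalizing D with
  | fin D => rfl
  | act a => cases h
  | par _ _ ihx ihy =>
    cases h with
    | par h h' => rw [ihx h, ihy h', add_zero]

theorem exists_done (hx : Remaining x 0) : ∃ D, Done E s x D := by
  generalize hA : (0 : Multiset Act) = A at hx
  induction hx with
  | fin D => exact ⟨D, .fin D⟩
  | act a => exact absurd hA.symm (Multiset.singleton_ne_zero a)
  | par _ _ ihx ihy =>
    obtain ⟨rfl, rfl⟩ := add_eq_zero.1 hA.symm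
    exact ⟨_, .par (ihx rfl).choose_spec (ihy rfl).choose_spec⟩

theorem exists_step (hx : Remaining x A) (k : ℕ) {a : Act} (ha : a ∈ A)
    (hs : s' ∈ env.effect a s) : ∃ K x', Step E env k s x (some a) K x' s' := by
  induction hx with
  | fin D => exact absurd ha (Multiset.notMem_zero a)
  | act a =>
    obtain rfl := Multiset.mem_singleton.1 ha
    exact ⟨_, _, .act hs⟩
  | par _ _ ihx ihy =>
    rcases Multiset.mem_add.1 ha with ha | ha
    · obtain ⟨K, x', h⟩ := ihx ha
      exact ⟨_, _, .par_left h⟩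
    · obtain ⟨K, x', h⟩ := ihy ha
      exact ⟨_, _, .par_right h⟩

theorem parList_act (l : List Act) :
    Remaining (parList (l.map fun a => (.act a : Term Act Var S))) (l : Multiset Act) := by
  induction l with
  | nil => exact .fin _
  | cons a l ih =>
    cases l with
    | nil => exact .act a
    | cons b l => exact .par (.act a) ih

end Remaining

/-! ### Threads -/

/-- A sequential thread: it has executed the events `past`, it executes `term`, and then it
continues with `next`. -/
structure Thread (Act : Type u) (Var : Type v) (S : Type w) where
  past : Set ℕ
  term : Term Act Var S
  next : Var

/-- The thread after the events `D`. -/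
def Thread.after (D : Set ℕ) (θ : Thread Act Var S) : Thread Act Var S :=
  ⟨D ∪ θ.past, θ.term, θ.next⟩

theorem Thread.after_empty : (Thread.after ∅ : Thread Act Var S → Thread Act Var S) = id := by
  funext θ
  simp [Thread.after]

theorem Thread.map_after_after (D D' : Set ℕ) (M : Multiset (Thread Act Var S)) :
    (M.map (Thread.after D')).map (Thread.after D) = M.map (Thread.after (D ∪ D')) := by
  rw [Multiset.map_map]
  exact Multiset.map_congr rfl fun θ _ => by simp [Thread.after, Set.union_assoc]

/-- `Flat E U t M`: the process `t` is the parallel composition of the threads `M`, whose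
continuations are in `U`. -/
inductive Flat (E : Spec Act Var S) (U : Set Var) :
    Term Act Var S → Multiset (Thread Act Var S) → Prop
  | thread {x : Term Act Var S} {X : Var} (hX : X ∈ U) (hx : Basic Set.univ x) :
      Flat E U (.seq x (.var X)) {⟨∅, x, X⟩}
  | fin {y : Term Act Var S} {M : Multiset (Thread Act Var S)} (D : Set ℕ) (h : Flat E U y M) :
      Flat E U (.seq (.fin D) y) (M.map (Thread.after D))
  | par {x y : Term Act Var S} {M N : Multiset (Thread Act Var S)} (hx : Flat E U x M)
      (hy : Flat E U y N) : Flat E U (.par x y) (M + N)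
  | var {X : Var} {M : Multiset (Thread Act Var S)} (h : Flat E U (E X) M) : Flat E U (.var X) M
  | new {x x' y : Term Act Var S} {M : Multiset (Thread Act Var S)} (hx : created x = some x')
      (h : Flat E U (.par x' y) M) : Flat E U (.seq x y) M

/-- `Fires E env thr k s M l K M' s'`: one of the threads `M` executes the event number `k`, where
`thr X` are the threads of the variable `X`. -/
inductive Fires (E : Spec Act Var S) (env : DataEnv Act S)
    (thr : Var → Multiset (Thread Act Var S)) (k : ℕ) (s : S) :
    Multiset (Thread Act Var S) → Option Act → Set ℕ → Multiset (Thread Act Var S) → S → Prop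
  | step {D : Set ℕ} {x x' : Term Act Var S} {X : Var} {l : Option Act} {K : Set ℕ} {s' : S}
      (N : Multiset (Thread Act Var S)) (h : Step E env k s x l K x' s') :
      Fires E env thr k s (⟨D, x, X⟩ ::ₘ N) l (D ∪ K) (⟨D, x', X⟩ ::ₘ N) s'
  | next {D D' : Set ℕ} {x : Term Act Var S} {X : Var} {l : Option Act} {K : Set ℕ} {s' : S}
      {M : Multiset (Thread Act Var S)} (N : Multiset (Thread Act Var S)) (hD : Done E s x D')
      (h : Fires E env thr k s (thr X) l K M s') :
      Fires E env thr k s (⟨D, x, X⟩ ::ₘ N) l (D ∪ D' ∪ K)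
        (M.map (Thread.after (D ∪ D')) + N) s'

section

variable {E : Spec Act Var S} {env : DataEnv Act S} {U : Set Var}
  {thr : Var → Multiset (Thread Act Var S)} {k : ℕ} {s s' : S} {t t' : Term Act Var S}
  {M M' N : Multiset (Thread Act Var S)} {l : Option Act} {K : Set ℕ}

theorem Fires.add (h : Fires E env thr k s M l K M' s') (N : Multiset (Thread Act Var S)) :
    Fires E env thr k s (M + N) l K (M' + N) s' := by
  cases h with
  | step N₀ h =>
    rw [Multiset.cons_add, Multiset.cons_add]
    exact .step _ h
  | next N₀ hD h =>
    rw [Multiset.cons_add, add_assoc]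
    exact .next _ hD h

theorem Fires.after (h : Fires E env thr k s M l K M' s') (D : Set ℕ) :
    Fires E env thr k s (M.map (Thread.after D)) l (D ∪ K) (M'.map (Thread.after D)) s' := by
  cases h with
  | step N₀ h =>
    rw [Multiset.map_cons, Multiset.map_cons, ← Set.union_assoc]
    exact .step _ h
  | next N₀ hD h =>
    rw [Multiset.map_cons, Multiset.map_add, Thread.map_after_after, ← Set.union_assoc,
      ← Set.union_assoc]
    exact .next _ hD h

theorem Flat.of_mem (h : Flat E U t M) {θ : Thread Act Var S} (hθ : θ ∈ M) :
    θ.next ∈ U ∧ Basic Set.univ θ.term := by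
  induction h generalizing θ with
  | thread hX hx =>
    rw [Multiset.mem_singleton.1 hθ]
    exact ⟨hX, hx⟩
  | fin D _ ih =>
    obtain ⟨θ', hθ', rfl⟩ := Multiset.mem_map.1 hθ
    exact ih (θ := θ') hθ'
  | par _ _ ihx ihy => exact (Multiset.mem_add.1 hθ).elim ihx ihy
  | var _ ih => exact ih hθ
  | new _ _ ih => exact ih hθ

/-- Termination of a parallel composition requires every thread to terminate. To exclude it, the
continuation of a single thread suffices. -/
theorem Flat.done (h : Flat E U t M) {D : Set ℕ} (hD : Done E s t D) {θ : Thread Act Var S}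
    (hθ : θ ∈ M) : ∃ D', Done E s (.var θ.next) D' := by
  induction h generalizing θ D with
  | thread hX hx =>
    rw [Multiset.mem_singleton.1 hθ]
    cases hD with
    | seq _ _ h => exact ⟨_, h⟩
    | seq_new hc => rw [hx.created_eq_none] at hc; cases hc
  | fin D _ ih =>
    obtain ⟨θ', hθ', rfl⟩ := Multiset.mem_map.1 hθ
    cases hD with
    | seq _ _ h => exact ih (θ := θ') h hθ'
    | seq_new hc => cases hc
  | par _ _ ihx ihy =>
    cases hD with
    | par h h' => exact (Multiset.mem_add.1 hθ).elim (ihx h) (ihy h')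
  | var _ ih =>
    cases hD with
    | var h => exact ih h hθ
  | new hx _ ih =>
    cases hD with
    | seq hc => rw [hx] at hc; cases hc
    | seq_new hc h =>
      rw [hx] at hc
      cases hc
      exact ih h hθ

/-- Every transition of a process is a transition of one of its threads. -/
theorem Flat.fires (hthr : ∀ X ∈ U, Flat E U (.var X) (thr X)) (ht : Flat E U t M)
    (h : Step E env k s t l K t' s') :
    ∃ M', Fires E env thr k s M l K M' s' ∧ Flat E U t' M' := by
  induction h generalizing M with
  | act | alt_left | alt_right | new | enc_tau | enc_act | abs => cases ht
  | seq_left hc h ih =>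
    cases ht with
    | @thread _ X hX hx =>
      refine ⟨_, ?_, .thread hX (hx.step h).1⟩
      have := Fires.step (thr := thr) (D := ∅) (X := X) 0 h
      rw [Set.empty_union] at this
      exact this
    | fin => exact absurd h not_step_fin
    | new hc' => rw [hc] at hc'; cases hc'
  | seq_right hc hD h ih =>
    cases ht with
    | thread hX hx =>
      -- The continuation is a variable; `hthr` flattens it, so the induction hypothesis applies to
      -- its transition.
      obtain ⟨M', hM', hf⟩ := ih (hthr _ hX)
      refine ⟨_, ?_, .fin _ hf⟩
      have := Fires.next (D := ∅) 0 hD hM'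
      rwa [Set.empty_union, add_zero] at this
    | fin D ht =>
      obtain rfl := done_fin_iff.1 hD
      obtain ⟨M', hM', hf⟩ := ih ht
      exact ⟨_, hM'.after _, .fin _ hf⟩
    | new hc' => rw [hc] at hc'; cases hc'
  | seq_new hc h ih =>
    cases ht with
    | thread hX hx => rw [hx.created_eq_none] at hc; cases hc
    | fin => cases hc
    | new hc' ht =>
      rw [hc] at hc'
      cases hc'
      exact ih ht
  | par_left h ih =>
    cases ht with
    | par hx hy =>
      obtain ⟨M', hM', hf⟩ := ih hx
      exact ⟨_, hM'.add _, .par hf hy⟩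
  | par_right h ih =>
    cases ht with
    | par hx hy =>
      obtain ⟨M', hM', hf⟩ := ih hy
      rw [add_comm]
      refine ⟨_, hM'.add _, ?_⟩
      rw [add_comm]
      exact .par hx hf
  | var h ih =>
    cases ht with
    | var ht => exact ih ht

/-- The context rule for threads. The transition is that of the whole thread `θ.term · θ.next`,
which covers both an event of the term and the passage to the continuation; the context contributes
the past of the thread as causes. -/
theorem Flat.step_of_thread {θ : Thread Act Var S} {z : Term Act Var S}
    {Mz : Multiset (Thread Act Var S)} (ht : Flat E U t (θ ::ₘ N))
    (h : Step E env k s (.seq θ.term (.var θ.next)) l K z s') (hz : Flat E U z Mz) :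
    ∃ t', Step E env k s t l (θ.past ∪ K) t' s' ∧
      Flat E U t' (Mz.map (Thread.after θ.past) + N) := by
  generalize hM : θ ::ₘ N = M at ht
  induction ht generalizing θ N with
  | thread hX hx =>
    obtain ⟨rfl, rfl⟩ := Multiset.singleton_eq_cons_iff _ |>.1 hM.symm
    refine ⟨z, ?_, ?_⟩
    · rwa [Set.empty_union]
    · rwa [Thread.after_empty, Multiset.map_id, add_zero]
  | @fin y M D _ ih =>
    obtain ⟨θ', hθ', rfl⟩ := Multiset.mem_map.1 (hM ▸ Multiset.mem_cons_self θ N)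
    obtain ⟨N', rfl⟩ := Multiset.exists_cons_of_mem hθ'
    rw [Multiset.map_cons, Multiset.cons_inj_right] at hM
    obtain ⟨t', ht', hf⟩ := ih (θ := θ') h rfl
    refine ⟨.seq (.fin D) t', ?_, ?_⟩
    · have := Step.seq_right (x := .fin D) rfl (.fin D) ht'
      rw [← Set.union_assoc] at this
      exact this
    · have := Flat.fin D hf
      rw [Multiset.map_add, Thread.map_after_after, ← hM] at this
      exact this
  | @par x y M₁ M₂ hx hy ihx ihy =>
    have hθ : θ ∈ M₁ + M₂ := hM ▸ Multiset.mem_cons_self θ N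
    rcases Multiset.mem_add.1 hθ with hθ | hθ
    · obtain ⟨N', rfl⟩ := Multiset.exists_cons_of_mem hθ
      obtain ⟨t', ht', hf⟩ := ihx h rfl
      rw [Multiset.cons_add, Multiset.cons_inj_right] at hM
      refine ⟨_, .par_left ht', ?_⟩
      rw [hM, ← add_assoc]
      exact .par hf hy
    · obtain ⟨N', rfl⟩ := Multiset.exists_cons_of_mem hθ
      obtain ⟨t', ht', hf⟩ := ihy h rfl
      rw [Multiset.add_cons, Multiset.cons_inj_right] at hM
      refine ⟨_, .par_right ht', ?_⟩
      rw [hM, add_left_comm]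
      exact .par hx hf
  | var _ ih =>
    obtain ⟨t', ht', hf⟩ := ih h hM
    exact ⟨t', .var ht', hf⟩
  | new hx _ ih =>
    obtain ⟨t', ht', hf⟩ := ih h hM
    exact ⟨t', .seq_new hx ht', hf⟩

/-- Every transition of a thread is a transition of the process. -/
theorem Flat.exists_step (hthr : ∀ X ∈ U, Flat E U (.var X) (thr X))
    (h : Fires E env thr k s M l K M' s') (ht : Flat E U t M) :
    ∃ t', Step E env k s t l K t' s' ∧ Flat E U t' M' := by
  induction h generalizing t with
  | @step D x x' X l K s' N h =>
    obtain ⟨hX, hx⟩ := ht.of_mem (Multiset.mem_cons_self _ N)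
    obtain ⟨t', ht', hf⟩ := ht.step_of_thread (.seq_left hx.created_eq_none h)
      (.thread hX (hx.step h).1)
    refine ⟨t', ht', ?_⟩
    simpa [Thread.after] using hf
  | @next D D' x X l K s' M N hD h ih =>
    obtain ⟨hX, hx⟩ := ht.of_mem (Multiset.mem_cons_self _ N)
    obtain ⟨z, hz, hzf⟩ := ih (hthr _ hX)
    obtain ⟨t', ht', hf⟩ := ht.step_of_thread (.seq_right hx.created_eq_none hD hz)
      (.fin D' hzf)
    rw [← Set.union_assoc] at ht'
    rw [Thread.map_after_after] at hf
    exact ⟨t', ht', hf⟩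

/-- A thread that has executed its term is as well the parallel composition of the threads of its
continuation. -/
theorem Flat.of_fin (hthr : ∀ X ∈ U, Flat E U (.var X) (thr X)) {D D' : Set ℕ} {X : Var}
    (ht : Flat E U t (⟨D, .fin D', X⟩ ::ₘ N)) :
    Flat E U t ((thr X).map (Thread.after (D ∪ D')) + N) := by
  generalize hM : (⟨D, .fin D', X⟩ ::ₘ N : Multiset (Thread Act Var S)) = M at ht
  induction ht generalizing D N with
  | @thread x X' hX hx =>
    obtain ⟨h, rfl⟩ := Multiset.singleton_eq_cons_iff _ |>.1 hM.symm
    cases h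
    rw [Set.empty_union, add_zero]
    -- `fin D' · X` has two readings: a thread with a finished term, and the flattened continuation
    -- after the events `D'`.
    exact .fin _ (hthr _ hX)
  | @fin y M D₀ _ ih =>
    obtain ⟨⟨D₁, x₁, X₁⟩, hθ', hθ⟩ := Multiset.mem_map.1 (hM ▸ Multiset.mem_cons_self _ N)
    obtain ⟨N', rfl⟩ := Multiset.exists_cons_of_mem hθ'
    cases hθ
    rw [Multiset.map_cons] at hM
    replace hM := (Multiset.cons_inj_right _).1 hM
    have := Flat.fin D₀ (ih rfl)
    rw [Multiset.map_add, Thread.map_after_after, ← Set.union_assoc] at this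
    simpa [hM] using this
  | @par x y M₁ M₂ hx hy ihx ihy =>
    have hθ : (⟨D, .fin D', X⟩ : Thread Act Var S) ∈ M₁ + M₂ :=
      hM ▸ Multiset.mem_cons_self _ N
    rcases Multiset.mem_add.1 hθ with hθ | hθ
    · obtain ⟨N', rfl⟩ := Multiset.exists_cons_of_mem hθ
      rw [Multiset.cons_add, Multiset.cons_inj_right] at hM
      rw [hM, ← add_assoc]
      exact .par (ihx rfl) hy
    · obtain ⟨N', rfl⟩ := Multiset.exists_cons_of_mem hθ
      rw [Multiset.add_cons, Multiset.cons_inj_right] at hM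
      rw [hM, add_left_comm]
      exact .par hx (ihy rfl)
  | var _ ih => exact .var (ih hM)
  | new hx _ ih => exact .new hx (ih hM)

end

end APTC

namespace GFS

open APTC

universe u w

variable {n : ℕ} {A : Type u} {S : Type w}

/-! ### The actions and the threads of the actors -/

notation "rReq" => Action.recv Name.CA Msg.DI_CA
notation "sResp" => Action.send Name.O Msg.DO_CA
notation "sMas" => Action.send Name.Mas Msg.DI_Mas
notation "rMas" => Action.recv Name.Mas Msg.DI_Mas
notation "sDI[" i "]" => Action.send (Name.CSA i) (Msg.DI_CSA i)
notation "rDI[" i "]" => Action.recv (Name.CSA i) (Msg.DI_CSA i)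
notation "sDO[" i "]" => Action.send Name.CA (Msg.DO_CSA i)
notation "rDO[" i "]" => Action.recv Name.CA (Msg.DO_CSA i)

/-- The visible actions: the request, and the response to it. -/
def ext (n : ℕ) (A : Type u) : Bool → Action n A
  | false => rReq
  | true => sResp

abbrev Thr (n : ℕ) (A : Type u) (S : Type w) := Thread (Action n A) (Var n) S

/-- The variables of the actors. -/
def actorVars (n : ℕ) : Set (Var n) := {X | X ≠ .Loop}

/-- The newly created chunk servers. -/
def newServers (n : ℕ) (A : Type u) (S : Type w) : Multiset (Thr n A S) :=
  (List.ofFn fun i => ⟨∅, .act rDI[i], .CSA₁ i⟩ : List (Thr n A S))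

def threads (L : Computations n A S) : Var n → Multiset (Thr n A S)
  | .CA => {⟨∅, .act rReq, .CA₁⟩}
  | .CA₁ => {⟨∅, L.ca, .CA₂⟩}
  | .CA₂ => {⟨∅, .act sMas, .CA₃⟩}
  | .CA₃ => {⟨∅, parFin fun i => .act rDO[i], .CA₄⟩}
  | .CA₄ => {⟨∅, L.ca', .CA₅⟩}
  | .CA₅ => {⟨∅, .act sResp, .CA⟩}
  | .CSA i => {⟨∅, .act rDI[i], .CSA₁ i⟩}
  | .CSA₁ i => {⟨∅, L.csa i, .CSA₂ i⟩}
  | .CSA₂ i => {⟨∅, .act sDO[i], .CSA i⟩}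
  | .Mas => {⟨∅, .act rMas, .Mas₁⟩}
  | .Mas₁ => {⟨∅, L.mas, .Mas₂⟩}
  | .Mas₂ => newServers n A S + {⟨∅, parFin fun i => .act sDI[i], .Mas⟩}
  | .Mas₃ => {⟨∅, parFin fun i => .act sDI[i], .Mas⟩}
  | .Loop => 0

theorem remaining_parFin (f : Fin n → Action n A) :
    Remaining (parFin fun i => (.act (f i) : Proc n A S))
      ((Finset.univ : Finset (Fin n)).val.map f) := by
  have h := Remaining.parList_act (Var := Var n) (S := S) (List.ofFn f)
  rw [List.map_ofFn] at h
  have e : ((List.ofFn f : List _) : Multiset (Action n A)) =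
      (Finset.univ : Finset (Fin n)).val.map f := by
    rw [Fin.univ_def]
    simp [List.ofFn_eq_map]
  rwa [e] at h

theorem Flat.parList {E : Spec (Action n A) (Var n) S} {U : Set (Var n)} {ι : Type*}
    {f : ι → Proc n A S} {g : ι → Thr n A S} (hfg : ∀ i, Flat E U (f i) {g i}) {l : List ι}
    (hl : l ≠ []) : Flat E U (parList (l.map f)) (l.map g : List (Thr n A S)) := by
  induction l with
  | nil => exact absurd rfl hl
  | cons i l ih =>
    cases l with
    | nil => exact hfg i
    | cons i' l => exact Flat.par (hfg i) (ih (List.cons_ne_nil _ _))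

/-- The empty parallel composition is `fin ∅`, which is not a creation; so the list must be
nonempty. -/
theorem created_parList_new {ι : Type*} (f : ι → Proc n A S) {l : List ι} (hl : l ≠ []) :
    created (parList (l.map fun i => .new (f i))) = some (parList (l.map f)) := by
  induction l with
  | nil => exact absurd rfl hl
  | cons i l ih =>
    cases l with
    | nil => rfl
    | cons i' l =>
      have := ih (List.cons_ne_nil _ _)
      simp only [List.map_cons] at this ⊢
      simp only [parList, created, this]

variable {env : DataEnv (Action n A) S} {L : Computations n A S}

theorem flat_thread {X Y : Var n} {x : Proc n A S} (hX : spec L X = .seq x (.var Y))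
    (hY : Y ≠ .Loop) (hx : Basic Set.univ x) :
    Flat (spec L) (actorVars n) (.var X) {⟨∅, x, Y⟩} :=
  .var (hX ▸ .thread hY hx)

theorem flat_servers (i₀ : Fin n) :
    Flat (spec L) (actorVars n) (parFin fun i => .var (.CSA i)) (newServers n A S) := by
  rw [newServers, parFin, List.ofFn_eq_map, List.ofFn_eq_map]
  exact Flat.parList (fun i => flat_thread rfl (by simp) (.act trivial))
    (List.ne_nil_of_mem (List.mem_finRange i₀))

/-- Each actor variable unfolds to one thread, except `Mas₂`: there the creation unfolds to the new
servers next to the thread of `Mas₃`. The index `i₀` witnesses that there is a server to create. -/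
theorem flat_threads (i₀ : Fin n) (hL : L.Valid env) :
    ∀ X ∈ actorVars n, Flat (spec L) (actorVars n) (.var X) (threads L X) := by
  intro X hX
  have sends : Flat (spec L) (actorVars n) (.var .Mas₃) (threads L .Mas₃) :=
    flat_thread rfl (by simp) (remaining_parFin _).basic
  cases X with
  | CA | CA₂ | CA₅ | CSA | CSA₂ | Mas => exact flat_thread rfl (by simp) (.act trivial)
  | CA₁ => exact flat_thread rfl (by simp) (hL.ca_local.basic.mono (Set.subset_univ _))
  | CA₄ => exact flat_thread rfl (by simp) (hL.ca'_local.basic.mono (Set.subset_univ _))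
  | CSA₁ i => exact flat_thread rfl (by simp) ((hL.csa_local i).basic.mono (Set.subset_univ _))
  | Mas₁ => exact flat_thread rfl (by simp) (hL.mas_local.basic.mono (Set.subset_univ _))
  | CA₃ => exact flat_thread rfl (by simp) (remaining_parFin _).basic
  | Mas₂ =>
    refine .var (.new (x' := parFin fun i => .var (.CSA i)) ?_ (.par (flat_servers i₀) sends))
    rw [parFin, parFin, List.ofFn_eq_map, List.ofFn_eq_map]
    exact created_parList_new _ (List.ne_nil_of_mem (List.mem_finRange i₀))
  | Mas₃ => exact sends
  | Loop => exact absurd rfl hX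

/-! ### Counting communications -/

/-- The number of the occurrences of `a`. -/
noncomputable def cnt (m : List (Action n A × ℕ)) (a : Action n A) : ℕ := (occ m a).length

open scoped Classical in
/-- One more occurrence of `a`. -/
noncomputable def bump (c : Action n A → ℕ) (a : Action n A) (x : Action n A) : ℕ :=
  c x + if x = a then 1 else 0

theorem cnt_append (m : List (Action n A × ℕ)) (a : Action n A) (k : ℕ) :
    cnt (m ++ [(a, k)]) = bump (cnt m) a := by
  classical
  funext x
  by_cases h : a = x
  · simp [cnt, bump, occ, List.filter_append, h]
  · simp [cnt, bump, occ, List.filter_append, h, Ne.symm h]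

@[simp]
theorem bump_loc_send (c : Action n A → ℕ) (X Y : Name n) (a : A) (d : Msg n) :
    bump c (.loc X a) (.send Y d) = c (.send Y d) := by simp [bump]

@[simp]
theorem bump_loc_recv (c : Action n A → ℕ) (X Y : Name n) (a : A) (d : Msg n) :
    bump c (.loc X a) (.recv Y d) = c (.recv Y d) := by simp [bump]

theorem mem_internal_of_constraint {s r : Action n A} (h : Constraint n A (s, r)) :
    s ∈ internal n A ∧ r ∈ internal n A :=
  ⟨.inl (.inl (.inl ⟨_, h, .inl rfl⟩)), .inl (.inl (.inl ⟨_, h, .inr rfl⟩))⟩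

theorem ext_notMem_internal (b : Bool) : ext n A b ∉ internal n A := by
  rintro (((⟨p, hp, h⟩ | ⟨a, h⟩) | h) | ⟨a, h⟩)
  · cases b <;> cases hp <;> simp [ext] at h
  · cases b <;> simp [ext] at h
  · simp only [Set.mem_iUnion] at h
    obtain ⟨i, a, h⟩ := h
    cases b <;> simp [ext] at h
  · cases b <;> simp [ext] at h

theorem send_notMem_local (X Y : Name n) (d : Msg n) :
    Action.send Y d ∉ localActions n A X := fun ⟨_, h⟩ => by cases h

theorem recv_notMem_local (X Y : Name n) (d : Msg n) :
    Action.recv Y d ∉ localActions n A X := fun ⟨_, h⟩ => by cases h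

theorem notMem_local {X Y : Name n} (h : X ≠ Y) {a : Action n A} (ha : a ∈ localActions n A X) :
    a ∉ localActions n A Y := by
  rintro ⟨b, hb⟩
  obtain ⟨a', rfl⟩ := ha
  cases hb
  exact h rfl

/-! ### The invariant -/

/-- The states of the client in the round number `j`, where `c` counts the communications; the
`Bool` tells whether it has received a request. -/
inductive ClientState (env : DataEnv (Action n A) S) (L : Computations n A S) (j : ℕ)
    (c : Action n A → ℕ) (s : S) : Bool → Thr n A S → Prop
  | idle (D : Set ℕ) (h : c sMas = j) : ClientState env L j c s false ⟨D, .act rReq, .CA₁⟩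
  | prepare (D : Set ℕ) {x : Proc n A S}
      (hx : Reached (spec L) env (localActions n A .CA) L.ca x s) (h : c sMas = j) :
      ClientState env L j c s true ⟨D, x, .CA₂⟩
  | send (D : Set ℕ) (h : c sMas = j) : ClientState env L j c s true ⟨D, .act sMas, .CA₃⟩
  | collect (D : Set ℕ) {x : Proc n A S} {B : Multiset (Fin n)}
      (hx : Remaining x (B.map fun i => rDO[i])) (h : c sMas = j + 1)
      (hB : ∀ i, c rDO[i] + B.count i = j + 1) : ClientState env L j c s true ⟨D, x, .CA₄⟩
  | process (D : Set ℕ) {x : Proc n A S}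
      (hx : Reached (spec L) env (localActions n A .CA) L.ca' x s)
      (h : ∀ i : Fin n, c rDO[i] = j + 1) : ClientState env L j c s true ⟨D, x, .CA₅⟩
  | respond (D : Set ℕ) (h : ∀ i : Fin n, c rDO[i] = j + 1) :
      ClientState env L j c s true ⟨D, .act sResp, .CA⟩

inductive MasterState (env : DataEnv (Action n A) S) (L : Computations n A S)
    (c : Action n A → ℕ) (s : S) : Thr n A S → Prop
  | idle (D : Set ℕ) (h : ∀ i : Fin n, c sDI[i] = c rMas) :
      MasterState env L c s ⟨D, .act rMas, .Mas₁⟩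
  | work (D : Set ℕ) {x : Proc n A S}
      (hx : Reached (spec L) env (localActions n A .Mas) L.mas x s)
      (h : ∀ i : Fin n, c sDI[i] + 1 = c rMas) : MasterState env L c s ⟨D, x, .Mas₂⟩
  | assign (D : Set ℕ) {x : Proc n A S} {B : Multiset (Fin n)}
      (hx : Remaining x (B.map fun i => sDI[i])) (hB : ∀ i, c sDI[i] + B.count i = c rMas) :
      MasterState env L c s ⟨D, x, .Mas⟩

inductive ServerState (env : DataEnv (Action n A) S) (L : Computations n A S) (s : S) :
    Thr n A S → Prop
  | idle (D : Set ℕ) (i : Fin n) : ServerState env L s ⟨D, .act rDI[i], .CSA₁ i⟩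
  | work (D : Set ℕ) (i : Fin n) {x : Proc n A S}
      (hx : Reached (spec L) env (localActions n A (.CSA i)) (L.csa i) x s) :
      ServerState env L s ⟨D, x, .CSA₂ i⟩
  | reply (D : Set ℕ) (i : Fin n) : ServerState env L s ⟨D, .act sDO[i], .CSA i⟩

/-- For the client, an action of another actor only changes the data state. A running local
computation tolerates this, since `Reached` allows foreign moves. -/
theorem ClientState.frame {j : ℕ} {c c' : Action n A → ℕ} {s s' : S} {b : Bool} {θ : Thr n A S}
    (h : ClientState env L j c s b θ) (h₁ : c' sMas = c sMas)
    (h₂ : ∀ i : Fin n, c' rDO[i] = c rDO[i]) {a : Action n A} (ha : a ∉ localActions n A .CA)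
    (hs : s' ∈ env.effect a s) : ClientState env L j c' s' b θ := by
  cases h with
  | idle D h => exact .idle D (h₁.trans h)
  | prepare D hx h => exact .prepare D (hx.other ha hs) (h₁.trans h)
  | send D h => exact .send D (h₁.trans h)
  | collect D hx h hB => exact .collect D hx (h₁.trans h) fun i => by rw [h₂, hB]
  | process D hx h => exact .process D (hx.other ha hs) fun i => by rw [h₂, h]
  | respond D h => exact .respond D fun i => by rw [h₂, h]

theorem MasterState.frame {c c' : Action n A → ℕ} {s s' : S} {θ : Thr n A S}
    (h : MasterState env L c s θ) (h₁ : c' rMas = c rMas)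
    (h₂ : ∀ i : Fin n, c' sDI[i] = c sDI[i]) {a : Action n A} (ha : a ∉ localActions n A .Mas)
    (hs : s' ∈ env.effect a s) : MasterState env L c' s' θ := by
  cases h with
  | idle D h => exact .idle D fun i => by rw [h₁, h₂, h]
  | work D hx h => exact .work D (hx.other ha hs) fun i => by rw [h₁, h₂, h]
  | assign D hx hB => exact .assign D hx fun i => by rw [h₁, h₂, hB]

/-- Only a copy that is computing is sensitive to the data state, so the hypothesis on `a` concerns
the continuation `CSA₂` alone. -/
theorem ServerState.frame {s s' : S} {θ : Thr n A S} (h : ServerState env L s θ) {a : Action n A}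
    (ha : ∀ i, θ.next = .CSA₂ i → a ∉ localActions n A (.CSA i)) (hs : s' ∈ env.effect a s) :
    ServerState env L s' θ := by
  cases h with
  | idle D i => exact .idle D i
  | work D i hx => exact .work D i (hx.other (ha i rfl) hs)
  | reply D i => exact .reply D i

/-- Whether a thread is a copy of the chunk server number `i`. -/
def serves (i : Fin n) : Var n → Prop
  | .CSA k => k = i
  | .CSA₁ k => k = i
  | .CSA₂ k => k = i
  | _ => False

/-- Whether a thread is a copy of the chunk server number `i` that has received a request. -/
def busy (i : Fin n) : Var n → ℕ
  -- A copy continues with `.CSA k` while it has yet to reply, and with `.CSA₂ k` while it computes;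
  -- a waiting copy continues with `.CSA₁ k`.
  | .CSA k => if k = i then 1 else 0
  | .CSA₂ k => if k = i then 1 else 0
  | _ => 0

/-- The number of the busy copies of the chunk server number `i`. -/
def load (i : Fin n) (N : Multiset (Thr n A S)) : ℕ := (N.map fun θ => busy i θ.next).sum

@[simp]
theorem load_cons (i : Fin n) (θ : Thr n A S) (N : Multiset (Thr n A S)) :
    load i (θ ::ₘ N) = busy i θ.next + load i N := by simp [load]

@[simp]
theorem load_add (i : Fin n) (M N : Multiset (Thr n A S)) :
    load i (M + N) = load i M + load i N := by simp [load]

theorem busy_le_load (i : Fin n) {θ : Thr n A S} {N : Multiset (Thr n A S)} (h : θ ∈ N) :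
    busy i θ.next ≤ load i N :=
  Multiset.single_le_sum (fun _ _ => Nat.zero_le _) _ (Multiset.mem_map_of_mem _ h)

/-- The invariant of the round number `j`: the threads are the client `ca`, the master `mas` and the
chunk servers `N`; `c` counts the communications, and `V` are the visible events of the past. -/
structure Inv (env : DataEnv (Action n A) S) (L : Computations n A S) (j : ℕ) (b : Bool)
    (V : Set ℕ) (c : Action n A → ℕ) (s : S) (ca mas : Thr n A S) (N : Multiset (Thr n A S)) :
    Prop where
  client : ClientState env L j c s b ca
  past : V ⊆ ca.past
  master : MasterState env L c s mas
  servers : ∀ θ ∈ N, ServerState env L s θ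
  load : ∀ i, c sDO[i] + load i N = c rDI[i]
  -- Without initial servers there is no copy before the first creation; once the master assigns, or
  -- has ever assigned, there is one.
  avail : ∀ i, mas.next = .Mas ∨ 0 < c sDI[i] → ∃ θ ∈ N, serves i θ.next
  -- The missing link `c sDO[i] ≤ c rDI[i]` follows from `load`, so all the counters lie between `j`
  -- and `j + 1`.
  le : ∀ i : Fin n, j ≤ c rDO[i] ∧ c rDO[i] ≤ c sDO[i] ∧ c rDI[i] ≤ c sDI[i] ∧
    c sDI[i] ≤ c rMas ∧ c rMas ≤ c sMas ∧ c sMas ≤ j + 1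

/-- The threads `M` satisfy the invariant. -/
def Good (env : DataEnv (Action n A) S) (L : Computations n A S) (j : ℕ) (b : Bool)
    (V : Set ℕ) (c : Action n A → ℕ) (s : S) (M : Multiset (Thr n A S)) : Prop :=
  ∃ ca mas N, M = ca ::ₘ mas ::ₘ N ∧ Inv env L j b V c s ca mas N

/-- The case distinction for a distinguished thread: it is the client, the master or a server. -/
theorem cons_eq_cons_cons {α : Type*} {a b c : α} {M N : Multiset α}
    (h : a ::ₘ M = b ::ₘ c ::ₘ N) :
    (a = b ∧ M = c ::ₘ N) ∨ (a = c ∧ M = b ::ₘ N) ∨ ∃ N', N = a ::ₘ N' ∧ M = b ::ₘ c ::ₘ N' := by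
  rcases Multiset.cons_eq_cons.1 h with ⟨rfl, rfl⟩ | ⟨-, C, rfl, hC⟩
  · exact .inl ⟨rfl, rfl⟩
  · rcases Multiset.cons_eq_cons.1 hC with ⟨rfl, rfl⟩ | ⟨-, C', rfl, rfl⟩
    · exact .inr (.inl ⟨rfl, rfl⟩)
    · exact .inr (.inr ⟨C', rfl, rfl⟩)

/-! ### Preservation of the invariant -/

/-- The continuations of the local computations. -/
def IsLocalNext : Var n → Prop
  | .CA₂ => True
  | .CA₅ => True
  | .Mas₂ => True
  | .CSA₂ _ => True
  | _ => False

theorem local_mem_internal {a : Action n A} {X : Name n} (hX : X ≠ .O)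
    (ha : a ∈ localActions n A X) : a ∈ internal n A := by
  cases X with
  | CA => exact .inl (.inl (.inr ha))
  | Mas => exact .inr ha
  | CSA i => exact .inl (.inr (Set.mem_iUnion.2 ⟨i, ha⟩))
  | O => exact absurd rfl hX

variable {j : ℕ} {b : Bool} {V : Set ℕ} {c : Action n A → ℕ} {s s' : S} {ca mas : Thr n A S}
  {N : Multiset (Thr n A S)} {k : ℕ} {D K : Set ℕ} {a : Action n A} {x x' : Proc n A S} {X : Var n}

/-- A step of a local computation preserves the invariant. -/
theorem Good.local_step (i₀ : Fin n) (hL : L.Valid env)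
    (h : Good env L j b V c s (⟨D, x, X⟩ ::ₘ N)) (hX : IsLocalNext X)
    (hx : Step (spec L) env k s x (some a) K x' s') :
    a ∈ internal n A ∧ b = true ∧ (∃ Y a', a = .loc Y a') ∧
      Good env L j b V (bump c a) s' (⟨D, x', X⟩ ::ₘ N) := by
  obtain ⟨ca, mas, N₀, hM, h⟩ := h
  rcases cons_eq_cons_cons hM with ⟨rfl, rfl⟩ | ⟨rfl, rfl⟩ | ⟨N', rfl, rfl⟩
  · have key : ∀ {x₀ : Proc n A S}, IsLocal (localActions n A .CA) x₀ →
        Reached (spec L) env (localActions n A .CA) x₀ x s →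
        (ClientState env L j (bump c a) s' b ⟨D, x', X⟩) → b = true →
        a ∈ internal n A ∧ b = true ∧ (∃ Y a', a = .loc Y a') ∧
          Good env L j b V (bump c a) s' (⟨D, x', X⟩ ::ₘ mas ::ₘ N₀) := by
      intro x₀ h₀ hr hc hb
      obtain ⟨-, a, ha, hl, hs⟩ := (hr.basic h₀.basic).step hx
      cases hl
      refine ⟨local_mem_internal (by simp) ha, hb, ⟨_, _, ha.choose_spec.symm⟩, _, _, _, rfl,
        hc, h.past, ?_, ?_, ?_, ?_, ?_⟩
      · obtain ⟨a', rfl⟩ := ha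
        exact h.master.frame (by simp) (by simp) (notMem_local (by simp) ⟨a', rfl⟩) hs
      · exact fun θ hθ => (h.servers θ hθ).frame (fun i _ => notMem_local (by simp) ha) hs
      all_goals obtain ⟨a', rfl⟩ := ha
      · simpa using h.load
      · simpa using h.avail
      · simpa using h.le
    cases h.client with
    | prepare D hr hj =>
      refine key hL.ca_local hr (.prepare D (hr.own hx) ?_) rfl
      obtain ⟨-, a, ⟨a', rfl⟩, hl, hs⟩ := (hr.basic hL.ca_local.basic).step hx
      cases hl
      simpa using hj
    | process D hr hj =>
      refine key hL.ca'_local hr (.process D (hr.own hx) ?_) rfl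
      obtain ⟨-, a, ⟨a', rfl⟩, hl, hs⟩ := (hr.basic hL.ca'_local.basic).step hx
      cases hl
      simpa using hj
    | _ => exact absurd hX id
  · cases h.master with
    | work D hr hj =>
      obtain ⟨-, a, ha, hl, hs⟩ := (hr.basic hL.mas_local.basic).step hx
      cases hl
      -- An idle client means `c sMas = j`, whereas a working master has `c rMas = c sDI[i₀] + 1 ≥ j
      -- + 1`.
      have hb : b = true := by
        cases hc : h.client with
        | idle => have := h.le i₀; have := hj i₀; have := h.load i₀; omega
        | _ => rfl
      refine ⟨local_mem_internal (by simp) ha, hb, ⟨_, _, ha.choose_spec.symm⟩, ca,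
        ⟨D, x', .Mas₂⟩, N₀, Multiset.cons_swap _ _ _, ?_, h.past, .work D (hr.own hx) ?_, ?_, ?_, ?_, ?_⟩
      · obtain ⟨a', rfl⟩ := ha
        exact h.client.frame (by simp) (by simp) (notMem_local (by simp) ⟨a', rfl⟩) hs
      rotate_left
      · exact fun θ hθ => (h.servers θ hθ).frame (fun i _ => notMem_local (by simp) ha) hs
      all_goals obtain ⟨a', rfl⟩ := ha
      · simpa using h.load
      · simpa using h.avail
      · simpa using h.le
      · simpa using hj
    | _ => exact absurd hX id
  · cases h.servers _ (Multiset.mem_cons_self _ _) with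
    | work D i hr =>
      obtain ⟨-, a, ha, hl, hs⟩ := (hr.basic (hL.csa_local i).basic).step hx
      cases hl
      have hload := h.load i
      rw [load_cons] at hload
      simp only [busy, if_true] at hload
      have hle := h.le i
      have hb : b = true := by
        cases hc : h.client with
        | idle D' h' => omega
        | _ => rfl
      refine ⟨local_mem_internal (by simp) ha, hb, ⟨_, _, ha.choose_spec.symm⟩, ca, mas,
        ⟨D, x', .CSA₂ i⟩ ::ₘ N', ?_, ?_, h.past, ?_, ?_, ?_, ?_, ?_⟩
      · rw [Multiset.cons_swap, Multiset.cons_swap _ mas]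
      · obtain ⟨a', rfl⟩ := ha
        exact h.client.frame (by simp) (by simp) (notMem_local (by simp) ⟨a', rfl⟩) hs
      · obtain ⟨a', rfl⟩ := ha
        exact h.master.frame (by simp) (by simp) (notMem_local (by simp) ⟨a', rfl⟩) hs
      · intro θ hθ
        rcases Multiset.mem_cons.1 hθ with rfl | hθ
        · exact .work D i (hr.own hx)
        -- No other copy of the same server can be computing: two busy copies would give `c rDI[i] ≥
        -- c sDO[i] + 2 ≥ j + 2`.
        · refine (h.servers θ (Multiset.mem_cons_of_mem hθ)).frame (fun i' hi' => ?_) hs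
          refine notMem_local (fun e => ?_) ha
          cases e
          have := busy_le_load i hθ
          rw [hi'] at this
          simp only [busy, if_true] at this
          omega
      all_goals obtain ⟨a', rfl⟩ := ha
      · simpa using h.load
      · simpa using h.avail
      · simpa using h.le
    | _ => exact absurd hX id

theorem Inv.good (h : Inv env L j b V c s ca mas N) :
    Good env L j b V c s (ca ::ₘ mas ::ₘ N) := ⟨_, _, _, rfl, h⟩

theorem Inv.good_master (h : Inv env L j b V c s ca mas N) :
    Good env L j b V c s (mas ::ₘ ca ::ₘ N) := ⟨_, _, _, Multiset.cons_swap _ _ _, h⟩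

theorem Inv.good_server {θ : Thr n A S} (h : Inv env L j b V c s ca mas (θ ::ₘ N)) :
    Good env L j b V c s (θ ::ₘ ca ::ₘ mas ::ₘ N) :=
  ⟨_, _, _, by rw [Multiset.cons_swap, Multiset.cons_swap _ mas], h⟩

/-- An idle client has not yet contacted the master in its round. Any communication that presupposes
this contact therefore occurs in the active phase, where silent events are allowed. -/
theorem Inv.active_of_lt (h : Inv env L j b V c s ca mas N) (hj : j < c sMas) : b = true := by
  cases h.client with
  | idle D h => omega
  | _ => rfl

theorem Inv.recv_le_send (i₀ : Fin n) (h : Inv env L j b V c s ca mas N) {p q : Action n A}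
    (hpq : Constraint n A (p, q)) : c q ≤ c p := by
  cases hpq with
  | csa i => exact (h.le i).2.2.1
  | ca i => exact (h.le i).2.1
  | mas => exact (h.le i₀).2.2.2.2.1

theorem count_univ (i : Fin n) : (Finset.univ : Finset (Fin n)).val.count i = 1 :=
  Multiset.count_eq_one_of_mem Finset.univ.nodup (Finset.mem_univ i)

theorem mem_newServers_map {D : Set ℕ} {θ : Thr n A S}
    (hθ : θ ∈ (newServers n A S).map (Thread.after D)) :
    ∃ i, θ = ⟨D ∪ ∅, .act rDI[i], .CSA₁ i⟩ := by
  obtain ⟨θ', hθ', rfl⟩ := Multiset.mem_map.1 hθ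
  obtain ⟨i, rfl⟩ := List.mem_ofFn.1 (Multiset.mem_coe.1 hθ')
  exact ⟨i, rfl⟩

theorem newServer_mem_map (D : Set ℕ) (i : Fin n) :
    (⟨D ∪ ∅, .act rDI[i], .CSA₁ i⟩ : Thr n A S) ∈ (newServers n A S).map (Thread.after D) :=
  Multiset.mem_map.2 ⟨⟨∅, .act rDI[i], .CSA₁ i⟩, Multiset.mem_coe.2 (List.mem_ofFn.2 ⟨i, rfl⟩), rfl⟩

theorem load_newServers_map (i : Fin n) (D : Set ℕ) :
    load i ((newServers n A S).map (Thread.after D)) = 0 := by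
  refine Multiset.sum_eq_zero fun l hl => ?_
  obtain ⟨θ, hθ, rfl⟩ := Multiset.mem_map.1 hl
  obtain ⟨i', rfl⟩ := mem_newServers_map hθ
  rfl

theorem map_eq_zero_of_done {B : Multiset (Fin n)} {f : Fin n → Action n A}
    (hx : Remaining x (B.map f)) {D' : Set ℕ} (hD : Done (spec L) s x D') : B = 0 :=
  Multiset.map_eq_zero.1 (hx.eq_zero_of_done hD)

/-- A thread that has executed its term continues with its next variable. -/
theorem Good.next (h : Good env L j b V c s (⟨D, x, X⟩ ::ₘ N)) {D' : Set ℕ}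
    (hD : Done (spec L) s x D') :
    Good env L j b V c s ((threads L X).map (Thread.after (D ∪ D')) + N) := by
  obtain ⟨ca, mas, N₀, hM, h⟩ := h
  -- The `∅` is the past of a fresh thread in `threads`, extended by `Thread.after`.
  have past : V ⊆ D → V ⊆ D ∪ D' ∪ ∅ := fun hV => by
    rw [Set.union_empty]
    exact hV.trans Set.subset_union_left
  rcases cons_eq_cons_cons hM with ⟨rfl, rfl⟩ | ⟨rfl, rfl⟩ | ⟨N', rfl, rfl⟩
  · cases h.client with
    | prepare D _ hj => exact Inv.good { h with client := .send _ hj, past := past h.past }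
    | collect D hx hj hB =>
      obtain rfl := map_eq_zero_of_done hx hD
      exact Inv.good { h with client := .process _ .start hB, past := past h.past }
    | process D _ hj => exact Inv.good { h with client := .respond _ hj, past := past h.past }
    | idle | send | respond => exact absurd hD not_done_act
  · cases h.master with
    | idle => exact absurd hD not_done_act
    | work D _ hj =>
      -- The creation itself is not an event: the new servers and the sending thread appear
      -- together.
      refine ⟨ca, ⟨D ∪ D' ∪ ∅, parFin fun i => .act sDI[i], .Mas⟩,
        (newServers n A S).map (Thread.after (D ∪ D')) + N₀, ?_, ?_⟩
      · simp only [threads, Multiset.map_add, Multiset.map_singleton, Thread.after,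
          Multiset.add_cons, add_assoc, Multiset.singleton_add]
      · refine { h with master := .assign _ (remaining_parFin _) ?_, servers := ?_, load := ?_,
                        avail := ?_ }
        · intro i
          rw [count_univ]
          exact hj i
        · intro θ hθ
          rcases Multiset.mem_add.1 hθ with hθ | hθ
          · obtain ⟨i, rfl⟩ := mem_newServers_map hθ
            exact .idle _ _
          · exact h.servers θ hθ
        · intro i
          rw [load_add, load_newServers_map, zero_add]
          exact h.load i
        -- The copies just created make every server available.
        · intro i _
          exact ⟨_, Multiset.mem_add.2 (.inl (newServer_mem_map _ i)), rfl⟩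
    | assign D hx hB =>
      obtain rfl := map_eq_zero_of_done hx hD
      exact Inv.good_master { h with
        master := .idle _ hB
        avail := fun i _ => h.avail i (.inl rfl) }
  · cases h.servers _ (Multiset.mem_cons_self _ _) with
    | idle | reply => exact absurd hD not_done_act
    | work D i _ =>
      refine Inv.good_server (θ := ⟨D ∪ D' ∪ ∅, .act sDO[i], .CSA i⟩) { h with
        servers := fun θ hθ => ?_, load := fun i' => ?_, avail := fun i' h' => ?_ }
      · rcases Multiset.mem_cons.1 hθ with rfl | hθ
        · exact .reply _ _
        · exact h.servers θ (Multiset.mem_cons_of_mem hθ)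
      · have := h.load i'
        rw [load_cons] at this ⊢
        exact this
      · obtain ⟨θ, hθ, hs⟩ := h.avail i' h'
        rcases Multiset.mem_cons.1 hθ with rfl | hθ
        · exact ⟨_, Multiset.mem_cons_self _ _, hs⟩
        · exact ⟨θ, Multiset.mem_cons_of_mem hθ, hs⟩

/-- A process with the threads `M` has as well the threads `M'`. -/
def Refines (L : Computations n A S) (M M' : Multiset (Thr n A S)) : Prop :=
  ∀ t, Flat (spec L) (actorVars n) t M → Flat (spec L) (actorVars n) t M'

/-- The occurrence of `a` satisfies its constraint. -/
def Allowed (c : Action n A → ℕ) (a : Action n A) : Prop := ∀ p, Constraint n A (p, a) → c a < c p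

/-- The threads `M'`, which are reached by the event number `k` with the action `a` and the causes
`K`, satisfy the invariant again. -/
inductive Outcome (env : DataEnv (Action n A) S) (L : Computations n A S) (j : ℕ) (b : Bool)
    (V : Set ℕ) (c : Action n A → ℕ) (k : ℕ) (a : Action n A) (K : Set ℕ)
    (M' : Multiset (Thr n A S)) (s' : S) : Prop
  | hidden {M''} (ha : a ∈ internal n A) (hb : b = true) (hr : Refines L M' M'')
      (h : Good env L j b V (bump c a) s' M'')
  | visible {M'' j'} (ha : a = ext n A b) (hV : V ⊆ K) (hr : Refines L M' M'')
      (h : Good env L j' (!b) (insert k V) (bump c a) s' M'')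

theorem refines_fin (i₀ : Fin n) (hL : L.Valid env) (D D' : Set ℕ) (X : Var n)
    (N : Multiset (Thr n A S)) :
    Refines L (⟨D, .fin D', X⟩ ::ₘ N) ((threads L X).map (Thread.after (D ∪ D')) + N) :=
  fun _ h => h.of_fin (flat_threads i₀ hL)

theorem exists_of_cons_eq_map {B : Multiset (Fin n)} {f : Fin n → Action n A} {a : Action n A}
    {B' : Multiset (Action n A)} (h : B.map f = a ::ₘ B') :
    ∃ i B₀, B = i ::ₘ B₀ ∧ a = f i ∧ B' = B₀.map f := by
  obtain ⟨i, hi, rfl⟩ := Multiset.mem_map.1 (h ▸ Multiset.mem_cons_self a B')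
  obtain ⟨B₀, rfl⟩ := Multiset.exists_cons_of_mem hi
  rw [Multiset.map_cons] at h
  exact ⟨i, B₀, rfl, rfl, ((Multiset.cons_inj_right _).1 h).symm⟩

/-- The client is the only source of visible events. As its past contains `V`, the causes of each of
its events do so too. When a single action has been executed, `refines_fin` replaces the finished
thread by its continuation, to restore one of the listed states. -/
theorem Good.client_step (i₀ : Fin n) (hL : L.Valid env)
    (h : Inv env L j b V c s ⟨D, x, X⟩ mas N) (hX : ¬ IsLocalNext X)
    (hx : Step (spec L) env k s x (some a) K x' s') (ha : Allowed c a) :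
    Outcome env L j b V c k a (D ∪ K) (⟨D, x', X⟩ ::ₘ mas ::ₘ N) s' := by
  have h₀ := h.le i₀
  have h₁ := h.load i₀
  have past : V ⊆ D → V ⊆ D ∪ {k} ∪ ∅ := fun hV => by
    rw [Set.union_empty]
    exact hV.trans Set.subset_union_left
  -- After a visible event, its own number joins the past of the client through `{k}`.
  have past' : V ⊆ D → insert k V ⊆ D ∪ {k} ∪ ∅ := fun hV =>
    Set.insert_subset (.inl (.inr rfl)) (past hV)
  cases h.client with
  | prepare | process => exact absurd trivial hX
  | idle D hj =>
    obtain ⟨hs, hl, rfl, rfl⟩ := step_act_iff.1 hx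
    cases hl
    refine .visible (j' := j) rfl (h.past.trans Set.subset_union_left)
      (refines_fin i₀ hL _ _ _ _) (Inv.good (ca := ⟨D ∪ {k} ∪ ∅, L.ca, .CA₂⟩)
        ⟨.prepare _ .start ?_, past' h.past, ?_, ?_, ?_, ?_, ?_⟩)
    · simpa [bump] using hj
    · exact h.master.frame (by simp [bump]) (by simp [bump]) (recv_notMem_local _ _ _) hs
    · exact fun θ hθ => (h.servers θ hθ).frame (fun _ _ => recv_notMem_local _ _ _) hs
    · simpa [bump] using h.load
    · simpa [bump] using h.avail
    · simpa [bump] using h.le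
  | send D hj =>
    obtain ⟨hs, hl, rfl, rfl⟩ := step_act_iff.1 hx
    cases hl
    refine .hidden (mem_internal_of_constraint .mas).1 rfl (refines_fin i₀ hL _ _ _ _)
      (Inv.good (ca := ⟨D ∪ {k} ∪ ∅, parFin fun i => .act rDO[i], .CA₄⟩)
        ⟨.collect _ (remaining_parFin _) ?_ ?_, past h.past, ?_, ?_, ?_, ?_, ?_⟩)
    · simpa [bump] using hj
    · intro i
      have := h.le i
      have := h.load i
      rw [count_univ]
      simp only [bump, reduceCtorEq, if_false]
      omega
    · exact h.master.frame (by simp [bump]) (by simp [bump]) (send_notMem_local _ _ _) hs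
    · exact fun θ hθ => (h.servers θ hθ).frame (fun _ _ => send_notMem_local _ _ _) hs
    · simpa [bump] using h.load
    · simpa [bump] using h.avail
    · intro i
      have := h.le i
      simp [bump]
      omega
  | collect D hr hj hB =>
    obtain ⟨B', hB', hr'⟩ := hr.step hx
    obtain ⟨i, B₀, rfl, rfl, rfl⟩ := exists_of_cons_eq_map hB'
    obtain ⟨-, _, -, hl, hs⟩ := hr.basic.step hx
    cases hl
    -- The constraint gives `c rDO[i] < c sDO[i]`, which keeps the counters ordered after the
    -- reading.
    have hlt := ha _ (.ca i)
    refine .hidden (mem_internal_of_constraint (.ca i)).2 rfl (fun _ => id)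
      (Inv.good ⟨.collect D hr' ?_ ?_, h.past, ?_, ?_, ?_, ?_, ?_⟩)
    · simpa [bump] using hj
    · intro i'
      have := hB i'
      rw [Multiset.count_cons] at this
      simp only [bump, Action.recv.injEq, Msg.DO_CSA.injEq, true_and]
      split_ifs at this ⊢ <;> omega
    · exact h.master.frame (by simp [bump]) (by simp [bump]) (recv_notMem_local _ _ _) hs
    · exact fun θ hθ => (h.servers θ hθ).frame (fun _ _ => recv_notMem_local _ _ _) hs
    · simpa [bump] using h.load
    · simpa [bump] using h.avail
    · intro i'
      have := h.le i'
      by_cases hi : i' = i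
      · subst hi
        simp [bump]
        omega
      · simp [bump, hi]
        omega
  | respond D hj =>
    obtain ⟨hs, hl, rfl, rfl⟩ := step_act_iff.1 hx
    cases hl
    have := hj i₀
    -- The response closes the round: all the counters equal `j + 1`, the starting value of the next
    -- round.
    refine .visible (j' := j + 1) rfl (h.past.trans Set.subset_union_left)
      (refines_fin i₀ hL _ _ _ _) (Inv.good (ca := ⟨D ∪ {k} ∪ ∅, .act rReq, .CA₁⟩)
        ⟨.idle _ ?_, past' h.past, ?_, ?_, ?_, ?_, ?_⟩)
    · simp [bump]
      omega
    · exact h.master.frame (by simp [bump]) (by simp [bump]) (send_notMem_local _ _ _) hs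
    · exact fun θ hθ => (h.servers θ hθ).frame (fun _ _ => send_notMem_local _ _ _) hs
    · simpa [bump] using h.load
    · simpa [bump] using h.avail
    · intro i
      have := h.le i
      have := hj i
      simp [bump]
      omega

theorem Good.master_step (i₀ : Fin n) (hL : L.Valid env)
    (h : Inv env L j b V c s ca ⟨D, x, X⟩ N) (hX : ¬ IsLocalNext X)
    (hx : Step (spec L) env k s x (some a) K x' s') (ha : Allowed c a) :
    Outcome env L j b V c k a (D ∪ K) (⟨D, x', X⟩ ::ₘ ca ::ₘ N) s' := by
  have h₀ := h.le i₀
  have h₁ := h.load i₀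
  cases h.master with
  | work => exact absurd trivial hX
  | idle D hj =>
    obtain ⟨hs, hl, rfl, rfl⟩ := step_act_iff.1 hx
    cases hl
    -- Since `j ≤ c rMas`, the constraint `c rMas < c sMas` shows that the client is active.
    have hlt := ha _ .mas
    refine .hidden (mem_internal_of_constraint .mas).2 (h.active_of_lt (by omega))
      (refines_fin i₀ hL _ _ _ _) (Inv.good_master (mas := ⟨D ∪ {k} ∪ ∅, L.mas, .Mas₂⟩)
        ⟨?_, h.past, .work _ .start ?_, ?_, ?_, ?_, ?_⟩)
    · exact h.client.frame (by simp [bump]) (by simp [bump]) (recv_notMem_local _ _ _) hs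
    · simpa [bump] using hj
    · exact fun θ hθ => (h.servers θ hθ).frame (fun _ _ => recv_notMem_local _ _ _) hs
    · simpa [bump] using h.load
    · simpa [bump] using h.avail
    · intro i
      have := h.le i
      simp [bump]
      omega
  | assign D hr hB =>
    obtain ⟨B', hB', hr'⟩ := hr.step hx
    obtain ⟨i, B₀, rfl, rfl, rfl⟩ := exists_of_cons_eq_map hB'
    obtain ⟨-, _, -, hl, hs⟩ := hr.basic.step hx
    cases hl
    have hi := hB i
    rw [Multiset.count_cons_self] at hi
    have := h.le i
    have := h.load i
    refine .hidden (mem_internal_of_constraint (.csa i)).1 (h.active_of_lt (by omega))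
      (fun _ => id) (Inv.good_master ⟨?_, h.past, .assign D hr' ?_, ?_, ?_, ?_, ?_⟩)
    · exact h.client.frame (by simp [bump]) (by simp [bump]) (send_notMem_local _ _ _) hs
    · intro i'
      have := hB i'
      rw [Multiset.count_cons] at this
      simp only [bump, Action.send.injEq, Name.CSA.injEq, Msg.DI_CSA.injEq, and_self, reduceCtorEq,
        if_false]
      split_ifs at this ⊢ <;> omega
    · exact fun θ hθ => (h.servers θ hθ).frame (fun _ _ => send_notMem_local _ _ _) hs
    · simpa [bump] using h.load
    -- This may be the first assignment ever, so availability comes from the earlier creation and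
    -- not from the counter.
    · exact fun i _ => h.avail i (.inl rfl)
    · intro i'
      have := h.le i'
      by_cases hi : i' = i
      · subst hi
        simp [bump]
        omega
      · simp [bump, hi]
        omega

theorem Good.server_step (i₀ : Fin n) (hL : L.Valid env)
    (h : Inv env L j b V c s ca mas (⟨D, x, X⟩ ::ₘ N)) (hX : ¬ IsLocalNext X)
    (hx : Step (spec L) env k s x (some a) K x' s') (ha : Allowed c a) :
    Outcome env L j b V c k a (D ∪ K) (⟨D, x', X⟩ ::ₘ ca ::ₘ mas ::ₘ N) s' := by
  -- A copy that moves on still serves the same index, so no server becomes unavailable.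
  have avail : ∀ (i : Fin n) (θ : Thr n A S) (i' : Fin n), (∀ i', serves i' X → serves i' θ.next) →
      (mas.next = .Mas ∨ 0 < c sDI[i']) → ∃ θ' ∈ θ ::ₘ N, serves i' θ'.next := by
    intro i θ i' hs h'
    obtain ⟨θ', hθ', hs'⟩ := h.avail i' h'
    rcases Multiset.mem_cons.1 hθ' with rfl | hθ'
    · exact ⟨_, Multiset.mem_cons_self _ _, hs _ hs'⟩
    · exact ⟨θ', Multiset.mem_cons_of_mem hθ', hs'⟩
  cases h.servers _ (Multiset.mem_cons_self _ _) with
  | work => exact absurd trivial hX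
  | idle D i =>
    obtain ⟨hs, hl, rfl, rfl⟩ := step_act_iff.1 hx
    cases hl
    have hlt := ha _ (.csa i)
    have := h.le i
    have := h.load i
    refine .hidden (mem_internal_of_constraint (.csa i)).2 (h.active_of_lt (by omega))
      (refines_fin i₀ hL _ _ _ _) (Inv.good_server (θ := ⟨D ∪ {k} ∪ ∅, L.csa i, .CSA₂ i⟩)
        ⟨?_, h.past, ?_, ?_, ?_, ?_, ?_⟩)
    · exact h.client.frame (by simp [bump]) (by simp [bump]) (recv_notMem_local _ _ _) hs
    · exact h.master.frame (by simp [bump]) (by simp [bump]) (recv_notMem_local _ _ _) hs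
    · intro θ hθ
      rcases Multiset.mem_cons.1 hθ with rfl | hθ
      · exact .work _ _ .start
      · exact (h.servers θ (Multiset.mem_cons_of_mem hθ)).frame
          (fun _ _ => recv_notMem_local _ _ _) hs
    · intro i'
      have := h.load i'
      rw [load_cons] at this ⊢
      by_cases hi : i' = i
      · subst hi
        simp [bump, busy] at this ⊢
        omega
      · simpa [bump, busy, hi, Ne.symm hi] using this
    · intro i' h'
      exact avail i _ i' (fun _ h => h) (by simpa [bump] using h')
    · intro i'
      have := h.le i'
      by_cases hi : i' = i
      · subst hi
        simp [bump]
        omega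
      · simp [bump, hi]
        omega
  | reply D i =>
    obtain ⟨hs, hl, rfl, rfl⟩ := step_act_iff.1 hx
    cases hl
    have hle := h.le i
    have hload := h.load i
    rw [load_cons] at hload
    simp only [busy, if_true] at hload
    refine .hidden (mem_internal_of_constraint (.ca i)).1 (h.active_of_lt (by omega))
      (refines_fin i₀ hL _ _ _ _) (Inv.good_server (θ := ⟨D ∪ {k} ∪ ∅, .act rDI[i], .CSA₁ i⟩)
        ⟨?_, h.past, ?_, ?_, ?_, ?_, ?_⟩)
    · exact h.client.frame (by simp [bump]) (by simp [bump]) (send_notMem_local _ _ _) hs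
    · exact h.master.frame (by simp [bump]) (by simp [bump]) (send_notMem_local _ _ _) hs
    · intro θ hθ
      rcases Multiset.mem_cons.1 hθ with rfl | hθ
      · exact .idle _ _
      · exact (h.servers θ (Multiset.mem_cons_of_mem hθ)).frame
          (fun _ _ => send_notMem_local _ _ _) hs
    · intro i'
      have := h.load i'
      rw [load_cons] at this ⊢
      by_cases hi : i' = i
      · subst hi
        simp [bump, busy] at this ⊢
        omega
      · simpa [bump, busy, hi, Ne.symm hi] using this
    · intro i' h'
      exact avail i _ i' (fun _ h => h) (by simpa [bump] using h')
    · intro i'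
      have := h.le i'
      by_cases hi : i' = i
      · subst hi
        simp [bump]
        omega
      · simp [bump, hi]
        omega

theorem Good.step (i₀ : Fin n) (hL : L.Valid env)
    (h : Good env L j b V c s (⟨D, x, X⟩ ::ₘ N))
    (hx : Step (spec L) env k s x (some a) K x' s') (ha : Allowed c a) :
    Outcome env L j b V c k a (D ∪ K) (⟨D, x', X⟩ ::ₘ N) s' := by
  by_cases hX : IsLocalNext X
  · obtain ⟨hi, hb, -, h'⟩ := h.local_step i₀ hL hX hx
    exact .hidden hi hb (fun _ => id) h'
  · obtain ⟨ca, mas, N₀, hM, h⟩ := h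
    rcases cons_eq_cons_cons hM with ⟨rfl, rfl⟩ | ⟨rfl, rfl⟩ | ⟨N', rfl, rfl⟩
    · exact client_step i₀ hL h hX hx ha
    · exact master_step i₀ hL h hX hx ha
    · exact server_step i₀ hL h hX hx ha

theorem Good.basic (hL : L.Valid env) (h : Good env L j b V c s (⟨D, x, X⟩ ::ₘ N)) :
    Basic Set.univ x := by
  obtain ⟨ca, mas, N₀, hM, h⟩ := h
  have up : ∀ {Y : Name n} {x₀ : Proc n A S}, IsLocal (localActions n A Y) x₀ →
      Reached (spec L) env (localActions n A Y) x₀ x s → Basic Set.univ x :=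
    fun h₀ hr => (hr.basic h₀.basic).mono (Set.subset_univ _)
  rcases cons_eq_cons_cons hM with ⟨rfl, rfl⟩ | ⟨rfl, rfl⟩ | ⟨N', rfl, rfl⟩
  · cases h.client with
    | idle | send | respond => exact .act trivial
    | prepare D hr => exact up hL.ca_local hr
    | process D hr => exact up hL.ca'_local hr
    | collect D hr => exact hr.basic
  · cases h.master with
    | idle => exact .act trivial
    | work D hr => exact up hL.mas_local hr
    | assign D hr => exact hr.basic
  · cases h.servers _ (Multiset.mem_cons_self _ _) with
    | idle | reply => exact .act trivial
    | work D i hr => exact up (hL.csa_local i) hr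

/-- When a finished thread fires through its continuation, the induction descends to the threads of
that continuation. They live in the context of the other threads and after some events, whence the
generality in `N₀` and `D₀`. -/
theorem Good.fires_after (i₀ : Fin n) (hL : L.Valid env) {M M' : Multiset (Thr n A S)}
    {l : Option (Action n A)} (hF : Fires (spec L) env (threads L) k s M l K M' s') (D₀ : Set ℕ)
    (N₀ : Multiset (Thr n A S)) (h : Good env L j b V c s (M.map (Thread.after D₀) + N₀)) :
    ∃ a, l = some a ∧ (Allowed c a →
      Outcome env L j b V c k a (D₀ ∪ K) (M'.map (Thread.after D₀) + N₀) s') := by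
  induction hF generalizing D₀ N₀ with
  | @step D x x' X l K s' N hx =>
    rw [Multiset.map_cons, Multiset.cons_add] at h
    obtain ⟨-, a, -, rfl, -⟩ := (h.basic hL).step hx
    refine ⟨a, rfl, fun ha => ?_⟩
    rw [Multiset.map_cons, Multiset.cons_add, ← Set.union_assoc]
    exact h.step i₀ hL hx ha
  | @next D D' x X l K s' M N hD hF ih =>
    rw [Multiset.map_cons, Multiset.cons_add] at h
    rw [Multiset.map_add, Thread.map_after_after, add_assoc, ← Set.union_assoc, ← Set.union_assoc]
    exact ih _ _ (h.next hD)

theorem Good.fires (i₀ : Fin n) (hL : L.Valid env) {M M' : Multiset (Thr n A S)}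
    {l : Option (Action n A)} (hF : Fires (spec L) env (threads L) k s M l K M' s')
    (h : Good env L j b V c s M) :
    ∃ a, l = some a ∧ (Allowed c a → Outcome env L j b V c k a K M' s') := by
  have := fires_after (j := j) (b := b) (V := V) (c := c) i₀ hL hF ∅ 0
  rw [Thread.after_empty, Multiset.map_id, Multiset.map_id, add_zero, add_zero,
    Set.empty_union] at this
  exact this h

/-! ### The system -/

/-- `τ_I(∂_H(t))` after the actions `m`. -/
def sys (m : List (Action n A × ℕ)) (t : Proc n A S) : Proc n A S :=
  .abs (internal n A) (.enc (constraints n A) m t)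

theorem hide_internal (ha : a ∈ internal n A) : hide (internal n A) (some a) = none := by
  simp [hide, ha]

theorem hide_ext (b : Bool) : hide (internal n A) (some (ext n A b)) = some (ext n A b) := by
  simp [hide, ext_notMem_internal]

theorem Allowed.of_not_inH {m : List (Action n A × ℕ)} (h : ¬ InH (constraints n A) m a) :
    Allowed (cnt m) a :=
  fun p hp => not_le.1 fun hle => h (.inl ⟨p, hp, hle⟩)

/-- `InH` also forbids sending after the corresponding reading; under the invariant no reading is
ahead of its sending, so only the readings have to be checked. -/
theorem Good.not_inH (i₀ : Fin n) {m : List (Action n A × ℕ)} {M : Multiset (Thr n A S)}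
    (h : Good env L j b V (cnt m) s M) (ha : Allowed (cnt m) a) :
    ¬ InH (constraints n A) m a := by
  obtain ⟨ca, mas, N, -, h⟩ := h
  rintro (⟨p, hp, hle⟩ | ⟨q, hq, hlt⟩)
  · exact (ha p hp).not_ge hle
  · exact hlt.not_ge (h.recv_le_send i₀ hq)

/-- The invariant of the system. -/
def SysInv (env : DataEnv (Action n A) S) (L : Computations n A S) (b : Bool) (V : Set ℕ)
    (_ : ℕ) (s : S) (x : Proc n A S) : Prop :=
  ∃ m t M j, x = sys m t ∧ Flat (spec L) (actorVars n) t M ∧ Good env L j b V (cnt m) s M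

theorem SysInv.step (i₀ : Fin n) (hL : L.Valid env) (h : SysInv env L b V k s x)
    {l : Option (Action n A)} (hx : Step (spec L) env k s x l K x' s') :
    (l = none ∧ b = true ∧ SysInv env L b V (k + 1) s' x') ∨
      (l = some (ext n A b) ∧ V ⊆ K ∧ SysInv env L (!b) (insert k V) (k + 1) s' x') := by
  obtain ⟨m, t, M, j, rfl, ht, hg⟩ := h
  cases hx with
  | abs hx =>
    cases hx with
    | enc_tau hx =>
      -- The threads execute only proper actions: silent events arise from hiding alone.
      obtain ⟨M', hF, -⟩ := ht.fires (flat_threads i₀ hL) hx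
      obtain ⟨a, ha, -⟩ := hg.fires i₀ hL hF
      cases ha
    | enc_act hx hH =>
      obtain ⟨M', hF, ht'⟩ := ht.fires (flat_threads i₀ hL) hx
      obtain ⟨a, ha, hout⟩ := hg.fires i₀ hL hF
      cases ha
      cases hout (.of_not_inH hH) with
      | hidden ha hb hr h' =>
        rw [← cnt_append m _ k] at h'
        exact .inl ⟨hide_internal ha, hb, _, _, _, _, rfl, hr _ ht', h'⟩
      | visible ha hV hr h' =>
        rw [← cnt_append m _ k] at h'
        subst ha
        exact .inr ⟨hide_ext b, hV.trans Set.subset_union_left, _, _, _, _, rfl, hr _ ht', h'⟩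

theorem not_done_seq {y : Proc n A S} (hx : created x = none)
    (hy : ∀ D, ¬ Done (spec L) s y D) (D : Set ℕ) : ¬ Done (spec L) s (.seq x y) D := by
  intro h
  cases h with
  | seq _ _ h => exact hy _ h
  | seq_new hc => rw [hx] at hc; cases hc

theorem not_done_var (h : ∀ D, ¬ Done (spec L) s (spec L X) D) (D : Set ℕ) :
    ¬ Done (spec L) s (.var X) D := by
  intro hD
  cases hD with
  | var hD => exact h D hD

/-- The client alone prevents termination: from each of its states, the continuation has an atomic
action to execute, whatever the local computations are. -/
theorem SysInv.not_done (hL : L.Valid env) (h : SysInv env L b V k s x) (D : Set ℕ) :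
    ¬ Done (spec L) s x D := by
  obtain ⟨m, t, M, j, rfl, ht, ca, mas, N, rfl, hg⟩ := h
  intro hD
  cases hD with
  | abs hD =>
    cases hD with
    | enc hD =>
      obtain ⟨D', hD'⟩ := ht.done hD (Multiset.mem_cons_self ca _)
      have h₂ : ∀ D, ¬ Done (spec L) s (.var .CA₂) D :=
        not_done_var fun _ => not_done_act_seq
      have h₅ : ∀ D, ¬ Done (spec L) s (.var .CA₅) D :=
        not_done_var fun _ => not_done_act_seq
      have h₄ : ∀ D, ¬ Done (spec L) s (.var .CA₄) D :=
        not_done_var (not_done_seq hL.ca'_local.basic.created_eq_none h₅)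
      cases hg.client with
      | idle => exact not_done_var (not_done_seq hL.ca_local.basic.created_eq_none h₂) _ hD'
      | prepare => exact h₂ _ hD'
      | send =>
        exact not_done_var (not_done_seq (remaining_parFin _).basic.created_eq_none h₄) _ hD'
      | collect => exact h₄ _ hD'
      | process => exact h₅ _ hD'
      | respond => exact not_done_var (fun _ => not_done_act_seq) _ hD'

/-! ### Responsiveness -/

/-- The number of the communications that remain to be executed in the round number `j`. -/
def todo (j : ℕ) (c : Action n A → ℕ) : ℕ :=
  (j + 1 - c sMas) + (j + 1 - c rMas) +
    ∑ i : Fin n, ((j + 1 - c sDI[i]) + (j + 1 - c rDI[i]) +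
      ((j + 1 - c sDO[i]) + (j + 1 - c rDO[i])))

/-- The communications that were executed are the same. -/
structure SameComm (c c' : Action n A → ℕ) : Prop where
  send : ∀ Y d, c' (.send Y d) = c (.send Y d)
  recv : ∀ Y d, c' (.recv Y d) = c (.recv Y d)

theorem SameComm.todo_eq {c' : Action n A → ℕ} (h : SameComm c c') (j : ℕ) :
    todo j c' = todo j c := by
  simp only [todo, h.send, h.recv]

/-- The bound `c a ≤ j` makes the truncated difference for `a` drop strictly, and no other summand
grows. -/
theorem todo_bump_lt {p q : Action n A} (hpq : Constraint n A (p, q)) (ha : a = p ∨ a = q)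
    (hj : c a ≤ j) : todo j (bump c a) < todo j c := by
  have mono : ∀ y, j + 1 - bump c a y ≤ j + 1 - c y := fun y => by
    unfold bump
    omega
  have strict : j + 1 - bump c a a < j + 1 - c a := by
    simp only [bump, if_true]
    omega
  have hsum : ∀ i : Fin n, (j + 1 - bump c a sDI[i]) + (j + 1 - bump c a rDI[i]) +
      ((j + 1 - bump c a sDO[i]) + (j + 1 - bump c a rDO[i])) ≤
      (j + 1 - c sDI[i]) + (j + 1 - c rDI[i]) + ((j + 1 - c sDO[i]) + (j + 1 - c rDO[i])) :=
    fun i => add_le_add (add_le_add (mono _) (mono _)) (add_le_add (mono _) (mono _))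
  have key : ∀ i : Fin n, a = sDI[i] ∨ a = rDI[i] ∨ a = sDO[i] ∨ a = rDO[i] →
      todo j (bump c a) < todo j c := by
    intro i hi
    refine add_lt_add_of_le_of_lt (add_le_add (mono _) (mono _))
      (Finset.sum_lt_sum (fun i _ => hsum i) ⟨i, Finset.mem_univ i, ?_⟩)
    have h₁ := mono sDI[i]
    have h₂ := mono rDI[i]
    have h₃ := mono sDO[i]
    have h₄ := mono rDO[i]
    rcases hi with rfl | rfl | rfl | rfl <;> omega
  cases hpq with
  | csa i => exact key i (ha.elim .inl (.inr ∘ .inl))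
  | ca i => exact key i (ha.elim (.inr ∘ .inr ∘ .inl) (.inr ∘ .inr ∘ .inr))
  | mas =>
    refine add_lt_add_of_lt_of_le ?_ (Finset.sum_le_sum fun i _ => hsum i)
    rcases ha with rfl | rfl
    · exact add_lt_add_of_lt_of_le strict (mono _)
    · exact add_lt_add_of_le_of_lt (mono _) strict

section

variable {m : List (Action n A × ℕ)} {t : Proc n A S} {M M' : Multiset (Thr n A S)}

theorem step_sys {t' : Proc n A S} {K : Set ℕ} (h : Step (spec L) env k s t (some a) K t' s')
    (hH : ¬ InH (constraints n A) m a) :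
    Step (spec L) env k s (sys m t) (hide (internal n A) (some a))
      (K ∪ sources (constraints n A) m a) (sys (m ++ [(a, k)]) t') s' :=
  .abs (.enc_act h hH)

theorem Good.responds_now (i₀ : Fin n) (hL : L.Valid env)
    (ht : Flat (spec L) (actorVars n) t M) (hg : Good env L j b V (cnt m) s M)
    (hF : Fires (spec L) env (threads L) k s M (some (ext n A b)) K M' s') :
    Responds (spec L) env k s (sys m t) := by
  obtain ⟨t', hx, -⟩ := ht.exists_step (flat_threads i₀ hL) hF
  have hH : ¬ InH (constraints n A) m (ext n A b) :=
    -- No constraint has a visible action as its reading action.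
    hg.not_inH i₀ fun p hp => by cases b <;> cases hp
  have := step_sys hx hH
  rw [hide_ext] at this
  exact .now this

/-- The process responds if it responds after an enabled communication. -/
theorem Good.responds_comm (i₀ : Fin n) (hL : L.Valid env)
    (ht : Flat (spec L) (actorVars n) t M) (hg : Good env L j b V (cnt m) s M)
    (hF : Fires (spec L) env (threads L) k s M (some a) K M' s') {p q : Action n A}
    (hpq : Constraint n A (p, q)) (ha : a = p ∨ a = q) (hall : Allowed (cnt m) a)
    (hj : cnt m a ≤ j)
    (ih : ∀ m' t' M', todo j (cnt m') < todo j (cnt m) → Flat (spec L) (actorVars n) t' M' →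
      Good env L j b V (cnt m') s' M' → Responds (spec L) env (k + 1) s' (sys m' t')) :
    Responds (spec L) env k s (sys m t) := by
  obtain ⟨t', hx, ht'⟩ := ht.exists_step (flat_threads i₀ hL) hF
  have hi : a ∈ internal n A := by
    rcases ha with rfl | rfl
    · exact (mem_internal_of_constraint hpq).1
    · exact (mem_internal_of_constraint hpq).2
  have := step_sys hx (hg.not_inH i₀ hall)
  rw [hide_internal hi] at this
  obtain ⟨a', ha', hout⟩ := hg.fires i₀ hL hF
  cases ha'
  cases hout hall with
  | hidden _ _ hr h' =>
    rw [← cnt_append m a k] at h'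
    refine .tau this (ih _ _ _ ?_ (hr _ ht') h')
    rw [cnt_append]
    exact todo_bump_lt hpq ha hj
  | visible ha' => exact absurd (ha' ▸ hi) (ext_notMem_internal b)

/-- The process responds if it responds after a local computation has been finished. -/
theorem Good.responds_local (i₀ : Fin n) (hL : L.Valid env)
    (hx : Finishes (spec L) env x s) (hX : IsLocalNext X)
    (ht : Flat (spec L) (actorVars n) t (⟨D, x, X⟩ ::ₘ N))
    (hg : Good env L j b V (cnt m) s (⟨D, x, X⟩ ::ₘ N))
    (ih : ∀ k s m' t' x' D', SameComm (cnt m) (cnt m') →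
      Flat (spec L) (actorVars n) t' (⟨D, x', X⟩ ::ₘ N) →
      Good env L j b V (cnt m') s (⟨D, x', X⟩ ::ₘ N) → Done (spec L) s x' D' →
      Responds (spec L) env k s (sys m' t')) :
    Responds (spec L) env k s (sys m t) := by
  induction hx generalizing k m t with
  | done hD => exact ih _ _ _ _ _ _ ⟨fun _ _ => rfl, fun _ _ => rfl⟩ ht hg hD
  | @step x s s' a K x' hx _ ih' =>
    obtain ⟨hi, -, ⟨Y, a, rfl⟩, hg'⟩ := hg.local_step i₀ hL hX (hx k)
    obtain ⟨t', hx', ht'⟩ := ht.exists_step (flat_threads i₀ hL)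
      (Fires.step (D := D) (X := X) N (hx k))
    -- A local action occurs in no constraint: it is never blocked, and it does not count as a
    -- communication.
    have := step_sys hx' (hg.not_inH i₀ (m := m) fun p hp => by cases hp)
    rw [hide_internal hi] at this
    have hs := fun Z d => bump_loc_send (cnt m) Y Z a d
    have hr := fun Z d => bump_loc_recv (cnt m) Y Z a d
    rw [← cnt_append m _ k] at hg' hs hr
    exact .tau this (ih' k ht' hg' fun k s m' t' x' D' hm' => ih k s m' t' x' D'
      ⟨fun Z d => (hm'.send Z d).trans (hs Z d), fun Z d => (hm'.recv Z d).trans (hr Z d)⟩)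

theorem exists_step_act (env : DataEnv (Action n A) S) (a : Action n A) (k : ℕ) (s : S) :
    ∃ s', Step (spec L) env k s (.act a) (some a) ∅ (.fin {k}) s' := by
  obtain ⟨s', hs⟩ := env.effect_nonempty a s
  exact ⟨s', .act hs⟩

theorem exists_fires_remaining {B : Multiset (Fin n)} {f : Fin n → Action n A}
    (hx : Remaining x (B.map f)) {i : Fin n} (hi : i ∈ B) (env : DataEnv (Action n A) S)
    (k : ℕ) (s : S) (D : Set ℕ) (X : Var n) (N : Multiset (Thr n A S)) :
    ∃ K M' s', Fires (spec L) env (threads L) k s (⟨D, x, X⟩ ::ₘ N) (some (f i)) K M' s' := by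
  obtain ⟨s', hs⟩ := env.effect_nonempty (f i) s
  obtain ⟨K, x', h⟩ := hx.exists_step (E := spec L) k (Multiset.mem_map_of_mem f hi) hs
  exact ⟨_, _, _, .step N h⟩

theorem exists_fires_act (env : DataEnv (Action n A) S) (a : Action n A)
    (k : ℕ) (s : S) (D : Set ℕ) (X : Var n) (N : Multiset (Thr n A S)) :
    ∃ K M' s', Fires (spec L) env (threads L) k s (⟨D, .act a, X⟩ ::ₘ N) (some a) K M' s' := by
  obtain ⟨s', h⟩ := exists_step_act (L := L) env a k s
  exact ⟨_, _, _, .step N h⟩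

theorem Fires.exists_next {D' : Set ℕ} (hD : Done (spec L) s x D') (D : Set ℕ)
    (N : Multiset (Thr n A S))
    (h : ∃ K M' s', Fires (spec L) env (threads L) k s (threads L X) (some a) K M' s') :
    ∃ K M' s', Fires (spec L) env (threads L) k s (⟨D, x, X⟩ ::ₘ N) (some a) K M' s' := by
  obtain ⟨K, M', s', h⟩ := h
  exact ⟨_, _, _, .next N hD h⟩

theorem Inv.collect_done (h : Inv env L j b V c s ⟨D, x, .CA₄⟩ mas N)
    (hj : ∀ i : Fin n, c rDO[i] = j + 1) : ∃ D', Done (spec L) s x D' := by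
  cases h.client with
  | @collect D x B hx _ hB =>
    obtain rfl : B = 0 := Multiset.eq_zero_of_forall_notMem fun i hi => by
      have := hB i
      have := hj i
      have := Multiset.count_pos.2 hi
      omega
    exact hx.exists_done

/-- The client responds when it has received all the chunks. -/
theorem Good.responds_client (i₀ : Fin n) (hL : L.Valid env)
    (ht : Flat (spec L) (actorVars n) t (ca ::ₘ mas ::ₘ N))
    (hg : Inv env L j b V (cnt m) s ca mas N) (hj : ∀ i : Fin n, cnt m rDO[i] = j + 1) :
    Responds (spec L) env k s (sys m t) := by
  have h₀ := hg.le i₀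
  have h₁ := hg.load i₀
  have h₂ := hj i₀
  have hresp : ∀ k s, ∃ K M' s', Fires (spec L) env (threads L) k s (threads L .CA₅)
      (some (ext n A true)) K M' s' := fun k s => exists_fires_act env _ k s _ _ 0
  have process : ∀ {k s m t x} {D : Set ℕ}, b = true → Finishes (spec L) env x s →
      Flat (spec L) (actorVars n) t (⟨D, x, .CA₅⟩ ::ₘ mas ::ₘ N) →
      Good env L j b V (cnt m) s (⟨D, x, .CA₅⟩ ::ₘ mas ::ₘ N) →
      Responds (spec L) env k s (sys m t) := by
    rintro k s m t x D rfl hfin ht hg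
    refine Good.responds_local (X := .CA₅) i₀ hL hfin trivial ht hg
      fun k s m' t' x' D' _ ht' hg' hD => ?_
    obtain ⟨K, M', s', hF⟩ := Fires.exists_next hD D (mas ::ₘ N) (hresp k s)
    exact Good.responds_now i₀ hL ht' hg' hF
  cases hc : hg.client with
  | idle | prepare | send => omega
  | @collect D x B hx _ hB =>
    obtain ⟨D', hD⟩ := hg.collect_done hj
    -- The finished collection may be a parallel composition of `fin`s, which `refines_fin` does not
    -- cover. The computation `L.ca'` is therefore entered by its first event, through `Fires.next`;
    -- if it can terminate at once, both are passed and the response itself is fired.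
    have hr : Reached (spec L) env (localActions n A .CA) L.ca' L.ca' s := .start
    cases hr.finishes hL.ca'_local.basic hL.ca'_completes with
    | done hD₂ =>
      obtain ⟨K, M', s', hF⟩ := Fires.exists_next (X := .CA₄) hD D (mas ::ₘ N)
        (Fires.exists_next (X := .CA₅) hD₂ ∅ 0 (hresp k s))
      exact Good.responds_now i₀ hL ht hg.good hF
    | @step _ _ s' a K x' hx' hfin =>
      obtain ⟨hi, hb, ⟨Y, a, rfl⟩, hg'⟩ :=
        Good.local_step i₀ hL (X := .CA₅) (hg.good.next hD) trivial (hx' k)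
      obtain ⟨t', hx'', ht'⟩ := ht.exists_step (flat_threads i₀ hL)
        (Fires.next (D := D) (X := .CA₄) (mas ::ₘ N) hD
          (Fires.step (D := ∅) (X := .CA₅) 0 (hx' k)))
      have := step_sys hx'' (hg.good.not_inH i₀ (m := m) fun p hp => by cases hp)
      rw [hide_internal hi] at this
      rw [← cnt_append m _ k] at hg'
      rw [Multiset.cons_zero, Multiset.map_singleton, Multiset.singleton_add] at ht'
      exact .tau this (process rfl (hfin k) ht' hg')
  | process D hr =>
    exact process rfl (hr.finishes hL.ca'_local.basic hL.ca'_completes) ht hg.good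
  | respond D =>
    obtain ⟨K, M', s', hF⟩ := exists_fires_act (L := L) env sResp k s D .CA (mas ::ₘ N)
    exact Good.responds_now i₀ hL ht hg.good hF

/-- Each case takes the first communication of the protocol whose counter is still `j` and
identifies the thread that owes it. Local computations on the way do not change `todo`, and the
communication decreases it. -/
theorem Good.responds (i₀ : Fin n) (hL : L.Valid env)
    (ht : Flat (spec L) (actorVars n) t M) (hg : Good env L j b V (cnt m) s M) :
    Responds (spec L) env k s (sys m t) := by
  generalize hμ : todo j (cnt m) = μ
  induction μ using Nat.strong_induction_on generalizing k s m t M with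
  | _ μ ih =>
  have comm : ∀ {k s s' m t M K M' a p q}, todo j (cnt m) = μ →
      Flat (spec L) (actorVars n) t M → Good env L j b V (cnt m) s M → Constraint n A (p, q) →
      a = p ∨ a = q → Allowed (cnt m) a → cnt m a ≤ j →
      Fires (spec L) env (threads L) k s M (some a) K M' s' →
      Responds (spec L) env k s (sys m t) := fun hm ht hg hpq ha hall hj hF =>
    Good.responds_comm i₀ hL ht hg hF hpq ha hall hj
      fun _ _ _ hlt ht' hg' => ih _ (hlt.trans_eq hm) ht' hg' rfl
  obtain ⟨ca, mas, N, rfl, h⟩ := hg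
  have h₀ := h.le i₀
  have h₁ := h.load i₀
  have sendsAllowed : ∀ (c : Action n A → ℕ) (Y : Name n) (d : Msg n), Allowed c (.send Y d) :=
    fun c Y d p hp => by cases hp
  have ht_master : Flat (spec L) (actorVars n) t (mas ::ₘ ca ::ₘ N) := by
    rwa [Multiset.cons_swap]
  by_cases hMas : cnt m sMas = j
  · cases hc : h.client with
    | idle D =>
      obtain ⟨K, M', s', hF⟩ := exists_fires_act (L := L) env rReq k s D .CA₁ (mas ::ₘ N)
      exact h.good.responds_now i₀ hL ht hF
    | prepare D hr =>
      refine h.good.responds_local (X := .CA₂) i₀ hL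
        (hr.finishes hL.ca_local.basic hL.ca_completes) trivial ht
        fun k s m' t' x' D' hm' ht' hg' hD => ?_
      obtain ⟨K, M', s', hF⟩ := Fires.exists_next (X := .CA₂) hD D (mas ::ₘ N)
        (exists_fires_act env sMas k s _ _ 0)
      exact comm ((hm'.todo_eq j).trans hμ) ht' hg' .mas (.inl rfl) (sendsAllowed _ _ _)
        ((hm'.send _ _).trans hMas).le hF
    | send D =>
      obtain ⟨K, M', s', hF⟩ := exists_fires_act (L := L) env sMas k s D .CA₃ (mas ::ₘ N)
      exact comm hμ ht h.good .mas (.inl rfl) (sendsAllowed _ _ _) hMas.le hF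
    | collect => omega
    | process D _ hj => have := hj i₀; omega
    | respond D hj => have := hj i₀; omega
  by_cases hMas' : cnt m rMas = j
  · have hidle : ∀ q, Constraint n A (q, rMas) → cnt m rMas < cnt m q := by
      intro q hq
      cases hq
      omega
    cases hc : h.master with
    | idle D hj =>
      obtain ⟨K, M', s', hF⟩ := exists_fires_act (L := L) env rMas k s D .Mas₁ (ca ::ₘ N)
      exact comm hμ ht_master h.good_master .mas (.inr rfl) hidle hMas'.le hF
    | work D hr hj => have := hj i₀; omega
    -- The assignments of the previous round are complete, so the thread passes to `Mas` without an
    -- event and reads the new request.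
    | @assign D x B hx hB =>
      obtain rfl : B = 0 := Multiset.eq_zero_of_forall_notMem fun i hi => by
        have := hB i
        have := h.le i
        have := h.load i
        have := Multiset.count_pos.2 hi
        omega
      obtain ⟨D', hD⟩ := hx.exists_done (E := spec L) (s := s)
      obtain ⟨K, M', s', hF⟩ := Fires.exists_next (X := .Mas) hD D (ca ::ₘ N)
        (exists_fires_act env rMas k s _ _ 0)
      exact comm hμ ht_master h.good_master .mas (.inr rfl) hidle hMas'.le hF
  by_cases hsDI : ∃ i : Fin n, cnt m sDI[i] = j
  · obtain ⟨i, hi⟩ := hsDI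
    have := h.le i
    have := h.load i
    cases hc : h.master with
    | idle D hj => have := hj i; omega
    | work D hr hj =>
      refine h.good_master.responds_local (X := .Mas₂) i₀ hL
        (hr.finishes hL.mas_local.basic hL.mas_completes) trivial ht_master
        fun k s m' t' x' D' hm' ht' hg' hD => ?_
      have hsend : ∃ K M' s', Fires (spec L) env (threads L) k s (threads L .Mas₂)
          (some sDI[i]) K M' s' := by
        -- The new servers become the context of the sending thread.
        rw [threads, add_comm, Multiset.singleton_add]
        exact exists_fires_remaining (remaining_parFin _) (Finset.mem_univ i) env _ _ _ _ _
      obtain ⟨K, M', s', hF⟩ := Fires.exists_next hD D (ca ::ₘ N) hsend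
      exact comm ((hm'.todo_eq j).trans hμ) ht' hg' (.csa i) (.inl rfl) (sendsAllowed _ _ _)
        ((hm'.send _ _).trans hi).le hF
    | @assign D x B hx hB =>
      have := hB i
      obtain ⟨K, M', s', hF⟩ := exists_fires_remaining (L := L) hx
        (Multiset.count_pos.1 (by omega : 0 < B.count i)) env k s D .Mas (ca ::ₘ N)
      exact comm hμ ht_master h.good_master (.csa i) (.inl rfl) (sendsAllowed _ _ _) hi.le hF
  by_cases hrDI : ∃ i : Fin n, cnt m rDI[i] = j
  · obtain ⟨i, hi⟩ := hrDI
    have := h.le i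
    have hload := h.load i
    have : cnt m sDI[i] ≠ j := fun e => hsDI ⟨i, e⟩
    -- Since `c sDI[i] = j + 1`, there is a copy; since `c rDI[i] = c sDO[i] = j`, its load is `0`,
    -- so it is waiting.
    obtain ⟨θ, hθ, hs⟩ := h.avail i (.inr (by omega))
    have hbusy := busy_le_load i hθ
    obtain ⟨N', rfl⟩ := Multiset.exists_cons_of_mem hθ
    cases hc : h.servers θ hθ with
    | idle D i' =>
      obtain rfl : i' = i := hs
      obtain ⟨K, M', s', hF⟩ :=
        exists_fires_act (L := L) env rDI[i'] k s D (.CSA₁ i') (ca ::ₘ mas ::ₘ N')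
      refine comm hμ ?_ h.good_server (.csa i') (.inr rfl) ?_ hi.le hF
      · rwa [Multiset.cons_swap, Multiset.cons_swap _ mas]
      · intro q hq
        cases hq
        omega
    | work D i' =>
      obtain rfl : i' = i := hs
      simp only [busy, if_true] at hbusy
      omega
    | reply D i' =>
      obtain rfl : i' = i := hs
      simp only [busy, if_true] at hbusy
      omega
  by_cases hsDO : ∃ i : Fin n, cnt m sDO[i] = j
  · obtain ⟨i, hi⟩ := hsDO
    have := h.le i
    have hload := h.load i
    have : cnt m rDI[i] ≠ j := fun e => hrDI ⟨i, e⟩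
    -- `c rDI[i] = j + 1` and `c sDO[i] = j` leave a load of `1`: some copy owes the reply.
    obtain ⟨θ, hθ, hs⟩ : ∃ θ ∈ N, busy i θ.next ≠ 0 := by
      by_contra! hN
      have : load i N = 0 := Multiset.sum_eq_zero fun l hl => by
        obtain ⟨θ, hθ, rfl⟩ := Multiset.mem_map.1 hl
        exact hN θ hθ
      omega
    obtain ⟨N', rfl⟩ := Multiset.exists_cons_of_mem hθ
    have ht_server : Flat (spec L) (actorVars n) t (θ ::ₘ ca ::ₘ mas ::ₘ N') := by
      rwa [Multiset.cons_swap, Multiset.cons_swap _ mas]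
    cases hc : h.servers θ hθ with
    | idle D i' => exact absurd rfl hs
    | work D i' hr =>
      obtain rfl : i' = i := by
        by_contra hne
        exact hs (if_neg hne)
      refine h.good_server.responds_local (X := .CSA₂ i') i₀ hL
        (hr.finishes (hL.csa_local i').basic (hL.csa_completes i')) trivial ht_server
        fun k s m' t' x' D' hm' ht' hg' hD => ?_
      obtain ⟨K, M', s', hF⟩ := Fires.exists_next (X := .CSA₂ i') hD D (ca ::ₘ mas ::ₘ N')
        (exists_fires_act env sDO[i'] k s _ _ 0)
      exact comm ((hm'.todo_eq j).trans hμ) ht' hg' (.ca i') (.inl rfl) (sendsAllowed _ _ _)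
        ((hm'.send _ _).trans hi).le hF
    | reply D i' =>
      obtain rfl : i' = i := by
        by_contra hne
        exact hs (if_neg hne)
      obtain ⟨K, M', s', hF⟩ :=
        exists_fires_act (L := L) env sDO[i'] k s D (.CSA i') (ca ::ₘ mas ::ₘ N')
      exact comm hμ ht_server h.good_server (.ca i') (.inl rfl) (sendsAllowed _ _ _) hi.le hF
  by_cases hrDO : ∃ i : Fin n, cnt m rDO[i] = j
  · obtain ⟨i, hi⟩ := hrDO
    have := h.le i
    have := h.load i
    have : cnt m sDO[i] ≠ j := fun e => hsDO ⟨i, e⟩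
    cases hc : h.client with
    | idle D hj => omega
    | prepare D hr hj => omega
    | send D hj => omega
    | @collect D x B hx hj hB =>
      have := hB i
      obtain ⟨K, M', s', hF⟩ := exists_fires_remaining (L := L) hx
        (Multiset.count_pos.1 (by omega : 0 < B.count i)) env k s D .CA₄ (mas ::ₘ N)
      refine comm hμ ht h.good (.ca i) (.inr rfl) ?_ hi.le hF
      intro q hq
      cases hq
      omega
    | process D hr hj => have := hj i; omega
    | respond D hj => have := hj i; omega
  -- No counter equals `j` any more, so all of them are `j + 1`.
  refine responds_client i₀ hL ht h fun i => ?_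
  have := h.le i
  have := h.load i
  have : cnt m rDO[i] ≠ j := fun e => hrDO ⟨i, e⟩
  omega

end

theorem isLoop_sysInv (i₀ : Fin n) (hL : L.Valid env) :
    IsLoop (spec L) env (ext n A) (SysInv env L) where
  tau h hx := by
    rcases h.step i₀ hL hx with ⟨-, hb, h'⟩ | ⟨hl, -⟩
    · exact ⟨hb, h'⟩
    · cases hl
  act h hx := by
    rcases h.step i₀ hL hx with ⟨hl, -⟩ | ⟨hl, hV, h'⟩
    · cases hl
    · exact ⟨Option.some.inj hl, hV, h'⟩
  responds h := by
    obtain ⟨m, t, M, j, rfl, ht, hg⟩ := h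
    exact hg.responds i₀ hL ht
  not_done h := h.not_done hL _

/-! ### The initial states -/

theorem below_parList {l : List (Proc n A S)} {k : ℕ} (h : ∀ x ∈ l, x.Below k) :
    (parList l).Below k := by
  induction l with
  | nil => exact Set.empty_subset _
  | cons x l ih =>
    cases l with
    | nil => exact h x (List.mem_singleton_self x)
    | cons y l =>
      exact ⟨h x List.mem_cons_self, ih fun z hz => h z (List.mem_cons_of_mem _ hz)⟩

theorem below_parFin {f : Fin n → Proc n A S} {k : ℕ} (h : ∀ i, (f i).Below k) :
    (parFin f).Below k :=
  below_parList fun x hx => by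
    obtain ⟨i, rfl⟩ := List.mem_ofFn.1 hx
    exact h i

theorem below_spec (hL : L.Valid env) (X : Var n) : (spec L X).Below 0 := by
  cases X with
  | CA₁ => exact ⟨hL.ca_local.term_below 0, trivial⟩
  | CA₄ => exact ⟨hL.ca'_local.term_below 0, trivial⟩
  | CSA₁ i => exact ⟨(hL.csa_local i).term_below 0, trivial⟩
  | Mas₁ => exact ⟨hL.mas_local.term_below 0, trivial⟩
  | CA₃ | Mas₂ | Mas₃ => exact ⟨below_parFin fun _ => trivial, trivial⟩
  | Loop => exact ⟨trivial, trivial, trivial⟩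
  | _ => exact ⟨trivial, trivial⟩

/-- Waiting servers carry no load, so any supply of them is allowed at the start. This is why the
initial chunk servers make no difference. -/
theorem inv_init (s : S) (hN : ∀ θ ∈ N, ∃ D i, θ = ⟨D, .act rDI[i], .CSA₁ i⟩) :
    Inv env L 0 false ∅ (cnt []) s ⟨∅, .act rReq, .CA₁⟩ ⟨∅, .act rMas, .Mas₁⟩ N where
  client := .idle _ rfl
  past := Set.empty_subset _
  master := .idle _ fun _ => rfl
  servers θ hθ := by
    obtain ⟨D, i, rfl⟩ := hN θ hθ
    exact .idle _ _
  load i := by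
    have : load i N = 0 := Multiset.sum_eq_zero fun l hl => by
      obtain ⟨θ, hθ, rfl⟩ := Multiset.mem_map.1 hl
      obtain ⟨D, i, rfl⟩ := hN θ hθ
      rfl
    rw [this]
    rfl
  avail i hi := by
    rcases hi with hi | hi
    · cases hi
    · exact absurd hi (lt_irrefl 0)
  le i := ⟨le_rfl, le_rfl, le_rfl, le_rfl, le_rfl, Nat.zero_le _⟩

theorem sysInv_system (i₀ : Fin n) (hL : L.Valid env) (k : ℕ) (s : S) :
    SysInv env L false ∅ k s system :=
  ⟨[], _, _, 0, rfl, .par (flat_threads i₀ hL .CA (by simp [actorVars]))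
    (flat_threads i₀ hL .Mas (by simp [actorVars])), _, _, 0, rfl, inv_init s (by simp)⟩

theorem sysInv_fullSystem (i₀ : Fin n) (hL : L.Valid env) (k : ℕ) (s : S) :
    SysInv env L false ∅ k s fullSystem :=
  ⟨[], _, _, 0, rfl, .par (flat_threads i₀ hL .CA (by simp [actorVars]))
    (.par (flat_threads i₀ hL .Mas (by simp [actorVars])) (flat_servers i₀)), _, _,
    newServers n A S, rfl, inv_init s fun θ hθ => by
      obtain ⟨i, rfl⟩ := List.mem_ofFn.1 (Multiset.mem_coe.1 hθ)
      exact ⟨∅, i, rfl⟩⟩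

end GFS

theorem mainTheorem2 {n : ℕ} (hn : 0 < n) {A S : Type*}
    (env : APTC.DataEnv (GFS.Action n A) S) (L : GFS.Computations n A S) (hL : L.Valid env) :
    APTC.ProcEq (GFS.spec L) env GFS.system GFS.fullSystem ∧
    APTC.ProcEq (GFS.spec L) env GFS.fullSystem (GFS.respond GFS.fullSystem) ∧
    APTC.ProcEq (GFS.spec L) env GFS.system (GFS.respond GFS.system) ∧
    APTC.ProcEq (GFS.spec L) env GFS.system (.var .Loop) := by
  -- A single enlarged invariant contains all the processes to be compared, each in its idle phase;
  -- `n ≥ 1` enters through the index `⟨0, hn⟩`.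
  have hP := (GFS.isLoop_sysInv ⟨0, hn⟩ hL).looped (Z := .Loop) rfl
  have hE := GFS.below_spec hL
  have h₁ := fun k s => APTC.Looped.base (ext := GFS.ext n A) (Z := .Loop)
    (GFS.sysInv_system ⟨0, hn⟩ hL k s)
  have h₂ := fun k s => APTC.Looped.base (ext := GFS.ext n A) (Z := .Loop)
    (GFS.sysInv_fullSystem ⟨0, hn⟩ hL k s)
  have b₁ : (GFS.system : GFS.Proc n A S).Below 0 := ⟨by simp, trivial, trivial⟩
  have b₂ : (GFS.fullSystem : GFS.Proc n A S).Below 0 :=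
    ⟨by simp, trivial, trivial, GFS.below_parFin fun _ => trivial⟩
  exact ⟨hP.procEq hE (h₁ 0) b₁ (h₂ 0) b₂,
    hP.procEq hE (h₂ 0) b₂ (.request h₂ 0) ⟨trivial, trivial, b₂⟩,
    hP.procEq hE (h₁ 0) b₁ (.request h₁ 0) ⟨trivial, trivial, b₁⟩,
    hP.procEq hE (h₁ 0) b₁ (.var 0) trivial⟩
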